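/- **Polygon maps.** Let $d\ge 2$. A polygon is a sequence $(v_k)_{k\in\mathbb Z}$ of points of $\mathbb{RP}^d$; it is a twisted $n$-gon if $v_{k+n}=\phi(v_k)$ for all $k$ and a projective transformation $\phi$. For $d$-element sets $P,Q\subset\mathbb Z$ let $T_{P,Q}$ be the (partially defined) map $\tilde v_k=\bigcap_{q\in Q}\Pi_{k+q}$, where $\Pi_k=\mathrm{span}\langle v_{k+p}\mid p\in P\rangle$. A *bi-diagonal map* is $\tilde v_k=\mathrm{span}\langle v_{k+j}\mid j\in A_+\rangle\cap \mathrm{span}\langle v_{k+j}\mid j\in A_-\rangle$, where $A_\pm\subset\mathbb Z$ are disjoint finite arithmetic progressions with the same common difference, $|A_\pm|\ge 2$ and $(|A_+|-1)+(|A_-|-1)=d$. A *long-diagonal map* is $T_{P,B}$ with $P=\{0,m,\dots,(d-1)m\}$, $m\geq 1$, and $B=B_+\cup B_-$, $|B|=d$, where $B_\pm$ are arithmetic progressions with common difference $m$ whose union is not an arithmetic progression with common difference $m$. **Continuous limit.** Let $G:\mathbb R\to\mathbb R^{d+1}$ be smooth with $\det(G,G',\dots,G^{(d)})=1$ and $G(x+2\pi)=MG(x)$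 for some $M\in \mathrm{SL}_{d+1}(\mathbb R)$, and let $L=\partial^{d+1}+u_{d-1}\partial^{d-1}+\dots+u_0$ be the operator with $2\pi$-periodic coefficients such that $LG=0$. For a $d$-element set $P\subset\mathbb Z$ let $k_1<\dots<k_d$ be the elements of $P$ shifted by a common real constant so that $\sum_l k_l=0$, and let $\Pi_\varepsilon(x)=\mathrm{span}\langle G(x+k_l\varepsilon)\mid 1\le l\le d\rangle$. Let $Z_\varepsilon$ be the lift of the envelope of this family of hyperplanes, i.e. $Z_\varepsilon,\dots,Z_\varepsilon^{(d-1)}$ span $\Pi_\varepsilon(x)$ at each $x$, with $\det(Z_\varepsilon,\dots,Z_\varepsilon^{(d)})=1$ (for even $d$ it is unique, for odd $d$ it is unique up to sign and the sign is chosen so that $Z_\varepsilon\to G$), and let $u_{j,\varepsilon}$ be the coefficients of the operator of the above form annihilating $Z_\varepsilon$. If $$Z_\varepsilon=G+\varepsilon^2F+O(\varepsilon^3),\qquad u_{j,\varepsilon}=u_j+\varepsilon^2w_j+O(\varepsilon^3)\quad(\varepsilon\to0^+),$$ the continuous limit of $T_{P,Q}$, for $Q$ an arithmetic progression of $d$ integers,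 is the evolution $dG/dt=F$, $du_j/dt=w_j$. The continuous limit of a map whose (generic) inverse is such a $T_{P,Q}$ is the time reversal ($t\mapsto -t$) of the continuous limit of its inverse. **Theorem.** Let $T$ be a bi-diagonal or a long-diagonal map in $\mathbb{RP}^d$. Then $T$ is inverse, as a generically defined map, to some $T_{P,Q}$ with $Q$ an arithmetic progression of $d$ integers, and for every $G$ as above the envelopes exist for all small $\varepsilon>0$ and have the above expansions, uniformly for $x$ in bounded sets for $Z_\varepsilon$ and uniformly in $x\in\mathbb R$ for $u_{j,\varepsilon}$. With $Q_2=\partial^2+\frac{2}{d+1}u_{d-1}$ there is a constant $C>0$, independent of $G$, such that the continuous limit of $T$ is $$\frac{dG}{dt}=-C\,Q_2G,\qquad \frac{dL}{dt}=-C\,[Q_2,L].$$ So, after the time change $t\mapsto -t/C$, it is the $(2,d+1)$-KdV flow $\frac{dL}{dt}=\left[\partial^2+\frac{2}{d+1}u_{d-1},L\right]$ of the Adler–Gelfand–Dickey hierarchy on the circle. If $d=2$, there is a constant $r>0$ such that for each smooth $2\pi$-periodic solution $L(t)=\partial^3+u(t,x)\partial+v(t,x)$ of the continuous limit, the function $y(t,x)=u(rt,x)$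 satisfies the Boussinesq equation $y_{tt}+2(y^2)_{xx}+y_{xxxx}=0$. -/

import Mathlib

open scoped ContDiff

namespace Pentagram

/-- Homogeneous coordinates on real projective `d`-space. -/
abbrev Vec (d : ℕ) : Type := Fin (d + 1) → ℝ

/-- Bi-infinite polygons in real projective `d`-space. -/
abbrev Polygon (d : ℕ) : Type := ℤ → Projectivization ℝ (Vec d)

/-- Partially defined self-maps of the space of polygons, given by their graphs:
`T v w` says that `T` is defined at `v` and that its value there is `w`. -/
abbrev PolygonMap (d : ℕ) : Type := Polygon d → Polygon d → Prop

/-- Twisted `n`-gons: `v (k + n) = φ (v k)` for a projective transformation `φ`. -/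
def IsTwisted {d : ℕ} (n : ℕ) (v : Polygon d) : Prop :=
  ∃ φ : Vec d ≃ₗ[ℝ] Vec d, ∀ k : ℤ,
    v (k + n) = Projectivization.map φ.toLinearMap φ.injective (v k)

/-- The arithmetic progression `{a, a + m, …, a + (n - 1) m}`. -/
noncomputable def progression (a : ℤ) (m n : ℕ) : Finset ℤ :=
  (Finset.range n).image fun i : ℕ => a + (m : ℤ) * (i : ℤ)

/-- Finite arithmetic progressions with common difference `m` (the empty one included). -/
def IsProgression (m : ℕ) (S : Finset ℤ) : Prop :=
  ∃ (a : ℤ) (n : ℕ), S = progression a m n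

/-- The span of the vertices `v (k + j)`, `j ∈ S`, as a linear subspace of `ℝ ^ (d + 1)`. A
projective plane of dimension `r` is a linear subspace of dimension `r + 1`. -/
noncomputable def diagonal {d : ℕ} (v : Polygon d) (S : Finset ℤ) (k : ℤ) : Submodule ℝ (Vec d) :=
  ⨆ j ∈ S, (v (k + j)).submodule

/-- The bi-diagonal map: the vertex `w k` is the intersection of the two planes spanned by
`v (k + j)`, `j ∈ Ap`, and by `v (k + j)`, `j ∈ Am`. It is defined when the planes have the
expected dimensions `#Ap - 1` and `#Am - 1` and meet in one point. -/
def biDiagonalMap (d : ℕ) (Ap Am : Finset ℤ) : PolygonMap d := fun v w =>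
  ∀ k : ℤ,
    Module.finrank ℝ (diagonal v Ap k) = Ap.card ∧
    Module.finrank ℝ (diagonal v Am k) = Am.card ∧
    diagonal v Ap k ⊓ diagonal v Am k = (w k).submodule

/-- The map `T_{P,Q}`: the vertex `w k` is the intersection of the diagonal hyperplanes
`Π_{k + q}`, `q ∈ Q`, where `Π_k` is spanned by the `v (k + p)`, `p ∈ P`. It is defined when
all `Π_k` are hyperplanes and the intersections are points. -/
def pentagramMap (d : ℕ) (P Q : Finset ℤ) : PolygonMap d := fun v w =>
  ∀ k : ℤ,
    Module.finrank ℝ (diagonal v P k) = d ∧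
    (⨅ q ∈ Q, diagonal v P (k + q)) = (w k).submodule

/-- `T` is the bi-diagonal map of two disjoint arithmetic progressions with the same common
difference, with at least two elements each, whose sizes minus one add up to `d`. -/
def IsBiDiagonal (d : ℕ) (T : PolygonMap d) : Prop :=
  ∃ (m : ℕ) (Ap Am : Finset ℤ), 0 < m ∧ IsProgression m Ap ∧ IsProgression m Am ∧
    Disjoint Ap Am ∧ 2 ≤ Ap.card ∧ 2 ≤ Am.card ∧ (Ap.card - 1) + (Am.card - 1) = d ∧
    T = biDiagonalMap d Ap Am

/-- `T` is the long-diagonal map of a `d`-element set that is the union of two non-consecutive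
arithmetic progressions with common difference `m`; the hyperplanes are the `m`-diagonal ones.
(If one of the progressions is empty or they overlap, the union is a progression.) -/
def IsLongDiagonal (d : ℕ) (T : PolygonMap d) : Prop :=
  ∃ (m : ℕ) (Bp Bm : Finset ℤ), 0 < m ∧ IsProgression m Bp ∧ IsProgression m Bm ∧
    ¬ IsProgression m (Bp ∪ Bm) ∧ (Bp ∪ Bm).card = d ∧
    T = pentagramMap d (progression 0 m d) (Bp ∪ Bm)

/-- `S` is the inverse of `T` as a generically defined map: both compositions are the identity
wherever they are defined, and they are defined at some twisted `n`-gon for every `n`. -/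
structure IsGenericInverse {d : ℕ} (T S : PolygonMap d) : Prop where
  left : ∀ v w v', T v w → S w v' → v' = v
  right : ∀ w v w', S w v → T v w' → w' = w
  nonempty : ∀ n : ℕ, 0 < n → ∃ v w, IsTwisted n v ∧ T v w ∧ S w v

/-- `det (G, G', …, G^(d))` at `x`. -/
noncomputable def wronskian {d : ℕ} (G : ℝ → Vec d) (x : ℝ) : ℝ :=
  Matrix.det (Matrix.of fun i j : Fin (d + 1) => iteratedDeriv (j : ℕ) G x i)

/-- Normalized lifts `G` of smooth non-degenerate quasi-periodic curves in projective space,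
with monodromy `M`. -/
structure IsNormalizedCurve {d : ℕ} (M : Matrix.SpecialLinearGroup (Fin (d + 1)) ℝ)
    (G : ℝ → Vec d) : Prop where
  smooth : ContDiff ℝ ∞ G
  wronskian_eq : ∀ x, wronskian G x = 1
  quasiperiodic : ∀ x, G (x + 2 * Real.pi) = (M : Matrix (Fin (d + 1)) (Fin (d + 1)) ℝ).mulVec (G x)

/-- Coefficients `u_0, …, u_{d-1}` of an operator
`L = ∂^(d+1) + u_{d-1} ∂^(d-1) + … + u_1 ∂ + u_0`. -/
abbrev Coeffs (d : ℕ) : Type := Fin d → ℝ → ℝ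

/-- Smooth coefficients on the circle `ℝ / 2πℤ`. -/
def IsSmoothPeriodic {d : ℕ} (u : Coeffs d) : Prop :=
  ∀ j, ContDiff ℝ ∞ (u j) ∧ Function.Periodic (u j) (2 * Real.pi)

/-- The operator `L` applied to a function `f` with values in a normed space. -/
noncomputable def opL {d : ℕ} (u : Coeffs d) {E : Type*} [NormedAddCommGroup E]
    [NormedSpace ℝ E] (f : ℝ → E) : ℝ → E := fun x =>
  iteratedDeriv (d + 1) f x + ∑ j : Fin d, u j x • iteratedDeriv (j : ℕ) f x

/-- The coefficient `u_{d-1}`. -/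
noncomputable def topCoeff {d : ℕ} (u : Coeffs d) : ℝ → ℝ :=
  if h : 0 < d then u ⟨d - 1, Nat.sub_lt h Nat.one_pos⟩ else 0

/-- The operator `Q₂ = ∂² + (2 / (d + 1)) u_{d-1}` applied to a function `f`. -/
noncomputable def opQ {d : ℕ} (u : Coeffs d) {E : Type*} [NormedAddCommGroup E]
    [NormedSpace ℝ E] (f : ℝ → E) : ℝ → E := fun x =>
  iteratedDeriv 2 f x + ((2 / ((d : ℝ) + 1)) * topCoeff u x) • f x

/-- The vector field `L ↦ W(L)` on operators `L` is that of the `(2, d+1)`-KdV equation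
`dL/dt = [Q₂, L]`: for each `L` with smooth coefficients `u`, the differential operator
`∑ W(u)_j ∂^j` is the commutator `Q₂ L - L Q₂`. -/
def IsKdVField {d : ℕ} (W : Coeffs d → Coeffs d) : Prop :=
  ∀ u : Coeffs d, (∀ j, ContDiff ℝ ∞ (u j)) → ∀ f : ℝ → ℝ, ContDiff ℝ ∞ f → ∀ x : ℝ,
    ∑ j : Fin d, W u j x * iteratedDeriv (j : ℕ) f x = opQ u (opL u f) x - opL u (opQ u f) x

/-- The hyperplane `Π_ε(x)` spanned by the points of the curve with parameters `x + k ε`, where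
`k` runs over the elements of `P` shifted by a constant so that their sum is zero. -/
noncomputable def curveHyperplane {d : ℕ} (P : Finset ℤ) (G : ℝ → Vec d) (ε x : ℝ) :
    Submodule ℝ (Vec d) :=
  Submodule.span ℝ
    ((fun p : ℤ => G (x + ((p : ℝ) - (∑ q ∈ P, (q : ℝ)) / (P.card : ℝ)) * ε)) '' (P : Set ℤ))

/-- `Z` is a normalized lift of the envelope of the hyperplanes `Π_ε(x)` (`ε` fixed): they are
the osculating hyperplanes of the curve `Z`. -/
structure IsEnvelopeLift {d : ℕ} (P : Finset ℤ) (G : ℝ → Vec d) (ε : ℝ) (Z : ℝ → Vec d) :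
    Prop where
  smooth : ContDiff ℝ ∞ Z
  osculating : ∀ x, Submodule.span ℝ (Set.range fun j : Fin d => iteratedDeriv (j : ℕ) Z x) =
    curveHyperplane P G ε x
  wronskian_eq : ∀ x, wronskian Z x = 1

/-- For small `ε > 0` the envelope of the hyperplanes `Π_ε(x)` exists, its normalized lift `Z_ε`
is unique up to sign, satisfies a linear differential equation with coefficients `u_{j,ε}`, and
`Z_ε = G + ε² F + O(ε³)`, `u_{j,ε} = u_j + ε² w_j + O(ε³)`. -/
def HasEnvelopeExpansion {d : ℕ} (P : Finset ℤ) (G : ℝ → Vec d) (u : Coeffs d)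
    (F : ℝ → Vec d) (w : Coeffs d) : Prop :=
  ∃ ε₀ : ℝ, 0 < ε₀ ∧ ∃ (Z : ℝ → ℝ → Vec d) (uε : ℝ → Coeffs d),
    (∀ ε ∈ Set.Ioo 0 ε₀,
      IsEnvelopeLift P G ε (Z ε) ∧
      (∀ Z', IsEnvelopeLift P G ε Z' → Z' = Z ε ∨ Z' = -Z ε) ∧
      (∀ x, opL (uε ε) (Z ε) x = 0)) ∧
    (∀ R : ℝ, ∃ K : ℝ, ∀ ε ∈ Set.Ioo 0 ε₀, ∀ x ∈ Set.Icc (-R) R,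
      ‖Z ε x - G x - ε ^ 2 • F x‖ ≤ K * ε ^ 3) ∧
    (∃ K : ℝ, ∀ ε ∈ Set.Ioo 0 ε₀, ∀ (j : Fin d) (x : ℝ),
      |uε ε j x - u j x - ε ^ 2 * w j x| ≤ K * ε ^ 3)

/-- The continuous limit of `T_{P,Q}`, for an equally spaced `d`-tuple `Q`: the evolution
`dG/dt = Φ(u, G)` of normalized curves, and `du/dt = W(u)` of the operators `L` with `L G = 0`,
in the direction of the envelope. -/
def IsEnvelopeLimit {d : ℕ} (P Q : Finset ℤ) (Φ : Coeffs d → (ℝ → Vec d) → ℝ → Vec d)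
    (W : Coeffs d → Coeffs d) : Prop :=
  P.card = d ∧ (∃ (a : ℤ) (m : ℕ), 0 < m ∧ Q = progression a m d) ∧
  ∀ (M : Matrix.SpecialLinearGroup (Fin (d + 1)) ℝ) (G : ℝ → Vec d), IsNormalizedCurve M G →
    ∃ u : Coeffs d, IsSmoothPeriodic u ∧ (∀ x, opL u G x = 0) ∧
      HasEnvelopeExpansion P G u (Φ u G) (W u)

/-- The continuous limit of a polygon map `T` whose inverse is a map `T_{P,Q}` with equally
spaced `Q`: the time reversal of the continuous limit of the inverse. -/
def IsContinuousLimit {d : ℕ} (T : PolygonMap d) (Φ : Coeffs d → (ℝ → Vec d) → ℝ → Vec d)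
    (W : Coeffs d → Coeffs d) : Prop :=
  ∃ P Q : Finset ℤ, IsGenericInverse T (pentagramMap d P Q) ∧
    IsEnvelopeLimit P Q (fun u G => -Φ u G) (fun u => -W u)

/-- Smooth solutions on the circle of the evolution equation `du/dt = W(u)`. -/
def IsSolution {d : ℕ} (W : Coeffs d → Coeffs d) (U : ℝ → Coeffs d) : Prop :=
  (∀ j, ContDiff ℝ ∞ fun p : ℝ × ℝ => U p.1 j p.2) ∧
  (∀ t, IsSmoothPeriodic (U t)) ∧
  ∀ t j x, deriv (fun s => U s j x) t = W (U t) j x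

/-- The Boussinesq equation `y_tt + 2 (y²)_xx + y_xxxx = 0`. -/
def SolvesBoussinesq (y : ℝ → ℝ → ℝ) : Prop :=
  ∀ t x, iteratedDeriv 2 (fun s => y s x) t + 2 * iteratedDeriv 2 (fun z => y t z ^ 2) x +
    iteratedDeriv 4 (fun z => y t z) x = 0

end Pentagram

namespace Pentagram
open scoped Matrix

/-! The continuous limit of T is defined through its inverse T_{P,Q}. There are therefore two
independent tasks: to find the inverse, and to expand the envelope of the hyperplanes spanned by the
points G(x + k_l ε).

Inverse. Let A_+ start at a with p + 1 terms and A_- start at b with q + 1 terms, p + q = d, and let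
H_s be the span of v_s, v_{s+m}, …, v_{s+(d-1)m}. If w = T(v), the d vertices w_{s-a+mi} (i < q) and
w_{s-b+mi} (i < p) all lie in H_s, and generically they span it. Since v_k is the intersection of
H_k, H_{k-m}, …, H_{k-(d-1)m}, this gives P and an equally spaced Q. A long-diagonal map intersects
the hyperplanes H_{k-j}, j ∈ P, for a P of the same form, so it has the same kind of inverse. The
definition also asks for a twisted n-gon where both compositions make sense. The orbit of (1, …, 1)
under diag(1, …, d + 1) works for every n: Descartes' rule of signs makes any d + 1 of its vertices
independent, and the coprimality of two polynomials makes the images of these vertices span the H_s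
(`exists_orbit_images`).

Envelope. Lagrange interpolation at the nodes k_l produces bases G^(j) + ε² B_j of the hyperplanes.
Because the nodes have sum zero, the G^(d)-component of B_j at ε = 0 vanishes except for j = d - 2,
where it is a constant C > 0 built from Σ k_l² (`exists_hyperplane_basis`). The conormal of the
hyperplane, and then the common kernel of its first d derivatives, give a normalized envelope Z_ε
depending smoothly on (ε, x), with Z_0 = G (`exists_envelope_family`). A variation field of G is
determined by the G^(d)-components of its first d derivatives and by the trace condition that fixes
the Wronskian (`eq_zero_of_osculating_of_trace`). For the first-order term these data are zero. For
the second-order term they are those of C Q₂ G; the factor 2/(d+1) in Q₂ is what makes its trace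
vanish (`exists_envelope_expansion`).

Operators. If Z = G + ε² F, then L Z = ε² L F while L_ε Z = 0, so L_ε - L is read off from -ε² L F.
With F = C Q₂ G and L G = 0 this is ε² C [Q₂, L] G. Periodicity of the coefficients makes the
estimate uniform in x. Passing back from the inverse to T changes the sign of C. For d = 2,
eliminating v from the two evolution equations leaves the Boussinesq equation after rescaling time.
-/

/-! ### Smooth dependence on parameters: integrals, Hadamard's lemma, Taylor's formula -/

open Set Filter Topology MeasureTheory in
theorem contDiff_nat_intervalIntegral {E : Type} [NormedAddCommGroup E] [NormedSpace ℝ E]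
    [CompleteSpace E] (n : ℕ) {f : (ℝ × ℝ) → ℝ → E}
    (hf : ContDiff ℝ ∞ fun p : (ℝ × ℝ) × ℝ => f p.1 p.2) :
    ContDiff ℝ n fun x => ∫ t in (0 : ℝ)..1, f x t := by
  induction n generalizing E with
  | zero =>
    rw [Nat.cast_zero, contDiff_zero]
    exact intervalIntegral.continuous_parametric_intervalIntegral_of_continuous' hf.continuous 0 1
  | succ n ih =>
    have hpart : ContDiff ℝ ∞ fun p : (ℝ × ℝ) × ℝ => fderiv ℝ (fun x => f x p.2) p.1 :=
      ContDiff.fderiv (m := ∞) (n := ∞) (f := fun (p : (ℝ × ℝ) × ℝ) x => f x p.2)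
        (hf.comp (by fun_prop : ContDiff ℝ ∞ fun q : ((ℝ × ℝ) × ℝ) × (ℝ × ℝ) => (q.2, q.1.2)))
        (by fun_prop) (by simp)
    rw [Nat.cast_add, Nat.cast_one, contDiff_succ_iff_hasFDerivAt]
    refine ⟨fun x => ∫ t in (0 : ℝ)..1, fderiv ℝ (fun x => f x t) x, ih hpart, fun x₀ => ?_⟩
    -- A constant bound on this compact set dominates the derivative, which allows differentiation
    -- under the integral sign.
    have hcomp : IsCompact (Metric.closedBall x₀ 1 ×ˢ Icc (0 : ℝ) 1) :=
      (isCompact_closedBall x₀ 1).prod isCompact_Icc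
    obtain ⟨K, hK⟩ := hcomp.exists_bound_of_continuousOn hpart.continuous.continuousOn
    have hslice : ∀ x, Continuous (f x) := fun x =>
      hf.continuous.comp (by fun_prop : Continuous fun t : ℝ => (x, t))
    refine intervalIntegral.hasFDerivAt_integral_of_dominated_of_fderiv_le
      (F' := fun x t => fderiv ℝ (fun x => f x t) x) (bound := fun _ => K)
      (Metric.closedBall_mem_nhds x₀ one_pos)
      (Eventually.of_forall fun x => (hslice x).aestronglyMeasurable)
      ((hslice x₀).intervalIntegrable 0 1) ?_ ?_ ?_ ?_
    · exact (hpart.continuous.comp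
        (by fun_prop : Continuous fun t : ℝ => (x₀, t))).aestronglyMeasurable
    · refine Eventually.of_forall fun t ht x hx => hK (x, t) ⟨hx, ?_⟩
      rw [uIoc_of_le zero_le_one] at ht
      exact ⟨ht.1.le, ht.2⟩
    · exact continuous_const.intervalIntegrable 0 1
    · refine Eventually.of_forall fun t _ x _ => DifferentiableAt.hasFDerivAt ?_
      have : ContDiff ℝ ∞ fun x => f x t :=
        hf.comp (by fun_prop : ContDiff ℝ ∞ fun x : ℝ × ℝ => (x, t))
      exact this.differentiable (by simp) x

theorem contDiff_intervalIntegral {E : Type} [NormedAddCommGroup E] [NormedSpace ℝ E]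
    [CompleteSpace E] {f : (ℝ × ℝ) → ℝ → E}
    (hf : ContDiff ℝ ∞ fun p : (ℝ × ℝ) × ℝ => f p.1 p.2) :
    ContDiff ℝ ∞ fun x => ∫ t in (0 : ℝ)..1, f x t :=
  contDiff_infty.2 fun n => contDiff_nat_intervalIntegral n hf

section
variable {E : Type} [NormedAddCommGroup E] [NormedSpace ℝ E]

theorem contDiff_deriv_fst {H : ℝ → ℝ → E} (hH : ContDiff ℝ ∞ fun p : ℝ × ℝ => H p.1 p.2) :
    ContDiff ℝ ∞ fun p : ℝ × ℝ => deriv (fun s => H s p.2) p.1 := by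
  have := ContDiff.fderiv (m := ∞) (n := ∞) (f := fun (p : ℝ × ℝ) s => H s p.2) (g := Prod.fst)
        (hH.comp (by fun_prop : ContDiff ℝ ∞ fun q : (ℝ × ℝ) × ℝ => (q.2, q.1.2)))
        (by fun_prop) (by simp)
  exact this.clm_apply contDiff_const

theorem contDiff_deriv_snd {H : ℝ → ℝ → E} (hH : ContDiff ℝ ∞ fun p : ℝ × ℝ => H p.1 p.2) :
    ContDiff ℝ ∞ fun p : ℝ × ℝ => deriv (H p.1) p.2 := by
  have := ContDiff.fderiv (m := ∞) (n := ∞) (f := fun (p : ℝ × ℝ) s => H p.1 s) (g := Prod.snd)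
        (hH.comp (by fun_prop : ContDiff ℝ ∞ fun q : (ℝ × ℝ) × ℝ => (q.1.1, q.2)))
        (by fun_prop) (by simp)
  exact this.clm_apply contDiff_const

theorem contDiff_iteratedDeriv_snd {H : ℝ → ℝ → E}
    (hH : ContDiff ℝ ∞ fun p : ℝ × ℝ => H p.1 p.2) (n : ℕ) :
    ContDiff ℝ ∞ fun p : ℝ × ℝ => iteratedDeriv n (H p.1) p.2 := by
  induction n with
  | zero => simpa using hH
  | succ n ih =>
    simp only [iteratedDeriv_succ]
    exact contDiff_deriv_snd (H := fun a => iteratedDeriv n (H a)) ih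

theorem contDiff_slice {H : ℝ → ℝ → E}
    (hH : ContDiff ℝ ∞ fun p : ℝ × ℝ => H p.1 p.2) (s : ℝ) : ContDiff ℝ ∞ (H s) :=
  hH.comp (by fun_prop : ContDiff ℝ ∞ fun x : ℝ => (s, x))

theorem contDiff_iteratedDeriv {f : ℝ → E} (hf : ContDiff ℝ ∞ f) (n : ℕ) :
    ContDiff ℝ ∞ (iteratedDeriv n f) := by
  induction n with
  | zero => simpa using hf
  | succ n ih =>
    rw [iteratedDeriv_succ]
    exact (contDiff_infty_iff_deriv.1 ih).2

/-- Hadamard's lemma. -/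
theorem exists_smooth_quotient [CompleteSpace E] {H : ℝ → ℝ → E}
    (hH : ContDiff ℝ ∞ fun p : ℝ × ℝ => H p.1 p.2) :
    ∃ H₁ : ℝ → ℝ → E, (ContDiff ℝ ∞ fun p : ℝ × ℝ => H₁ p.1 p.2) ∧
      ∀ s x, H s x = H 0 x + s • H₁ s x := by
  refine ⟨fun s x => ∫ t in (0 : ℝ)..1, deriv (fun r => H r x) (t * s), ?_, fun s x => ?_⟩
  · exact contDiff_intervalIntegral (f := fun p t => deriv (fun r => H r p.2) (t * p.1))
      ((contDiff_deriv_fst hH).comp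
        (by fun_prop : ContDiff ℝ ∞ fun q : (ℝ × ℝ) × ℝ => (q.2 * q.1.1, q.1.2)))
  · have hx : ContDiff ℝ ∞ fun r => H r x :=
      hH.comp (by fun_prop : ContDiff ℝ ∞ fun r : ℝ => (r, x))
    have key : ∫ t in (0 : ℝ)..1, s • deriv (fun r => H r x) (t * s) = H (1 * s) x - H (0 * s) x := by
      refine intervalIntegral.integral_eq_sub_of_hasDerivAt (f := fun t => H (t * s) x)
        (fun t _ => ?_) ?_
      · have h1 : HasDerivAt (fun r => H r x) (deriv (fun r => H r x) (t * s)) (t * s) :=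
          (hx.differentiable (by simp) _).hasDerivAt
        have h2 : HasDerivAt (fun t : ℝ => t * s) s t := by
          simpa using (hasDerivAt_id t).mul_const s
        exact h1.scomp t h2
      · refine Continuous.intervalIntegrable ?_ 0 1
        have := (contDiff_deriv_fst hH).continuous
        exact (this.comp (by fun_prop : Continuous fun t : ℝ => (t * s, x))).const_smul s
    rw [intervalIntegral.integral_smul, one_mul, zero_mul] at key
    rw [key]; abel

theorem deriv_comp_add_const_left {G : ℝ → E} (x s : ℝ) (hG : ContDiff ℝ ∞ G) :
    HasDerivAt (fun s => G (x + s)) (deriv G (x + s)) s := by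
  have h1 : HasDerivAt G (deriv G (x + s)) (x + s) :=
    (hG.differentiable (by simp) _).hasDerivAt
  exact h1.comp_const_add x s

/-- Taylor's formula with a jointly smooth remainder. -/
theorem exists_taylor_remainder [CompleteSpace E] (n : ℕ) {G : ℝ → E} (hG : ContDiff ℝ ∞ G) :
    ∃ R : ℝ → ℝ → E, (ContDiff ℝ ∞ fun p : ℝ × ℝ => R p.1 p.2) ∧
      ∀ s x, G (x + s) =
        ∑ j ∈ Finset.range n, (s ^ j / (j.factorial : ℝ)) • iteratedDeriv j G x + s ^ n • R s x := by
  induction n generalizing G with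
  | zero =>
    exact ⟨fun s x => G (x + s), hG.comp (by fun_prop), by simp⟩
  | succ n ih =>
    obtain ⟨R, hR, h⟩ := ih (contDiff_infty_iff_deriv.1 hG).2
    -- R is the order-n remainder of G'. Integrating r^n R(r, x) over [0, s] and substituting r = ts
    -- gives s^(n+1) times this integral.
    refine ⟨fun s x => ∫ t in (0 : ℝ)..1, t ^ n • R (t * s) x, ?_, fun s x => ?_⟩
    · refine contDiff_intervalIntegral (f := fun p t => t ^ n • R (t * p.1) p.2) ?_
      exact (contDiff_snd.pow n).smul (hR.comp
        (by fun_prop : ContDiff ℝ ∞ fun q : (ℝ × ℝ) × ℝ => (q.2 * q.1.1, q.1.2)))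
    · have hint : Continuous fun t : ℝ => t ^ n • R (t * s) x :=
        (continuous_pow n).smul (hR.continuous.comp
          (by fun_prop : Continuous fun t : ℝ => (t * s, x)))
      have hd : ∀ r, HasDerivAt (fun r => G (x + r) - ∑ j ∈ Finset.range (n + 1),
          (r ^ j / (j.factorial : ℝ)) • iteratedDeriv j G x) (r ^ n • R r x) r := by
        intro r
        have hsum : HasDerivAt (fun r : ℝ => ∑ j ∈ Finset.range (n + 1),
            (r ^ j / (j.factorial : ℝ)) • iteratedDeriv j G x)
            (∑ j ∈ Finset.range (n + 1),
              ((j : ℝ) * r ^ (j - 1) / (j.factorial : ℝ)) • iteratedDeriv j G x) r :=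
          HasDerivAt.fun_sum fun j _ => ((hasDerivAt_pow j r).div_const _).smul_const _
        have := (deriv_comp_add_const_left x r hG).sub hsum
        refine this.congr_deriv ?_
        rw [h r x, Finset.sum_range_succ']
        simp only [← iteratedDeriv_succ', Nat.add_sub_cancel, Nat.cast_zero, zero_mul, zero_div,
          zero_smul, add_zero]
        rw [add_sub_right_comm, ← Finset.sum_sub_distrib, Finset.sum_eq_zero, zero_add]
        intro j _
        rw [← sub_smul, Nat.factorial_succ]
        have : (j.factorial : ℝ) ≠ 0 := by positivity
        push_cast
        rw [show r ^ j / (j.factorial : ℝ) -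
          ((j : ℝ) + 1) * r ^ j / (((j : ℝ) + 1) * (j.factorial : ℝ)) = 0 by field_simp; ring,
          zero_smul]
      have key := intervalIntegral.integral_eq_sub_of_hasDerivAt (a := 0) (b := 1)
        (f := fun t => G (x + t * s) - ∑ j ∈ Finset.range (n + 1),
          ((t * s) ^ j / (j.factorial : ℝ)) • iteratedDeriv j G x)
        (f' := fun t => s ^ (n + 1) • t ^ n • R (t * s) x) (fun t _ => by
          have h2 : HasDerivAt (fun t : ℝ => t * s) s t := by
            simpa using (hasDerivAt_id t).mul_const s
          have h3 := (hd (t * s)).scomp t h2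
          refine h3.congr_deriv ?_
          rw [smul_smul, smul_smul]; congr 1; ring)
        ((hint.const_smul _).intervalIntegrable 0 1)
      rw [intervalIntegral.integral_smul] at key
      rw [key, Finset.sum_range_succ' (fun j => (((0 : ℝ) * s) ^ j / (j.factorial : ℝ)) •
        iteratedDeriv j G x)]
      simp

theorem iteratedDeriv_smul_eq_sum {f : ℝ → ℝ} {g : ℝ → E} (hf : ContDiff ℝ ∞ f)
    (hg : ContDiff ℝ ∞ g) (n : ℕ) (x : ℝ) :
    iteratedDeriv n (fun x => f x • g x) x = ∑ i ∈ Finset.range (n + 1),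
      ((n.choose i : ℝ) * iteratedDeriv i f x) • iteratedDeriv (n - i) g x := by
  have h := iteratedDerivWithin_smul (n := n) (Set.mem_univ x) uniqueDiffOn_univ
    (hf.of_le (by exact_mod_cast le_top)).contDiffWithinAt
    (hg.of_le (by exact_mod_cast le_top)).contDiffWithinAt
  simp only [iteratedDerivWithin_univ] at h
  rw [show (fun x => f x • g x) = f • g from rfl, h]
  refine Finset.sum_congr rfl fun i _ => ?_
  rw [mul_smul, Nat.cast_smul_eq_nsmul]

/-- The geometric identities hold only for small s > 0, often after division by a power of s;
continuity carries them to s = 0. -/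
theorem apply_zero_eq_of_eventuallyEq {X : Type*} [TopologicalSpace X] [T2Space X] {f g : ℝ → X}
    (hf : Continuous f) (hg : Continuous g) {r : ℝ} (hr : 0 < r)
    (h : ∀ s ∈ Set.Ioo 0 r, f s = g s) : f 0 = g 0 := by
  have h1 := (hf.tendsto 0).mono_left (nhdsWithin_le_nhds (s := Set.Ioi 0))
  have h2 := (hg.tendsto 0).mono_left (nhdsWithin_le_nhds (s := Set.Ioi 0))
  refine tendsto_nhds_unique_of_eventuallyEq h1 h2 ?_
  filter_upwards [Ioo_mem_nhdsGT hr] with s hs using h s hs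

end

/-! ### Determinants of smooth matrix families -/

theorem contDiff_matrix_det {V : Type*} [NormedAddCommGroup V] [NormedSpace ℝ V] {n : Type*}
    [Fintype n] [DecidableEq n] {X : V → Matrix n n ℝ}
    (hX : ∀ i j, ContDiff ℝ ∞ fun v => X v i j) : ContDiff ℝ ∞ fun v => (X v).det := by
  simp only [Matrix.det_apply]
  exact ContDiff.sum fun σ _ => (contDiff_prod fun i _ => hX _ _).const_smul _

theorem contDiff_matrix_adjugate {V : Type*} [NormedAddCommGroup V] [NormedSpace ℝ V] {n : Type*}
    [Fintype n] [DecidableEq n] {X : V → Matrix n n ℝ}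
    (hX : ∀ i j, ContDiff ℝ ∞ fun v => X v i j) (i j : n) :
    ContDiff ℝ ∞ fun v => (X v).adjugate i j := by
  simp only [Matrix.adjugate_apply]
  refine contDiff_matrix_det fun k l => ?_
  by_cases h : k = j
  · subst h; simpa using contDiff_const
  · simpa [Matrix.updateRow_ne h] using hX k l

/-- Since det(1 + tX) = 1 + t tr X + O(t²), the constancy of the determinant kills the trace. Here t
= s^k is treated first as a variable independent of s: Hadamard gives det(1 + t X_s) = 1 + t ψ(t,
s), and ψ(0, 0) is computed once along t = s^k and once along s = 0. -/
theorem trace_eq_zero_of_det_eq_one {n : Type} [Fintype n] [DecidableEq n]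
    {X : ℝ → Matrix n n ℝ} (hX : ∀ i j, ContDiff ℝ ∞ fun s => X s i j) {k : ℕ} (hk : k ≠ 0)
    {r : ℝ} (hr : 0 < r) (h : ∀ s ∈ Set.Ioo 0 r, (1 + s ^ k • X s).det = 1) :
    (X 0).trace = 0 := by
  obtain ⟨ψ, hψ, hdet⟩ := exists_smooth_quotient (H := fun t s => (1 + t • X s).det)
    (contDiff_matrix_det fun i j => by
      simp only [Matrix.add_apply, Matrix.smul_apply, smul_eq_mul]
      exact contDiff_const.add (contDiff_fst.mul ((hX i j).comp contDiff_snd)))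
  simp only [zero_smul, add_zero, Matrix.det_one, smul_eq_mul] at hdet
  have h1 : ψ ((0 : ℝ) ^ k) 0 = 0 := by
    refine apply_zero_eq_of_eventuallyEq (f := fun s => ψ (s ^ k) s) (g := fun _ => 0)
      (hψ.continuous.comp (by fun_prop : Continuous fun s : ℝ => (s ^ k, s)))
      continuous_const hr fun s hs => ?_
    have := hdet (s ^ k) s
    rw [h s hs] at this
    have hs0 : s ^ k ≠ 0 := pow_ne_zero _ hs.1.ne'
    simpa [hs0] using this
  rw [zero_pow hk] at h1
  have h2 : ψ 0 0 = (X 0).trace + 0 * (Matrix.det (1 + (Polynomial.X : Polynomial ℝ) •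
        (X 0).map Polynomial.C)).divX.divX.eval 0 := by
    refine apply_zero_eq_of_eventuallyEq (f := fun t => ψ t 0)
      (g := fun t => (X 0).trace + t * (Matrix.det (1 + (Polynomial.X : Polynomial ℝ) •
        (X 0).map Polynomial.C)).divX.divX.eval t)
      (hψ.continuous.comp (by fun_prop : Continuous fun s : ℝ => (s, (0 : ℝ)))) ?_ one_pos
        fun t ht => ?_
    · have := (Matrix.det (1 + (Polynomial.X : Polynomial ℝ) •
        (X 0).map Polynomial.C)).divX.divX.continuous
      fun_prop
    · have := hdet t 0
      rw [Matrix.det_one_add_smul] at this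
      have ht0 : t ≠ 0 := ht.1.ne'
      apply mul_left_cancel₀ ht0
      linear_combination -this
  rw [h1] at h2
  simpa using h2.symm

/-! ### Frames, dual curves and osculating hyperplanes -/

section Frame
variable {d : ℕ}

/-- The Wronskian matrix, with columns `Z, Z', …, Z^(d)`. -/
noncomputable def frame (Z : ℝ → Vec d) (x : ℝ) : Matrix (Fin (d + 1)) (Fin (d + 1)) ℝ :=
  Matrix.of fun i j => iteratedDeriv (j : ℕ) Z x i

/-- Coordinates with respect to `Z, Z', …, Z^(d)` for curves with Wronskian `1`. -/
noncomputable def coord (Z : ℝ → Vec d) (x : ℝ) : Vec d →ₗ[ℝ] Vec d :=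
  (frame Z x).adjugate.mulVecLin

/-- The dual curve: the covectors vanishing on the osculating hyperplanes. -/
noncomputable def dualCurve (Z : ℝ → Vec d) (x : ℝ) : Vec d :=
  (frame Z x).adjugate (Fin.last d)

/-- The matrix with rows `n^(d), …, n', n`. -/
noncomputable def coframe (n : ℝ → Vec d) (x : ℝ) : Matrix (Fin (d + 1)) (Fin (d + 1)) ℝ :=
  Matrix.of fun i j => iteratedDeriv (d - (i : ℕ)) n x j

theorem det_frame (Z : ℝ → Vec d) (x : ℝ) : (frame Z x).det = wronskian Z x := rfl

theorem frame_col (Z : ℝ → Vec d) (x : ℝ) (j : Fin (d + 1)) :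
    (frame Z x).col j = iteratedDeriv (j : ℕ) Z x := rfl

theorem dualCurve_dotProduct (Z : ℝ → Vec d) (x : ℝ) (v : Vec d) :
    dualCurve Z x ⬝ᵥ v = coord Z x v (Fin.last d) := rfl

theorem frame_mulVec (Z : ℝ → Vec d) (x : ℝ) (c : Vec d) :
    frame Z x *ᵥ c = ∑ j, c j • iteratedDeriv (j : ℕ) Z x := by
  ext i
  simp [Matrix.mulVec, dotProduct, frame, mul_comm, Finset.sum_apply]

theorem coord_iteratedDeriv {Z : ℝ → Vec d} {x : ℝ} (h : wronskian Z x = 1) (k : Fin (d + 1)) :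
    coord Z x (iteratedDeriv (k : ℕ) Z x) = Pi.single k 1 := by
  rw [← frame_col, coord, Matrix.mulVecLin_apply, ← Matrix.mulVec_single_one,
    Matrix.mulVec_mulVec, Matrix.adjugate_mul, det_frame, h, one_smul, Matrix.one_mulVec]

theorem coord_iteratedDeriv_apply {Z : ℝ → Vec d} {x : ℝ} (h : wronskian Z x = 1) {k : ℕ}
    (hk : k < d + 1) (j : Fin (d + 1)) :
    coord Z x (iteratedDeriv k Z x) j = if (j : ℕ) = k then 1 else 0 := by
  have := congrFun (coord_iteratedDeriv h ⟨k, hk⟩) j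
  simp only at this
  rw [this, Pi.single_apply]
  simp [Fin.ext_iff]

theorem sum_coord_smul {Z : ℝ → Vec d} {x : ℝ} (h : wronskian Z x = 1) (v : Vec d) :
    ∑ j, coord Z x v j • iteratedDeriv (j : ℕ) Z x = v := by
  rw [← frame_mulVec, coord, Matrix.mulVecLin_apply, Matrix.mulVec_mulVec, Matrix.mul_adjugate,
    det_frame, h, one_smul, Matrix.one_mulVec]

theorem contDiff_frame {Z : ℝ → Vec d} (hZ : ContDiff ℝ ∞ Z) (i j : Fin (d + 1)) :
    ContDiff ℝ ∞ fun x => frame Z x i j :=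
  contDiff_pi.1 (contDiff_iteratedDeriv hZ j) i

theorem contDiff_dualCurve {Z : ℝ → Vec d} (hZ : ContDiff ℝ ∞ Z) :
    ContDiff ℝ ∞ (dualCurve Z) :=
  contDiff_pi.2 fun i => contDiff_matrix_adjugate (contDiff_frame hZ) _ i

/-- For curves of Wronskian `1`, the derivative `Z^(d+1)` is a combination of lower ones. -/
theorem coord_iteratedDeriv_succ_last {Z : ℝ → Vec d} (hZ : ContDiff ℝ ∞ Z)
    (h : ∀ x, wronskian Z x = 1) (x : ℝ) :
    coord Z x (iteratedDeriv (d + 1) Z x) (Fin.last d) = 0 := by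
  choose R hR hT using fun j : Fin (d + 1) =>
    exists_taylor_remainder 2 (contDiff_iteratedDeriv hZ (j : ℕ))
  let D : ℝ → Matrix (Fin (d + 1)) (Fin (d + 1)) ℝ := fun s =>
    Matrix.of fun i j => (iteratedDeriv ((j : ℕ) + 1) Z x + s • R j s x) i
  have hD : ∀ s, frame Z (x + s) = frame Z x + s • D s := by
    intro s
    ext i j
    have := congrFun (hT j s x) i
    simp only [frame, D, Matrix.of_apply, Matrix.add_apply, Matrix.smul_apply, this,
      Finset.sum_range_succ, Finset.sum_range_zero, Pi.add_apply, Pi.smul_apply, smul_eq_mul,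
      iteratedDeriv_zero, iteratedDeriv_one, ← iteratedDeriv_succ]
    simp
    ring
  have htr : ((frame Z x).adjugate * D 0).trace = 0 := by
    refine trace_eq_zero_of_det_eq_one (X := fun s => (frame Z x).adjugate * D s)
      (fun i j => ?_) one_ne_zero one_pos fun s _ => ?_
    · simp only [Matrix.mul_apply]
      refine ContDiff.sum fun k _ => contDiff_const.mul ?_
      simp only [D, Matrix.of_apply, Pi.add_apply, Pi.smul_apply]
      refine contDiff_const.add (contDiff_id.smul ?_)
      exact (contDiff_pi.1 (hR j) k).comp (by fun_prop : ContDiff ℝ ∞ fun s : ℝ => (s, x))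
    · have h1 : (frame Z x).adjugate * frame Z (x + s) = 1 + s ^ 1 • ((frame Z x).adjugate * D s) := by
        rw [hD, mul_add, Matrix.adjugate_mul, det_frame, h, one_smul, pow_one, Matrix.mul_smul]
      rw [← h1, Matrix.det_mul, Matrix.det_adjugate, det_frame, det_frame, h, h, one_pow, one_mul]
  have hent : ∀ j : Fin (d + 1), ((frame Z x).adjugate * D 0) j j =
      coord Z x (iteratedDeriv ((j : ℕ) + 1) Z x) j := by
    intro j
    simp [D, Matrix.mul_apply, coord, Matrix.mulVec, dotProduct]
  -- For j < d the vector Z^(j+1) is a member of the frame other than Z^(j), so only the last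
  -- diagonal entry contributes to the trace.
  rw [Matrix.trace, Fin.sum_univ_castSucc, Finset.sum_eq_zero, zero_add] at htr
  · rw [Matrix.diag_apply, hent] at htr
    simpa using htr
  · intro j _
    rw [Matrix.diag_apply, hent, coord_iteratedDeriv_apply (h x) (by simp)]
    simp

/-- The coefficients of the operator annihilating a curve of Wronskian `1`. -/
noncomputable def opCoeffs (Z : ℝ → Vec d) : Coeffs d := fun j x =>
  -coord Z x (iteratedDeriv (d + 1) Z x) j.castSucc

theorem opL_opCoeffs {Z : ℝ → Vec d} (hZ : ContDiff ℝ ∞ Z) (h : ∀ x, wronskian Z x = 1)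
    (x : ℝ) : opL (opCoeffs Z) Z x = 0 := by
  have := sum_coord_smul (h x) (iteratedDeriv (d + 1) Z x)
  rw [Fin.sum_univ_castSucc, coord_iteratedDeriv_succ_last hZ h, zero_smul, add_zero] at this
  unfold opL opCoeffs
  nth_rewrite 1 [← this]
  rw [← Finset.sum_add_distrib, Finset.sum_eq_zero]
  intro j _
  rw [neg_smul, Fin.val_castSucc, add_neg_cancel]

theorem iteratedDeriv_clm_apply {E F : Type} [NormedAddCommGroup E] [NormedSpace ℝ E]
    [NormedAddCommGroup F] [NormedSpace ℝ F] (T : E →L[ℝ] F) {f : ℝ → E} (hf : ContDiff ℝ ∞ f)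
    (k : ℕ) (x : ℝ) : iteratedDeriv k (fun x => T (f x)) x = T (iteratedDeriv k f x) := by
  induction k generalizing x with
  | zero => simp
  | succ k ih =>
    rw [iteratedDeriv_succ, iteratedDeriv_succ, funext ih]
    have : HasDerivAt (iteratedDeriv k f) (deriv (iteratedDeriv k f) x) x :=
      ((contDiff_iteratedDeriv hf k).differentiable (by simp) x).hasDerivAt
    exact (T.hasFDerivAt.comp_hasDerivAt x this).deriv

theorem iteratedDeriv_apply {f : ℝ → Vec d} (hf : ContDiff ℝ ∞ f) (k : ℕ) (x : ℝ)
    (i : Fin (d + 1)) : iteratedDeriv k f x i = iteratedDeriv k (fun x => f x i) x :=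
  (iteratedDeriv_clm_apply (ContinuousLinearMap.proj (R := ℝ) (φ := fun _ => ℝ) i) hf k x).symm

theorem iteratedDeriv_mulVec (A : Matrix (Fin (d + 1)) (Fin (d + 1)) ℝ) {f : ℝ → Vec d}
    (hf : ContDiff ℝ ∞ f) (k : ℕ) (x : ℝ) :
    iteratedDeriv k (fun x => A *ᵥ f x) x = A *ᵥ iteratedDeriv k f x :=
  iteratedDeriv_clm_apply (LinearMap.toContinuousLinearMap A.mulVecLin) hf k x

theorem iteratedDeriv_add_period {A : Matrix (Fin (d + 1)) (Fin (d + 1)) ℝ} {Z : ℝ → Vec d} {c : ℝ}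
    (hZ : ContDiff ℝ ∞ Z) (hA : ∀ x, Z (x + c) = A *ᵥ Z x) (k : ℕ) (x : ℝ) :
    iteratedDeriv k Z (x + c) = A *ᵥ iteratedDeriv k Z x := by
  rw [← iteratedDeriv_mulVec A hZ, ← funext hA, iteratedDeriv_comp_add_const]

theorem frame_add_period {A : Matrix (Fin (d + 1)) (Fin (d + 1)) ℝ} {Z : ℝ → Vec d} {c : ℝ}
    (hZ : ContDiff ℝ ∞ Z) (hA : ∀ x, Z (x + c) = A *ᵥ Z x) (x : ℝ) :
    frame Z (x + c) = A * frame Z x := by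
  ext i j
  have := congrFun (iteratedDeriv_add_period hZ hA (j : ℕ) x) i
  simpa [frame, Matrix.mul_apply, Matrix.mulVec, dotProduct] using this

/-- The monodromy acts on the frame and on the vector alike, so coordinates do not see it. This is
the source of all periodicity of operator coefficients. -/
theorem coord_add_period {A : Matrix (Fin (d + 1)) (Fin (d + 1)) ℝ} {Z E : ℝ → Vec d} {c : ℝ}
    (hdet : A.det = 1) (hZ : ContDiff ℝ ∞ Z) (hA : ∀ x, Z (x + c) = A *ᵥ Z x) {x : ℝ}
    (hE : E (x + c) = A *ᵥ E x) : coord Z (x + c) (E (x + c)) = coord Z x (E x) := by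
  rw [coord, coord, frame_add_period hZ hA, Matrix.mulVecLin_apply, Matrix.mulVecLin_apply, hE,
    Matrix.adjugate_mul_distrib, Matrix.mulVec_mulVec, mul_assoc, Matrix.adjugate_mul, hdet,
    one_smul, mul_one]

theorem opCoeffs_periodic {A : Matrix (Fin (d + 1)) (Fin (d + 1)) ℝ} {Z : ℝ → Vec d} {c : ℝ}
    (hdet : A.det = 1) (hZ : ContDiff ℝ ∞ Z) (hA : ∀ x, Z (x + c) = A *ᵥ Z x) (j : Fin d) :
    Function.Periodic (opCoeffs Z j) c := by
  intro x
  unfold opCoeffs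
  rw [coord_add_period hdet hZ hA (iteratedDeriv_add_period hZ hA _ x)]

theorem contDiff_coord {Z E : ℝ → Vec d} (hZ : ContDiff ℝ ∞ Z) (hE : ContDiff ℝ ∞ E)
    (j : Fin (d + 1)) : ContDiff ℝ ∞ fun x => coord Z x (E x) j := by
  simp only [coord, Matrix.mulVecLin_apply, Matrix.mulVec, dotProduct]
  exact ContDiff.sum fun i _ =>
    (contDiff_matrix_adjugate (contDiff_frame hZ) j i).mul (contDiff_pi.1 hE i)

theorem contDiff_opCoeffs {Z : ℝ → Vec d} (hZ : ContDiff ℝ ∞ Z) (j : Fin d) :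
    ContDiff ℝ ∞ (opCoeffs Z j) :=
  (contDiff_coord hZ (contDiff_iteratedDeriv hZ _) _).neg

theorem hasDerivAt_dotProduct {n Z : ℝ → Vec d} (hn : ContDiff ℝ ∞ n) (hZ : ContDiff ℝ ∞ Z)
    (i j : ℕ) (x : ℝ) :
    HasDerivAt (fun x => iteratedDeriv i n x ⬝ᵥ iteratedDeriv j Z x)
      (iteratedDeriv (i + 1) n x ⬝ᵥ iteratedDeriv j Z x +
        iteratedDeriv i n x ⬝ᵥ iteratedDeriv (j + 1) Z x) x := by
  have h : ∀ {f : ℝ → Vec d}, ContDiff ℝ ∞ f → ∀ i a, HasDerivAt (fun x => iteratedDeriv i f x a)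
      (iteratedDeriv (i + 1) f x a) x := fun {f} hf i a => by
    rw [iteratedDeriv_succ]
    exact hasDerivAt_pi.1
      ((contDiff_iteratedDeriv hf i).differentiable (by simp) x).hasDerivAt a
  simp only [dotProduct]
  rw [← Finset.sum_add_distrib]
  exact HasDerivAt.fun_sum fun a _ => (h hn i a).mul (h hZ j a)

/-- Differentiating a pairing that vanishes identically moves one derivative from n to Z at the cost
of a sign. -/
theorem dotProduct_iteratedDeriv {n Z : ℝ → Vec d} (hn : ContDiff ℝ ∞ n) (hZ : ContDiff ℝ ∞ Z)
    {m : ℕ} (h : ∀ i < m, ∀ x, iteratedDeriv i n x ⬝ᵥ Z x = 0) (j : ℕ) :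
    (∀ i, i + j < m → ∀ x, iteratedDeriv i n x ⬝ᵥ iteratedDeriv j Z x = 0) ∧
    (∀ i, i + j = m → ∀ x, iteratedDeriv i n x ⬝ᵥ iteratedDeriv j Z x =
      (-1) ^ j * (iteratedDeriv m n x ⬝ᵥ Z x)) := by
  induction j with
  | zero => exact ⟨fun i hi x => by simpa using h i hi x, fun i hi x => by
      rw [add_zero] at hi; simp [hi]⟩
  | succ j ih =>
    have key : ∀ i, i + j < m → ∀ x, iteratedDeriv i n x ⬝ᵥ iteratedDeriv (j + 1) Z x =
        -(iteratedDeriv (i + 1) n x ⬝ᵥ iteratedDeriv j Z x) := by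
      intro i hi x
      have h1 := (hasDerivAt_dotProduct hn hZ i j x).deriv
      rw [funext (ih.1 i hi), deriv_const] at h1
      linarith
    refine ⟨fun i hi x => ?_, fun i hi x => ?_⟩
    · rw [key i (by omega) x, ih.1 (i + 1) (by omega) x, neg_zero]
    · rw [key i (by omega) x, ih.2 (i + 1) (by omega) x, pow_succ]; ring

/-- The sign of the determinant of the pairing of a curve with its dual curve. -/
noncomputable def dualSign (d : ℕ) : ℝ := ∏ i : Fin (d + 1), (-1) ^ (d - (i : ℕ))

theorem dualSign_mul_self (d : ℕ) : dualSign d * dualSign d = 1 := by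
  rw [dualSign, ← Finset.prod_mul_distrib]
  exact Finset.prod_eq_one fun i _ => by rw [← mul_pow]; simp

/-- The matrix of pairings is triangular with signs on the diagonal. In particular n, n', …, n^(d)
are independent. -/
theorem det_coframe_mul_det_frame {n Z : ℝ → Vec d} {x : ℝ}
    (h0 : ∀ i j, i + j < d → iteratedDeriv i n x ⬝ᵥ iteratedDeriv j Z x = 0)
    (h1 : ∀ i j, i + j = d → iteratedDeriv i n x ⬝ᵥ iteratedDeriv j Z x = (-1) ^ i) :
    (coframe n x).det * (frame Z x).det = dualSign d := by
  have hent : ∀ i j, (coframe n x * frame Z x) i j =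
      iteratedDeriv (d - (i : ℕ)) n x ⬝ᵥ iteratedDeriv (j : ℕ) Z x := fun i j => rfl
  rw [← Matrix.det_mul, Matrix.det_of_isUpperTriangular]
  · exact Finset.prod_congr rfl fun i _ => by rw [hent, h1 _ _ (by omega)]
  · intro i j hij
    rw [hent]
    have : (j : ℕ) < i := hij
    exact h0 _ _ (by omega)

theorem dualCurve_dotProduct_iteratedDeriv {Z : ℝ → Vec d} {x : ℝ} (h : wronskian Z x = 1)
    {k : ℕ} (hk : k < d + 1) :
    dualCurve Z x ⬝ᵥ iteratedDeriv k Z x = if k = d then 1 else 0 := by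
  rw [dualCurve_dotProduct, coord_iteratedDeriv_apply h hk]
  simp [eq_comm]

theorem iteratedDeriv_dualCurve_dotProduct_eq_zero {Z E : ℝ → Vec d} (hZ : ContDiff ℝ ∞ Z)
    (hE : ContDiff ℝ ∞ E)
    (hEZ : ∀ j < d, ∀ x, dualCurve Z x ⬝ᵥ iteratedDeriv j E x = 0) {i j : ℕ} (hij : i + j < d)
    (x : ℝ) : iteratedDeriv i (dualCurve Z) x ⬝ᵥ iteratedDeriv j E x = 0 := by
  rw [dotProduct_comm]
  exact (dotProduct_iteratedDeriv hE (contDiff_dualCurve hZ)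
    (fun j hj x => by rw [dotProduct_comm]; exact hEZ j hj x) i).1 j (by omega) x

theorem dualCurve_orthogonal {Z : ℝ → Vec d} (h : ∀ x, wronskian Z x = 1) :
    ∀ j < d, ∀ x, dualCurve Z x ⬝ᵥ iteratedDeriv j Z x = 0 :=
  fun j hj x => by
    rw [dualCurve_dotProduct_iteratedDeriv (h x) (by omega), if_neg (by omega)]

theorem iteratedDeriv_dualCurve_dotProduct_self {Z : ℝ → Vec d} (hZ : ContDiff ℝ ∞ Z)
    (h : ∀ x, wronskian Z x = 1) {i j : ℕ} (hij : i + j = d) (x : ℝ) :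
    iteratedDeriv i (dualCurve Z) x ⬝ᵥ iteratedDeriv j Z x = (-1) ^ i := by
  rw [dotProduct_comm, (dotProduct_iteratedDeriv hZ (contDiff_dualCurve hZ)
    (m := d) (fun j hj x => by rw [dotProduct_comm]; exact dualCurve_orthogonal h j hj x) i).2
      j (by omega) x, dotProduct_comm,
    dualCurve_dotProduct_iteratedDeriv (h x) (by omega), if_pos rfl, mul_one]

theorem coframe_mulVec {n : ℝ → Vec d} {x : ℝ} {v : Vec d}
    (h : ∀ i < d, iteratedDeriv i n x ⬝ᵥ v = 0) :
    coframe n x *ᵥ v = (iteratedDeriv d n x ⬝ᵥ v) • Pi.single 0 1 := by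
  ext i
  rcases Fin.eq_zero_or_eq_succ i with rfl | ⟨i, rfl⟩
  · simp [coframe, Matrix.mulVec]
  · have := h (d - (i.succ : ℕ)) (by have := i.isLt; rw [Fin.val_succ]; omega)
    simpa [coframe, Matrix.mulVec] using this

/-- A curve whose derivatives lie in the osculating hyperplanes of `Z` is a multiple of `Z`. -/
theorem exists_smul_of_osculating {Z E : ℝ → Vec d} (hZ : ContDiff ℝ ∞ Z)
    (h : ∀ x, wronskian Z x = 1) (hE : ContDiff ℝ ∞ E)
    (hEZ : ∀ j < d, ∀ x, dualCurve Z x ⬝ᵥ iteratedDeriv j E x = 0) :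
    ∃ c : ℝ → ℝ, ContDiff ℝ ∞ c ∧ ∀ x, E x = c x • Z x := by
  have hn := contDiff_iteratedDeriv (contDiff_dualCurve hZ) d
  -- Both E and Z are annihilated by n, …, n^(d-1), hence are proportional. Pairing with n^(d) gives
  -- the factor, since n^(d) · Z = (-1)^d.
  refine ⟨fun x => (-1) ^ d * (iteratedDeriv d (dualCurve Z) x ⬝ᵥ E x), ?_, fun x => ?_⟩
  · simp only [dotProduct]
    exact contDiff_const.mul
      (ContDiff.sum fun a _ => (contDiff_pi.1 hn a).mul (contDiff_pi.1 hE a))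
  · have hdet := det_coframe_mul_det_frame (n := dualCurve Z) (Z := Z) (x := x)
      (fun i j hij => iteratedDeriv_dualCurve_dotProduct_eq_zero hZ hZ (dualCurve_orthogonal h) hij x)
      (fun i j hij => iteratedDeriv_dualCurve_dotProduct_self hZ h hij x)
    have hne : (coframe (dualCurve Z) x).det ≠ 0 := fun h0 => by
      have := dualSign_mul_self d
      rw [← hdet, h0] at this
      simp at this
    have h1 : coframe (dualCurve Z) x *ᵥ E x = _ := coframe_mulVec fun i hi => by
      simpa using iteratedDeriv_dualCurve_dotProduct_eq_zero hZ hE hEZ (i := i) (j := 0) hi x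
    have h2 : coframe (dualCurve Z) x *ᵥ Z x = _ := coframe_mulVec fun i hi => by
      simpa using iteratedDeriv_dualCurve_dotProduct_eq_zero hZ hZ (dualCurve_orthogonal h)
        (i := i) (j := 0) hi x
    have h3 := iteratedDeriv_dualCurve_dotProduct_self hZ h (i := d) (j := 0) rfl x
    rw [iteratedDeriv_zero] at h3
    rw [h3] at h2
    refine sub_eq_zero.1 (Matrix.eq_zero_of_mulVec_eq_zero hne ?_)
    rw [Matrix.mulVec_sub, Matrix.mulVec_smul, h1, h2, smul_smul, mul_right_comm, ← mul_pow]
    simp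

/-- In the Leibniz expansion of (cZ)^(j) only the term c Z^(j) involves Z^(j). Summed over j, the
trace of the variation cZ is (d + 1)c. -/
theorem coord_iteratedDeriv_smul {Z : ℝ → Vec d} (hZ : ContDiff ℝ ∞ Z) {x : ℝ}
    (h : wronskian Z x = 1) {c : ℝ → ℝ} (hc : ContDiff ℝ ∞ c) (j : Fin (d + 1)) :
    coord Z x (iteratedDeriv j (fun x => c x • Z x) x) j = c x := by
  rw [iteratedDeriv_smul_eq_sum hc hZ, map_sum, Finset.sum_apply, Finset.sum_range_succ',
    Finset.sum_eq_zero, zero_add]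
  · rw [map_smul, Pi.smul_apply, coord_iteratedDeriv_apply h (by omega)]
    simp
  · intro i hi
    rw [map_smul, Pi.smul_apply, coord_iteratedDeriv_apply h (by omega), if_neg (by
      rw [Finset.mem_range] at hi; omega), smul_zero]

/-- A deformation of `Z` preserving, to first order, the osculating hyperplanes and the
Wronskian is zero. -/
theorem eq_zero_of_osculating_of_trace {Z E : ℝ → Vec d} (hZ : ContDiff ℝ ∞ Z)
    (h : ∀ x, wronskian Z x = 1) (hE : ContDiff ℝ ∞ E)
    (hEZ : ∀ j < d, ∀ x, dualCurve Z x ⬝ᵥ iteratedDeriv j E x = 0)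
    (htr : ∀ x, ∑ j : Fin (d + 1), coord Z x (iteratedDeriv j E x) j = 0) : E = 0 := by
  obtain ⟨c, hc, hcE⟩ := exists_smul_of_osculating hZ h hE hEZ
  ext1 x
  have := htr x
  rw [funext hcE] at this ⊢
  simp only [coord_iteratedDeriv_smul hZ (h x) hc] at this
  rw [Finset.sum_const, Finset.card_univ, Fintype.card_fin, nsmul_eq_mul] at this
  have hd : ((d + 1 : ℕ) : ℝ) ≠ 0 := by positivity
  simp [(mul_eq_zero.1 this).resolve_left hd]

/-- By Leibniz, the frame of cY is the frame of Y times an upper triangular matrix with c on the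
diagonal. -/
theorem wronskian_smul {Y : ℝ → Vec d} (hY : ContDiff ℝ ∞ Y) {c : ℝ → ℝ} (hc : ContDiff ℝ ∞ c)
    (x : ℝ) : wronskian (fun x => c x • Y x) x = c x ^ (d + 1) * wronskian Y x := by
  let U : Matrix (Fin (d + 1)) (Fin (d + 1)) ℝ := Matrix.of fun i j =>
    if (i : ℕ) ≤ j then ((j : ℕ).choose (j - i) : ℝ) * iteratedDeriv (j - i : ℕ) c x else 0
  have hU : frame (fun x => c x • Y x) x = frame Y x * U := by
    ext a j
    have h1 := congrFun (iteratedDeriv_smul_eq_sum hc hY (j : ℕ) x) a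
    rw [Finset.sum_apply, ← Finset.sum_range_reflect] at h1
    simp only [frame, Matrix.of_apply, Matrix.mul_apply, U]
    rw [h1]
    rw [Fin.sum_univ_eq_sum_range (fun i => iteratedDeriv i Y x a * if i ≤ (j : ℕ) then
      ((j : ℕ).choose (j - i) : ℝ) * iteratedDeriv (j - i : ℕ) c x else 0) (d + 1)]
    rw [← Finset.sum_subset (Finset.range_mono (by omega : (j : ℕ) + 1 ≤ d + 1))]
    · refine Finset.sum_congr rfl fun i hi => ?_
      have hi' : i ≤ j := by rw [Finset.mem_range] at hi; omega
      rw [if_pos hi', Pi.smul_apply, smul_eq_mul]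
      rw [show (j : ℕ) + 1 - 1 - i = j - i by omega, show (j : ℕ) - (j - i) = i by omega]
      ring
    · intro i _ hi
      rw [Finset.mem_range] at hi
      rw [if_neg (by omega), mul_zero]
  rw [← det_frame, hU, Matrix.det_mul, det_frame, mul_comm]
  congr 1
  rw [Matrix.det_of_isUpperTriangular]
  · simp [U]
  · intro i j hij
    simp only [U, Matrix.of_apply]
    have hlt : (j : ℕ) < i := hij
    exact if_neg (not_le.2 hlt)

theorem dualCurve_dotProduct_of_mem_span {Z : ℝ → Vec d} {x : ℝ} (h : wronskian Z x = 1)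
    {v : Vec d} (hv : v ∈ Submodule.span ℝ (Set.range fun j : Fin d => iteratedDeriv (j : ℕ) Z x)) :
    dualCurve Z x ⬝ᵥ v = 0 := by
  induction hv using Submodule.span_induction with
  | mem v hv =>
    obtain ⟨j, rfl⟩ := hv
    rw [dualCurve_dotProduct_iteratedDeriv h (by omega), if_neg (by omega)]
  | zero => simp
  | add v w _ _ hv hw => rw [dotProduct_add, hv, hw, add_zero]
  | smul a v _ hv => rw [dotProduct_smul, hv, smul_zero]

/-- Equal osculating hyperplanes give Z' = cZ; the Wronskians force c^(d+1) = 1, so |c| = 1, and by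
continuity the sign is constant on the line. -/
theorem eq_or_eq_neg_of_osculating_eq {Z Z' : ℝ → Vec d} (hZ : ContDiff ℝ ∞ Z)
    (hZ' : ContDiff ℝ ∞ Z') (h : ∀ x, wronskian Z x = 1) (h' : ∀ x, wronskian Z' x = 1)
    (hs : ∀ x, Submodule.span ℝ (Set.range fun j : Fin d => iteratedDeriv (j : ℕ) Z' x) =
      Submodule.span ℝ (Set.range fun j : Fin d => iteratedDeriv (j : ℕ) Z x)) :
    Z' = Z ∨ Z' = -Z := by
  obtain ⟨c, hc, hcZ⟩ := exists_smul_of_osculating hZ h hZ' fun j hj x =>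
    dualCurve_dotProduct_of_mem_span (h x) (hs x ▸ Submodule.subset_span ⟨⟨j, hj⟩, rfl⟩)
  have hc1 : ∀ x, c x ^ 2 = 1 := fun x => by
    have := h' x
    rw [funext hcZ, wronskian_smul hZ hc, h, mul_one] at this
    have habs : |c x| ^ (d + 1) = 1 := by rw [← abs_pow, this, abs_one]
    rw [← sq_abs, (pow_eq_one_iff_of_nonneg (abs_nonneg _) (by omega)).1 habs, one_pow]
  have := isPreconnected_univ.eq_one_or_eq_neg_one_of_sq_eq hc.continuous.continuousOn
    (fun x _ => hc1 x)
  rcases this with h1 | h1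
  · left; ext1 x; rw [hcZ, h1 (Set.mem_univ x)]; simp
  · right; ext1 x; rw [hcZ, h1 (Set.mem_univ x)]; simp

end Frame

/-! ### Existence of envelopes for small parameter -/

-- Periodicity reduces the range of x to a compact interval, so one radius r serves all x.
open Filter Topology in
theorem exists_forall_gt_half {H : ℝ → ℝ → ℝ} {c : ℝ} (hc : 0 < c)
    (hH : Continuous fun p : ℝ × ℝ => H p.1 p.2) (h0 : ∀ x, H 0 x = 1)
    (hper : ∀ s, s ≠ 0 → Function.Periodic (H s) c) :
    ∃ r > 0, ∀ s ∈ Set.Ioo 0 r, ∀ x, 1 / 2 < H s x := by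
  have h1 : ∀ᶠ s in 𝓝 (0 : ℝ), ∀ x ∈ Set.Icc 0 c, 1 / 2 < H s x := by
    refine isCompact_Icc.eventually_forall_of_forall_eventually fun x _ => ?_
    exact (hH.tendsto (0, x)).eventually (lt_mem_nhds (by simp only [h0]; norm_num))
  obtain ⟨r, hr, h2⟩ := Metric.eventually_nhds_iff.1 h1
  refine ⟨r, hr, fun s hs x => ?_⟩
  obtain ⟨y, hy, hxy⟩ := (hper s hs.1.ne').exists_mem_Ico₀ hc x
  rw [hxy]
  refine h2 ?_ y ⟨hy.1, hy.2.le⟩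
  rw [Real.dist_eq, sub_zero, abs_of_pos hs.1]
  exact hs.2

/-- A smooth positive function equal to the identity on `[1/2, ∞)`. -/
noncomputable def positivePart (w : ℝ) : ℝ :=
  Real.smoothTransition (2 * w) * w + (1 - Real.smoothTransition (2 * w))

theorem contDiff_positivePart : ContDiff ℝ ∞ positivePart := by
  have h : ContDiff ℝ ∞ fun w : ℝ => Real.smoothTransition (2 * w) :=
    Real.smoothTransition.contDiff.comp (by fun_prop)
  exact (h.mul contDiff_id).add (contDiff_const.sub h)

theorem positivePart_pos (w : ℝ) : 0 < positivePart w := by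
  unfold positivePart
  rcases le_or_gt w 0 with hw | hw
  · rw [Real.smoothTransition.zero_of_nonpos (by linarith)]; norm_num
  · have h1 := Real.smoothTransition.le_one (2 * w)
    have h2 : 0 < Real.smoothTransition (2 * w) := Real.smoothTransition.pos_of_pos (by linarith)
    have := mul_pos h2 hw
    linarith

theorem positivePart_of_half_le {w : ℝ} (hw : 1 / 2 ≤ w) : positivePart w = w := by
  unfold positivePart
  rw [Real.smoothTransition.one_of_one_le (by linarith)]; ring

section
variable {d : ℕ}

theorem finrank_span_iteratedDeriv {Z : ℝ → Vec d} {x : ℝ} (h : wronskian Z x = 1) :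
    Module.finrank ℝ
      (Submodule.span ℝ (Set.range fun j : Fin d => iteratedDeriv (j : ℕ) Z x)) = d := by
  have hli : LinearIndependent ℝ (frame Z x).col :=
    Matrix.linearIndependent_cols_of_det_ne_zero (by rw [det_frame, h]; exact one_ne_zero)
  have := hli.comp (Fin.castSucc : Fin d → Fin (d + 1)) (Fin.castSucc_injective d)
  exact (finrank_span_eq_card this).trans (Fintype.card_fin d)

theorem contDiff_frame_family {Z : ℝ → ℝ → Vec d}
    (hZ : ContDiff ℝ ∞ fun p : ℝ × ℝ => Z p.1 p.2) (i j : Fin (d + 1)) :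
    ContDiff ℝ ∞ fun p : ℝ × ℝ => frame (Z p.1) p.2 i j :=
  contDiff_pi.1 (contDiff_iteratedDeriv_snd hZ j) i

/-- A smooth family of hyperplanes with bases `b_j(s, x)`, which are the osculating hyperplanes
of `G` at `s = 0`, has envelopes for small `s`. -/
theorem exists_envelope_family {M : Matrix.SpecialLinearGroup (Fin (d + 1)) ℝ} {G : ℝ → Vec d}
    (hG : IsNormalizedCurve M G) {b : Fin d → ℝ → ℝ → Vec d}
    (hb : ∀ j, ContDiff ℝ ∞ fun p : ℝ × ℝ => b j p.1 p.2)
    (hb0 : ∀ j x, b j 0 x = iteratedDeriv j G x)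
    (hbM : ∀ j s x, s ≠ 0 → b j s (x + 2 * Real.pi) = (M : Matrix _ _ ℝ) *ᵥ b j s x) :
    ∃ Z : ℝ → ℝ → Vec d, (ContDiff ℝ ∞ fun p : ℝ × ℝ => Z p.1 p.2) ∧ Z 0 = G ∧
      ∃ r > 0, ∀ s ∈ Set.Ioo 0 r, IsNormalizedCurve M (Z s) ∧
        ∀ x, Submodule.span ℝ (Set.range fun j : Fin d => iteratedDeriv (j : ℕ) (Z s) x) ≤
          Submodule.span ℝ (Set.range fun j => b j s x) := by
  have hpi : (0 : ℝ) < 2 * Real.pi := by positivity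
  -- The basis of the hyperplane is completed by G^(d), so that at s = 0 the matrix is the frame of
  -- G.
  let B : ℝ → ℝ → Matrix (Fin (d + 1)) (Fin (d + 1)) ℝ := fun s x => Matrix.of fun i j =>
    if h : (j : ℕ) < d then b ⟨j, h⟩ s x i else iteratedDeriv d G x i
  have hBsm : ∀ i j, ContDiff ℝ ∞ fun p : ℝ × ℝ => B p.1 p.2 i j := by
    intro i j
    simp only [B, Matrix.of_apply]
    split_ifs with h
    · exact contDiff_pi.1 (hb ⟨j, h⟩) i
    · exact (contDiff_pi.1 (contDiff_iteratedDeriv hG.smooth d) i).comp contDiff_snd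
  have hB0 : ∀ x, B 0 x = frame G x := by
    intro x
    ext i j
    simp only [B, Matrix.of_apply, frame]
    split_ifs with h
    · rw [hb0]
    · rw [show (j : ℕ) = d by omega]
  have hBM : ∀ s x, s ≠ 0 → B s (x + 2 * Real.pi) = (M : Matrix _ _ ℝ) * B s x := by
    intro s x hs
    ext i j
    simp only [B, Matrix.of_apply, Matrix.mul_apply]
    split_ifs with h
    · simp [hbM _ s x hs, Matrix.mulVec, dotProduct]
    · simp [iteratedDeriv_add_period hG.smooth hG.quasiperiodic, Matrix.mulVec, dotProduct]
  have hBcol : ∀ s x (j : Fin d), (B s x).col j.castSucc = b j s x := by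
    intro s x j; ext i; simp [B, Matrix.col]
  have hMdet : (M : Matrix (Fin (d + 1)) (Fin (d + 1)) ℝ).det = 1 := M.2
  let M' := (M : Matrix (Fin (d + 1)) (Fin (d + 1)) ℝ).adjugate
  have hM' : M' * (M : Matrix _ _ ℝ) = 1 := by
    rw [Matrix.adjugate_mul, hMdet, one_smul]
  have hM'det : M'.det = 1 := by rw [Matrix.det_adjugate, hMdet, one_pow]
  have hM'adj : M'.adjugate = (M : Matrix _ _ ℝ) := by
    rw [← mul_one M'.adjugate, ← hM', ← mul_assoc, Matrix.adjugate_mul, hM'det, one_smul, one_mul]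
  -- The last row of the adjugate is a conormal of the hyperplane; it is polynomial in the basis, so
  -- no division is needed for smoothness.
  let n : ℝ → ℝ → Vec d := fun s x => (B s x).adjugate (Fin.last d)
  have hnsm : ContDiff ℝ ∞ fun p : ℝ × ℝ => n p.1 p.2 :=
    contDiff_pi.2 fun i => contDiff_matrix_adjugate hBsm _ i
  have hn0 : n 0 = dualCurve G := by
    ext1 x; simp only [n, hB0]; rfl
  have hnM : ∀ s, s ≠ 0 → ∀ x, n s (x + 2 * Real.pi) = M'ᵀ *ᵥ n s x := by
    intro s hs x
    simp only [n, hBM s x hs, Matrix.adjugate_mul_distrib]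
    ext i
    simp [Matrix.mul_apply, Matrix.mulVec, dotProduct, M', mul_comm]
  have hNM : ∀ s, s ≠ 0 → ∀ x, coframe (n s) (x + 2 * Real.pi) = coframe (n s) x * M' := by
    intro s hs x
    ext i j
    have := congrFun (iteratedDeriv_add_period (contDiff_slice hnsm s) (hnM s hs) (d - (i : ℕ)) x) j
    simp only [coframe, Matrix.of_apply, Matrix.mul_apply]
    rw [this]
    simp [Matrix.mulVec, dotProduct, mul_comm]
  have hNsm : ∀ i j, ContDiff ℝ ∞ fun p : ℝ × ℝ => coframe (n p.1) p.2 i j := fun i j =>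
    contDiff_pi.1 (contDiff_iteratedDeriv_snd hnsm (d - (i : ℕ))) j
  -- The envelope point is the common kernel of n, …, n^(d-1), obtained from a column of the
  -- adjugate. The constant sign makes Y equal to G at s = 0.
  let Y : ℝ → ℝ → Vec d := fun s x =>
    ((-1) ^ d * dualSign d) • (coframe (n s) x).adjugate *ᵥ Pi.single 0 1
  have hYsm : ContDiff ℝ ∞ fun p : ℝ × ℝ => Y p.1 p.2 := by
    refine contDiff_pi.2 fun i => ?_
    simp only [Y, Matrix.mulVec_single_one, Pi.smul_apply, Matrix.col_apply]
    exact (contDiff_matrix_adjugate hNsm i 0).const_smul _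
  have hYM : ∀ s, s ≠ 0 → ∀ x, Y s (x + 2 * Real.pi) = (M : Matrix _ _ ℝ) *ᵥ Y s x := by
    intro s hs x
    simp only [Y, hNM s hs, Matrix.adjugate_mul_distrib, hM'adj]
    rw [Matrix.mulVec_smul, Matrix.mulVec_mulVec]
  have hNY : ∀ s x, coframe (n s) x *ᵥ Y s x =
      ((-1) ^ d * dualSign d * (coframe (n s) x).det) • Pi.single 0 1 := by
    intro s x
    simp only [Y]
    rw [Matrix.mulVec_smul, Matrix.mulVec_mulVec, Matrix.mul_adjugate,
      Matrix.smul_mulVec, Matrix.one_mulVec, smul_smul]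
  have hnY : ∀ s x i, i < d → iteratedDeriv i (n s) x ⬝ᵥ Y s x = 0 := by
    intro s x i hi
    have := congrFun (hNY s x) ⟨d - i, by omega⟩
    rw [Pi.smul_apply, Pi.single_eq_of_ne (by rw [Ne, Fin.ext_iff]; simp; omega), smul_zero] at this
    rw [← this]
    simp only [coframe, Matrix.mulVec, Matrix.of_apply]
    rw [show d - (d - i) = i by omega]
  have hY0 : Y 0 = G := by
    ext1 x
    have hdet := det_coframe_mul_det_frame (n := dualCurve G) (Z := G) (x := x)
      (fun i j hij => iteratedDeriv_dualCurve_dotProduct_eq_zero hG.smooth hG.smooth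
        (dualCurve_orthogonal hG.wronskian_eq) hij x)
      (fun i j hij => iteratedDeriv_dualCurve_dotProduct_self hG.smooth hG.wronskian_eq hij x)
    rw [det_frame, hG.wronskian_eq, mul_one] at hdet
    have h1 := hNY 0 x
    rw [hn0, hdet, mul_assoc, dualSign_mul_self, mul_one] at h1
    have h2 : coframe (dualCurve G) x *ᵥ G x = _ := coframe_mulVec fun i hi => by
      simpa using iteratedDeriv_dualCurve_dotProduct_eq_zero hG.smooth hG.smooth
        (dualCurve_orthogonal hG.wronskian_eq) (i := i) (j := 0) hi x
    have h3 := iteratedDeriv_dualCurve_dotProduct_self hG.smooth hG.wronskian_eq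
      (i := d) (j := 0) rfl x
    rw [iteratedDeriv_zero] at h3
    rw [h3, ← h1] at h2
    refine sub_eq_zero.1 (Matrix.eq_zero_of_mulVec_eq_zero
      (M := coframe (dualCurve G) x) (fun h0 => ?_) ?_)
    · have := dualSign_mul_self d
      rw [← hdet, h0] at this
      simp at this
    · rw [Matrix.mulVec_sub, h2, sub_self]
  let W : ℝ → ℝ → ℝ := fun s x => wronskian (Y s) x
  have hWsm : ContDiff ℝ ∞ fun p : ℝ × ℝ => W p.1 p.2 :=
    contDiff_matrix_det (contDiff_frame_family hYsm)
  obtain ⟨r₁, hr₁, hW⟩ := exists_forall_gt_half hpi hWsm.continuous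
    (fun x => by simp only [W, hY0, hG.wronskian_eq]) (fun s hs x => by
      simp only [W, ← det_frame]
      rw [frame_add_period (contDiff_slice hYsm s) (hYM s hs), Matrix.det_mul, hMdet, one_mul])
  obtain ⟨r₂, hr₂, hBdet⟩ := exists_forall_gt_half (H := fun s x => (B s x).det) hpi
    (contDiff_matrix_det hBsm).continuous
    (fun x => by rw [hB0, det_frame, hG.wronskian_eq]) (fun s hs x => by
      simp only [hBM s x hs, Matrix.det_mul, hMdet, one_mul])
  -- Multiplying Y by W^(-1/(d+1)) normalizes the Wronskian. W may fail to be positive for large s;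
  -- `positivePart` keeps the factor smooth for all (s, x) without changing it where W ≥ 1/2.
  let a : ℝ → ℝ → ℝ := fun s x => positivePart (W s x) ^ (-((d : ℝ) + 1)⁻¹)
  have hasm : ContDiff ℝ ∞ fun p : ℝ × ℝ => a p.1 p.2 :=
    (contDiff_positivePart.comp hWsm).rpow_const_of_ne fun p => (positivePart_pos _).ne'
  have ha : ∀ s x, 1 / 2 ≤ W s x → a s x ^ (d + 1) * W s x = 1 := by
    intro s x h
    have hpos : 0 < W s x := by linarith
    simp only [a, positivePart_of_half_le h]
    rw [← Real.rpow_natCast, ← Real.rpow_mul hpos.le]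
    push_cast
    rw [neg_mul, inv_mul_cancel₀ (by positivity), Real.rpow_neg_one, inv_mul_cancel₀ hpos.ne']
  have hZsm : ContDiff ℝ ∞ fun p : ℝ × ℝ => a p.1 p.2 • Y p.1 p.2 := hasm.smul hYsm
  refine ⟨fun s x => a s x • Y s x, hZsm, ?_, min r₁ r₂, lt_min hr₁ hr₂, fun s hs => ?_⟩
  · ext1 x
    have : W 0 x = 1 := by simp only [W, hY0, hG.wronskian_eq]
    simp only [a, this, hY0]
    rw [positivePart_of_half_le (by norm_num), Real.one_rpow, one_smul]
  have hs1 : s ∈ Set.Ioo 0 r₁ := ⟨hs.1, hs.2.trans_le (min_le_left _ _)⟩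
  have hs2 : s ∈ Set.Ioo 0 r₂ := ⟨hs.1, hs.2.trans_le (min_le_right _ _)⟩
  have hs0 : s ≠ 0 := hs.1.ne'
  refine ⟨⟨contDiff_slice (H := fun s x => a s x • Y s x) hZsm s, fun x => ?_, fun x => ?_⟩,
    fun x => ?_⟩
  · rw [wronskian_smul (contDiff_slice hYsm s) (contDiff_slice hasm s)]
    exact ha s x (hW s hs1 x).le
  · have : W s (x + 2 * Real.pi) = W s x := by
      simp only [W, ← det_frame]
      rw [frame_add_period (contDiff_slice hYsm s) (hYM s hs0), Matrix.det_mul, hMdet, one_mul]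
    simp only [a, this, hYM s hs0, Matrix.mulVec_smul]
  · rw [Submodule.span_le]
    rintro _ ⟨j, rfl⟩
    have hnZ := (dotProduct_iteratedDeriv (contDiff_slice hnsm s)
      (contDiff_slice (H := fun s x => a s x • Y s x) hZsm s) (m := d)
      (fun i hi x => by rw [dotProduct_smul, hnY s x i hi, smul_zero]) j).1 0 (by omega) x
    rw [iteratedDeriv_zero] at hnZ
    set v := iteratedDeriv (j : ℕ) (fun x => a s x • Y s x) x
    have hdet : (B s x).det ≠ 0 := by
      have := hBdet s hs2 x
      linarith
    -- By Cramer's rule, the coefficient of v along the added column is n · v, which vanishes.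
    have hv : (B s x).det • v = ∑ k : Fin d, ((B s x).adjugate *ᵥ v) k.castSucc • b k s x := by
      have h1 : B s x *ᵥ ((B s x).adjugate *ᵥ v) = (B s x).det • v := by
        rw [Matrix.mulVec_mulVec, Matrix.mul_adjugate, Matrix.smul_mulVec, Matrix.one_mulVec]
      rw [← h1, Matrix.mulVec_eq_sum, Fin.sum_univ_castSucc]
      have h2 : ((B s x).adjugate *ᵥ v) (Fin.last d) = 0 := hnZ
      rw [h2]
      simp only [← hBcol]
      simp [Matrix.col]
    have : v = (B s x).det⁻¹ • ∑ k : Fin d, ((B s x).adjugate *ᵥ v) k.castSucc • b k s x := by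
      rw [← hv, smul_smul, inv_mul_cancel₀ hdet, one_smul]
    change v ∈ _
    rw [this]
    exact Submodule.smul_mem _ _ (Submodule.sum_mem _ fun k _ =>
      Submodule.smul_mem _ _ (Submodule.subset_span ⟨k, rfl⟩))

end

/-! ### Second-order expansion of the envelope -/

section
variable {d : ℕ}

theorem iteratedDeriv_add_smul {G A : ℝ → Vec d} (hG : ContDiff ℝ ∞ G) (hA : ContDiff ℝ ∞ A)
    (c : ℝ) (j : ℕ) (x : ℝ) : iteratedDeriv j (fun x => G x + c • A x) x =
      iteratedDeriv j G x + c • iteratedDeriv j A x := by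
  have h1 : ContDiffAt ℝ j G x := (hG.of_le (by exact_mod_cast le_top)).contDiffAt
  have h2 : ContDiffAt ℝ j A x := (hA.of_le (by exact_mod_cast le_top)).contDiffAt
  rw [show (fun x => G x + c • A x) = G + c • A from rfl,
    iteratedDeriv_add h1 (g := c • A) (h2.const_smul c),
    iteratedDeriv_const_smul h2]

/-- In the frame of G the deformed frame is 1 + s^k X_s, with determinant 1; the sum is the trace of
X_0. -/
theorem sum_coord_eq_zero_of_wronskian_eq {G : ℝ → Vec d} (hG : ContDiff ℝ ∞ G)
    (hG1 : ∀ x, wronskian G x = 1) {A : ℝ → ℝ → Vec d}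
    (hA : ContDiff ℝ ∞ fun p : ℝ × ℝ => A p.1 p.2) {k : ℕ} (hk : k ≠ 0) {r : ℝ} (hr : 0 < r)
    (h : ∀ s ∈ Set.Ioo 0 r, ∀ x, wronskian (fun x => G x + s ^ k • A s x) x = 1) (x : ℝ) :
    ∑ j : Fin (d + 1), coord G x (iteratedDeriv j (A 0) x) j = 0 := by
  refine trace_eq_zero_of_det_eq_one (X := fun s => (frame G x).adjugate * frame (A s) x)
    (fun i j => ?_) hk hr fun s hs => ?_
  · simp only [Matrix.mul_apply]
    exact ContDiff.sum fun l _ => contDiff_const.mul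
      ((contDiff_frame_family hA l j).comp (by fun_prop : ContDiff ℝ ∞ fun s : ℝ => (s, x)))
  · have h1 : frame (fun x => G x + s ^ k • A s x) x = frame G x + s ^ k • frame (A s) x := by
      ext i j
      exact congrFun (iteratedDeriv_add_smul hG (contDiff_slice hA s) (s ^ k) j x) i
    have h2 : (frame G x).adjugate * frame (fun x => G x + s ^ k • A s x) x =
        1 + s ^ k • ((frame G x).adjugate * frame (A s) x) := by
      rw [h1, mul_add, Matrix.adjugate_mul, det_frame, hG1, one_smul, Matrix.mul_smul]
    rw [← h2, Matrix.det_mul, Matrix.det_adjugate, det_frame, det_frame, hG1, h s hs, one_pow,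
      one_mul]

theorem dualCurve_dotProduct_iteratedDeriv_smul {G : ℝ → Vec d} (hG : ContDiff ℝ ∞ G) {x : ℝ}
    (hG1 : wronskian G x = 1) {q : ℝ → ℝ} (hq : ContDiff ℝ ∞ q) {j : ℕ} (hj : j < d) :
    dualCurve G x ⬝ᵥ iteratedDeriv j (fun x => q x • G x) x = 0 := by
  rw [iteratedDeriv_smul_eq_sum hq hG, dotProduct_sum]
  refine Finset.sum_eq_zero fun i _ => ?_
  rw [dotProduct_smul, dualCurve_dotProduct_iteratedDeriv hG1 (by omega), if_neg (by omega),
    smul_zero]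

theorem topCoeff_eq {e : ℕ} (u : Coeffs (e + 2)) : topCoeff u = u (Fin.last (e + 1)) := by
  unfold topCoeff
  rw [dif_pos (by omega)]
  rfl

/-- Differentiating n · G^(d+1) = 0 gives n · G^(d+2) = -n' · G^(d+1). After substituting L G = 0,
only the term of G^(d-1) survives, because n' · G^(j) = 0 for j < d - 1 and n' · G^(d-1) = -1. -/
theorem coord_iteratedDeriv_succ_succ_last {e : ℕ} {G : ℝ → Vec (e + 2)} (hG : ContDiff ℝ ∞ G)
    (hG1 : ∀ x, wronskian G x = 1) (x : ℝ) :
    dualCurve G x ⬝ᵥ iteratedDeriv (e + 4) G x = -topCoeff (opCoeffs G) x := by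
  have h1 := (hasDerivAt_dotProduct (contDiff_dualCurve hG) hG 0 (e + 3) x).deriv
  have h0 : (fun x => iteratedDeriv 0 (dualCurve G) x ⬝ᵥ iteratedDeriv (e + 3) G x) = fun _ => 0 := by
    ext x
    rw [iteratedDeriv_zero, dualCurve_dotProduct, coord_iteratedDeriv_succ_last hG hG1]
  rw [h0, deriv_const, iteratedDeriv_zero] at h1
  have h2 := sum_coord_smul (hG1 x) (iteratedDeriv (e + 3) G x)
  rw [Fin.sum_univ_castSucc, coord_iteratedDeriv_succ_last hG hG1, zero_smul, add_zero,
    Fin.sum_univ_castSucc] at h2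
  rw [topCoeff_eq]
  unfold opCoeffs
  have h3 : iteratedDeriv (0 + 1) (dualCurve G) x ⬝ᵥ iteratedDeriv (e + 3) G x =
      -coord G x (iteratedDeriv (e + 3) G x) (Fin.last (e + 1)).castSucc := by
    nth_rewrite 1 [← h2]
    rw [dotProduct_add, dotProduct_sum, Finset.sum_eq_zero, zero_add, dotProduct_smul]
    · have := iteratedDeriv_dualCurve_dotProduct_self hG hG1 (i := 1) (j := e + 1) (by omega) x
      simp only [Fin.val_castSucc, Fin.val_last] at this ⊢
      rw [this, smul_eq_mul]; ring
    · intro i _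
      rw [dotProduct_smul, iteratedDeriv_dualCurve_dotProduct_eq_zero hG hG
        (dualCurve_orthogonal hG1), smul_zero]
      simp only [Fin.val_castSucc]; omega
  rw [h3] at h1
  linarith

theorem contDiff_topCoeff {u : Coeffs d} (hu : ∀ j, ContDiff ℝ ∞ (u j)) :
    ContDiff ℝ ∞ (topCoeff u) := by
  unfold topCoeff
  split_ifs
  · exact hu _
  · exact contDiff_const

theorem contDiff_opQ {E : Type} [NormedAddCommGroup E] [NormedSpace ℝ E] {u : Coeffs d}
    (hu : ∀ j, ContDiff ℝ ∞ (u j)) {f : ℝ → E} (hf : ContDiff ℝ ∞ f) :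
    ContDiff ℝ ∞ (opQ u f) :=
  (contDiff_iteratedDeriv hf 2).add ((contDiff_const.mul (contDiff_topCoeff hu)).smul hf)

theorem iteratedDeriv_iteratedDeriv {E : Type} [NormedAddCommGroup E] [NormedSpace ℝ E]
    (f : ℝ → E) (i j : ℕ) : iteratedDeriv i (iteratedDeriv j f) = iteratedDeriv (i + j) f := by
  simp only [iteratedDeriv_eq_iterate, Function.iterate_add_apply]

theorem iteratedDeriv_opQ {u : Coeffs d} (hu : ∀ j, ContDiff ℝ ∞ (u j)) {G : ℝ → Vec d}
    (hG : ContDiff ℝ ∞ G) (j : ℕ) (x : ℝ) : iteratedDeriv j (opQ u G) x =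
      iteratedDeriv (j + 2) G x +
        iteratedDeriv j (fun x => (2 / ((d : ℝ) + 1) * topCoeff u x) • G x) x := by
  have := iteratedDeriv_add_smul (contDiff_iteratedDeriv hG 2)
    ((contDiff_const (c := 2 / ((d : ℝ) + 1)).mul (contDiff_topCoeff hu)).smul hG) 1 j x
  simp only [one_smul, iteratedDeriv_iteratedDeriv] at this
  exact this

/-- The potential term contributes only derivatives of G below order d, so only G^(j+2) matters: for
j = d - 2 it is G^(d), and for j = d - 1 it is G^(d+1), which has no G^(d)-component. -/
theorem dualCurve_dotProduct_opQ {G : ℝ → Vec d} (hG : ContDiff ℝ ∞ G)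
    (hG1 : ∀ x, wronskian G x = 1) {j : ℕ} (hj : j < d) (x : ℝ) :
    dualCurve G x ⬝ᵥ iteratedDeriv j (opQ (opCoeffs G) G) x = if j + 2 = d then 1 else 0 := by
  rw [iteratedDeriv_opQ (contDiff_opCoeffs hG) hG, dotProduct_add,
    dualCurve_dotProduct_iteratedDeriv_smul hG (hG1 x)
      (contDiff_const.mul (contDiff_topCoeff (contDiff_opCoeffs hG))) hj, add_zero]
  rcases lt_or_ge (j + 2) (d + 1) with h | h
  · exact dualCurve_dotProduct_iteratedDeriv (hG1 x) h
  · obtain rfl : d = j + 1 := by omega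
    rw [dualCurve_dotProduct, coord_iteratedDeriv_succ_last hG hG1, if_neg (by omega)]

/-- The second derivative contributes -u_{d-1} to each of the last two diagonal entries, and the
potential contributes 2/(d+1) u_{d-1} to all d + 1 of them; the total is zero. This fixes the
constant in Q₂. -/
theorem sum_coord_opQ (hd : 2 ≤ d) {G : ℝ → Vec d} (hG : ContDiff ℝ ∞ G)
    (hG1 : ∀ x, wronskian G x = 1) (x : ℝ) :
    ∑ j : Fin (d + 1), coord G x (iteratedDeriv j (opQ (opCoeffs G) G) x) j = 0 := by
  obtain ⟨e, rfl⟩ : ∃ e, d = e + 2 := ⟨d - 2, by omega⟩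
  have hq : ContDiff ℝ ∞ fun x => 2 / (((e + 2 : ℕ) : ℝ) + 1) * topCoeff (opCoeffs G) x :=
    contDiff_const.mul (contDiff_topCoeff (contDiff_opCoeffs hG))
  simp only [iteratedDeriv_opQ (contDiff_opCoeffs hG) hG, map_add, Pi.add_apply,
    Finset.sum_add_distrib, coord_iteratedDeriv_smul hG (hG1 x) hq]
  rw [Finset.sum_const, Finset.card_univ, Fintype.card_fin, Fin.sum_univ_castSucc,
    Fin.sum_univ_castSucc, Finset.sum_eq_zero, zero_add]
  · have h1 := coord_iteratedDeriv_succ_succ_last hG hG1 x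
    rw [dualCurve_dotProduct] at h1
    have h2 : coord G x (iteratedDeriv (e + 3) G x) (Fin.last (e + 1)).castSucc =
        -topCoeff (opCoeffs G) x := by rw [topCoeff_eq]; simp [opCoeffs]
    simp only [Fin.val_castSucc, Fin.val_last]
    rw [show coord G x (iteratedDeriv (e + 1 + 2) G x) _ = _ from h2,
      show coord G x (iteratedDeriv (e + 2 + 2) G x) _ = _ from h1, nsmul_eq_mul]
    push_cast
    field_simp
    ring
  · intro i _
    simp only [Fin.val_castSucc]
    rw [coord_iteratedDeriv_apply (hG1 x) (by omega), if_neg]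
    simp

/-- The `s²`-expansion of a family of envelopes of hyperplanes with bases `G^(j) + s² B_j`. -/
theorem exists_envelope_expansion (hd : 2 ≤ d) {G : ℝ → Vec d} (hG : ContDiff ℝ ∞ G)
    (hG1 : ∀ x, wronskian G x = 1) {Z : ℝ → ℝ → Vec d}
    (hZ : ContDiff ℝ ∞ fun p : ℝ × ℝ => Z p.1 p.2) (hZ0 : Z 0 = G) {B : Fin d → ℝ → ℝ → Vec d}
    (hB : ∀ j, ContDiff ℝ ∞ fun p : ℝ × ℝ => B j p.1 p.2) {C r : ℝ} (hr : 0 < r)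
    (hB0 : ∀ j x, dualCurve G x ⬝ᵥ B j 0 x = if (j : ℕ) + 2 = d then C else 0)
    (hZ1 : ∀ s ∈ Set.Ioo 0 r, ∀ x, wronskian (Z s) x = 1)
    (hBZ : ∀ s ∈ Set.Ioo 0 r, ∀ (j : Fin d) x,
      dualCurve (Z s) x ⬝ᵥ (iteratedDeriv j G x + s ^ 2 • B j s x) = 0) :
    ∃ F : ℝ → ℝ → Vec d, (ContDiff ℝ ∞ fun p : ℝ × ℝ => F p.1 p.2) ∧
      (∀ s x, Z s x = G x + s ^ 2 • F s x) ∧ F 0 = C • opQ (opCoeffs G) G := by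
  have hsl : ∀ x, ContDiff ℝ ∞ fun s => dualCurve (Z s) x := fun x =>
    contDiff_pi.2 fun i => contDiff_matrix_adjugate (fun k l =>
      (contDiff_frame_family hZ k l).comp (by fun_prop : ContDiff ℝ ∞ fun s : ℝ => (s, x))) _ i
  have hdot : ∀ {H : ℝ → ℝ → Vec d}, (ContDiff ℝ ∞ fun p : ℝ × ℝ => H p.1 p.2) → ∀ x,
      Continuous fun s => dualCurve (Z s) x ⬝ᵥ H s x := fun {H} hH x => by
    simp only [dotProduct]
    exact continuous_finsetSum _ fun i _ => ((contDiff_pi.1 (hsl x) i).continuous).mul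
      ((contDiff_pi.1 hH i).continuous.comp (by fun_prop : Continuous fun s : ℝ => (s, x)))
  -- The conormal of Z_s annihilates both Z_s^(j) and the basis vector G^(j) + s² B_j, hence their
  -- difference.
  have hstep : ∀ {A : ℝ → ℝ → Vec d} {k : ℕ}, (ContDiff ℝ ∞ fun p : ℝ × ℝ => A p.1 p.2) →
      (∀ s x, Z s x = G x + s ^ k • A s x) → ∀ s ∈ Set.Ioo 0 r, ∀ (j : Fin d) x,
      s ^ k * (dualCurve (Z s) x ⬝ᵥ iteratedDeriv j (A s) x) =
        s ^ 2 * (dualCurve (Z s) x ⬝ᵥ B j s x) := by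
    intro A k hA hZA s hs j x
    have h1 := hBZ s hs j x
    have h2 := dualCurve_orthogonal (hZ1 s hs) j j.2 x
    nth_rewrite 2 [funext (hZA s)] at h2
    rw [iteratedDeriv_add_smul hG (contDiff_slice hA s)] at h2
    rw [dotProduct_add, dotProduct_smul, smul_eq_mul] at h1 h2
    linarith
  obtain ⟨A, hA, hZA⟩ := exists_smooth_quotient hZ
  have hZA' : ∀ s x, Z s x = G x + s ^ 1 • A s x := fun s x => by rw [hZA, hZ0, pow_one]
  -- There is no first-order term: dividing by s shows that A_0 preserves the osculating
  -- hyperplanes, and its trace is zero.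
  have hA0 : A 0 = 0 := by
    refine eq_zero_of_osculating_of_trace hG hG1 (contDiff_slice hA 0) (fun j hj x => ?_)
      (sum_coord_eq_zero_of_wronskian_eq hG hG1 hA one_ne_zero hr fun s hs x => by
        rw [← funext (hZA' s)]; exact hZ1 s hs x)
    have := apply_zero_eq_of_eventuallyEq
      (f := fun s => dualCurve (Z s) x ⬝ᵥ iteratedDeriv j (A s) x)
      (g := fun s => s * (dualCurve (Z s) x ⬝ᵥ B ⟨j, hj⟩ s x))
      (hdot (H := fun s x => iteratedDeriv j (A s) x) (contDiff_iteratedDeriv_snd hA j) x)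
      (continuous_id.mul (hdot (hB ⟨j, hj⟩) x)) hr fun s hs => by
        have h1 := hstep hA hZA' s hs ⟨j, hj⟩ x
        apply mul_left_cancel₀ hs.1.ne'
        linear_combination h1
    simpa [hZ0] using this
  obtain ⟨F, hF, hAF⟩ := exists_smooth_quotient hA
  have hZF : ∀ s x, Z s x = G x + s ^ 2 • F s x := fun s x => by
    rw [hZA', hAF, hA0, Pi.zero_apply, zero_add, smul_smul, pow_one, sq]
  refine ⟨F, hF, hZF, ?_⟩
  have hQ := contDiff_opQ (contDiff_opCoeffs hG) hG
  have hE : ∀ (j : ℕ) x, iteratedDeriv j (fun x => F 0 x + (-C) • opQ (opCoeffs G) G x) x =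
      iteratedDeriv j (F 0) x + (-C) • iteratedDeriv j (opQ (opCoeffs G) G) x := fun j x =>
    iteratedDeriv_add_smul (contDiff_slice hF 0) hQ (-C) j x
  -- F_0 and C Q₂ G have the same conormal components and the same zero trace, so their difference
  -- vanishes by rigidity.
  have key : (fun x => F 0 x + (-C) • opQ (opCoeffs G) G x) = 0 := by
    refine eq_zero_of_osculating_of_trace hG hG1
      ((contDiff_slice hF 0).add (hQ.const_smul _)) (fun j hj x => ?_) fun x => ?_
    · have h1 := apply_zero_eq_of_eventuallyEq (hdot (contDiff_iteratedDeriv_snd hF j) x)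
        (hdot (hB ⟨j, hj⟩) x) hr fun s hs =>
          mul_left_cancel₀ (pow_ne_zero 2 hs.1.ne') (hstep hF hZF s hs ⟨j, hj⟩ x)
      simp only [hZ0, hB0] at h1
      rw [hE, dotProduct_add, dotProduct_smul, h1, dualCurve_dotProduct_opQ hG hG1 hj]
      split_ifs <;> simp
    · have h1 := sum_coord_eq_zero_of_wronskian_eq hG hG1 hF two_ne_zero hr fun s hs x => by
        rw [← funext (hZF s)]; exact hZ1 s hs x
      simp only [hE, map_add, map_smul, Pi.add_apply, Pi.smul_apply, Finset.sum_add_distrib,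
        ← Finset.smul_sum, h1 x, sum_coord_opQ hd hG hG1 x]
      simp
  ext1 x
  have := congrFun key x
  simp only [neg_smul, Pi.zero_apply] at this
  exact add_neg_eq_zero.1 this

end

/-! ### Lagrange interpolation at the nodes and bases of the hyperplanes -/

section Nodes
open Polynomial

/-- Vieta for the three top coefficients of Π (X - k_i), with the second elementary symmetric
function written through power sums. -/
theorem nodal_coeff {ι : Type*} [DecidableEq ι] (s : Finset ι) (k : ι → ℝ) :
    (∀ m, s.card = m → (Lagrange.nodal s k).coeff m = 1) ∧
    (∀ m, s.card = m + 1 → (Lagrange.nodal s k).coeff m = -∑ i ∈ s, k i) ∧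
    (∀ m, s.card = m + 2 → (Lagrange.nodal s k).coeff m =
      ((∑ i ∈ s, k i) ^ 2 - ∑ i ∈ s, k i ^ 2) / 2) := by
  induction s using Finset.induction_on with
  | empty => simp [eq_comm]
  | insert a s ha ih =>
    obtain ⟨h0, h1, h2⟩ := ih
    have hz : ∀ m, s.card < m → (Lagrange.nodal s k).coeff m = 0 := fun m hm =>
      coeff_eq_zero_of_natDegree_lt (by rwa [Lagrange.natDegree_nodal])
    rw [Lagrange.nodal_insert_eq_nodal ha]
    simp only [sub_mul, coeff_sub, coeff_C_mul, Finset.card_insert_of_notMem ha,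
      Finset.sum_insert ha]
    refine ⟨fun m hm => ?_, fun m hm => ?_, fun m hm => ?_⟩
    · obtain rfl : m = s.card + 1 := hm.symm
      rw [coeff_X_mul, h0 _ rfl, hz _ (by omega)]; ring
    · obtain rfl : m = s.card := by omega
      rw [h0 _ rfl]
      rcases Nat.eq_zero_or_pos s.card with hs | hs
      · rw [Finset.card_eq_zero.1 hs]; simp
      · obtain ⟨e, he⟩ : ∃ e, s.card = e + 1 := ⟨s.card - 1, by omega⟩
        rw [he, coeff_X_mul, h1 e he]; ring
    · have hm' : s.card = m + 1 := by omega
      rw [h1 m hm']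
      rcases m with _ | e
      · obtain ⟨b, rfl⟩ := Finset.card_eq_one.1 hm'
        simp; ring
      · rw [coeff_X_mul, h2 e hm']; ring

/-- The coefficients of the Lagrange basis polynomials of the nodes `k`. -/
noncomputable def lagrangeCoeff (P : Finset ℤ) (k : ℤ → ℝ) (j : ℕ) (p : ℤ) : ℝ :=
  (Lagrange.basis P k p).coeff j

theorem sum_lagrangeCoeff_eval {P : Finset ℤ} {k : ℤ → ℝ} (hk : Set.InjOn k P) {f : ℝ[X]}
    (hf : f.degree < P.card) (j : ℕ) :
    ∑ p ∈ P, lagrangeCoeff P k j p * f.eval (k p) = f.coeff j := by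
  conv_rhs => rw [Lagrange.eq_interpolate hk hf, Lagrange.interpolate_apply, finsetSum_coeff]
  exact Finset.sum_congr rfl fun p _ => by rw [coeff_C_mul, lagrangeCoeff, mul_comm]

theorem sum_lagrangeCoeff_pow {P : Finset ℤ} {k : ℤ → ℝ} (hk : Set.InjOn k P) {i : ℕ}
    (hi : i < P.card) (j : ℕ) :
    ∑ p ∈ P, lagrangeCoeff P k j p * k p ^ i = if j = i then 1 else 0 := by
  have := sum_lagrangeCoeff_eval hk (f := X ^ i) (by rw [degree_X_pow]; exact_mod_cast hi) j
  simpa [coeff_X_pow] using this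

/-- On the nodes the first power outside the interpolation range, X^d with d the number of nodes,
agrees with X^d minus the nodal polynomial, which has lower degree and is interpolated exactly. -/
theorem sum_lagrangeCoeff_pow_card {P : Finset ℤ} {k : ℤ → ℝ} (hk : Set.InjOn k P)
    {j : ℕ} (hj : j < P.card) :
    ∑ p ∈ P, lagrangeCoeff P k j p * k p ^ P.card = -(Lagrange.nodal P k).coeff j := by
  have hdeg : (X ^ P.card - Lagrange.nodal P k).degree < (P.card : WithBot ℕ) := by
    have h1 : (X ^ P.card - Lagrange.nodal P k).degree < (X ^ P.card : ℝ[X]).degree :=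
      degree_sub_lt_left (by rw [Lagrange.degree_nodal, degree_X_pow]) (pow_ne_zero _ X_ne_zero)
        (by rw [(Lagrange.nodal_monic).leadingCoeff, (monic_X_pow _).leadingCoeff])
    rwa [degree_X_pow] at h1
  have := sum_lagrangeCoeff_eval hk hdeg j
  rw [coeff_sub, coeff_X_pow, if_neg hj.ne, zero_sub] at this
  rw [← this]
  refine Finset.sum_congr rfl fun p hp => ?_
  rw [eval_sub, Lagrange.eval_nodal_at_node hp, sub_zero, eval_pow, eval_X]

end Nodes

section
variable {d : ℕ}

/-- The positions of the vertices of `P`, centred at `0`. -/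
noncomputable def node (P : Finset ℤ) (p : ℤ) : ℝ := (p : ℝ) - (∑ q ∈ P, (q : ℝ)) / (P.card : ℝ)

theorem node_injective (P : Finset ℤ) : Function.Injective (node P) := fun p q h => by
  simpa [node] using h

theorem sum_node {P : Finset ℤ} (hP : P.card ≠ 0) : ∑ p ∈ P, node P p = 0 := by
  have : (P.card : ℝ) ≠ 0 := by exact_mod_cast hP
  simp only [node, Finset.sum_sub_distrib, Finset.sum_const, nsmul_eq_mul]
  field_simp
  ring

theorem sum_node_sq_pos {P : Finset ℤ} (hP : 2 ≤ P.card) : 0 < ∑ p ∈ P, node P p ^ 2 := by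
  obtain ⟨a, ha, b, hb, hab⟩ := Finset.one_lt_card.1 hP
  by_cases h : node P a = 0
  · refine Finset.sum_pos' (fun p _ => sq_nonneg _) ⟨b, hb, ?_⟩
    have : node P b ≠ 0 := fun h' => hab (node_injective P (h.trans h'.symm))
    positivity
  · exact Finset.sum_pos' (fun p _ => sq_nonneg _) ⟨a, ha, by positivity⟩

/-- The constant of the continuous limit. -/
noncomputable def limitConst (d : ℕ) (P : Finset ℤ) : ℝ :=
  ((d - 2).factorial : ℝ) / (d.factorial : ℝ) * ((∑ p ∈ P, node P p ^ 2) / 2)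

theorem limitConst_pos {P : Finset ℤ} (hP : 2 ≤ P.card) : 0 < limitConst d P := by
  have := sum_node_sq_pos hP
  unfold limitConst
  positivity

/-- The hyperplanes `Π_ε(x)` have bases `G^(j) + ε² B_j(ε, x)`. -/
theorem exists_hyperplane_basis (hd : 2 ≤ d) {P : Finset ℤ} (hP : P.card = d) {G : ℝ → Vec d}
    (hG : ContDiff ℝ ∞ G) (hG1 : ∀ x, wronskian G x = 1) :
    ∃ B : Fin d → ℝ → ℝ → Vec d, (∀ j, ContDiff ℝ ∞ fun p : ℝ × ℝ => B j p.1 p.2) ∧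
      (∀ j x, dualCurve G x ⬝ᵥ B j 0 x = if (j : ℕ) + 2 = d then limitConst d P else 0) ∧
      ∀ (j : Fin d) s x, s ≠ 0 → iteratedDeriv j G x + s ^ 2 • B j s x =
        (((j : ℕ).factorial : ℝ) * (s ^ (j : ℕ))⁻¹) •
          ∑ p ∈ P, lagrangeCoeff P (node P) j p • G (x + node P p * s) := by
  obtain ⟨R, hR, hT⟩ := exists_taylor_remainder (d + 2) hG
  set k := node P
  have hk : Set.InjOn k P := (node_injective P).injOn
  set V := lagrangeCoeff P k
  let c : ℕ → ℕ → ℝ := fun j i => ∑ p ∈ P, V j p * k p ^ i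
  have hc1 : ∀ i j, i < d → c j i = if j = i then 1 else 0 := fun i j hi =>
    sum_lagrangeCoeff_pow hk (by omega) j
  have hcd : ∀ j, j < d → c j d = -(Lagrange.nodal P k).coeff j := fun j hj => by
    have := sum_lagrangeCoeff_pow_card hk (j := j) (by omega)
    rw [hP] at this
    exact this
  have hsum : ∑ p ∈ P, k p = 0 := sum_node (by omega)
  have hcd1 : ∀ j, j + 1 = d → c j d = 0 := fun j hj => by
    rw [hcd j (by omega), (nodal_coeff P k).2.1 j (by omega), hsum]; simp
  have hcd2 : ∀ j, j + 2 = d → c j d = (∑ p ∈ P, k p ^ 2) / 2 := fun j hj => by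
    rw [hcd j (by omega), (nodal_coeff P k).2.2 j (by omega), hsum]; ring
  -- The terms of orders d, d + 1 and d + 2 of the Taylor expansion, divided by s^j and s². For j =
  -- d - 1 the truncated exponent d - 2 - j is wrong, but c j d is then zero because the nodes have
  -- sum zero.
  refine ⟨fun j s x => ((j : ℕ).factorial : ℝ) •
    ((c j d * s ^ (d - 2 - j) / (d.factorial : ℝ)) • iteratedDeriv d G x +
      (c j (d + 1) * s ^ (d - 1 - j) / ((d + 1).factorial : ℝ)) • iteratedDeriv (d + 1) G x +
      s ^ (d - j) • ∑ p ∈ P, (V j p * k p ^ (d + 2)) • R (k p * s) x), ?_, ?_, ?_⟩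
  · intro j
    refine ContDiff.const_smul _ (ContDiff.add (ContDiff.add ?_ ?_) ?_)
    · exact ((contDiff_const.mul (contDiff_fst.pow _)).div_const _).smul
        ((contDiff_iteratedDeriv hG d).comp contDiff_snd)
    · exact ((contDiff_const.mul (contDiff_fst.pow _)).div_const _).smul
        ((contDiff_iteratedDeriv hG (d + 1)).comp contDiff_snd)
    · refine (contDiff_fst.pow _).smul (ContDiff.sum fun p _ => ContDiff.const_smul _ ?_)
      exact hR.comp (by fun_prop : ContDiff ℝ ∞ fun q : ℝ × ℝ => (k p * q.1, q.2))
  · intro j x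
    have h1 := dualCurve_dotProduct_iteratedDeriv (hG1 x) (k := d) (by omega)
    have h2 : dualCurve G x ⬝ᵥ iteratedDeriv (d + 1) G x = 0 := by
      rw [dualCurve_dotProduct, coord_iteratedDeriv_succ_last hG hG1]
    rw [if_pos rfl] at h1
    beta_reduce
    rw [zero_pow (by omega : d - (j : ℕ) ≠ 0), zero_smul, add_zero]
    simp only [dotProduct_smul, dotProduct_add, h1, h2, smul_eq_mul, mul_zero, add_zero, mul_one]
    -- At s = 0 the G^(d+1)-term is invisible to the conormal, and the G^(d)-term survives only for
    -- j = d - 2, with value (d-2)!/d! times half the sum of squares of the nodes.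
    split_ifs with hj
    · rw [hcd2 j hj, limitConst, show d - 2 - (j : ℕ) = 0 by omega, show d - 2 = (j : ℕ) by omega,
        pow_zero]
      ring
    · rcases Nat.lt_or_ge ((j : ℕ) + 1) d with h | h
      · rw [zero_pow (by omega : d - 2 - (j : ℕ) ≠ 0)]; simp
      · rw [hcd1 j (by omega)]; simp
  · intro j s x hs
    have hjd := j.2
    have key : ∑ p ∈ P, V j p • G (x + k p * s) =
        ∑ i ∈ Finset.range (d + 2), (c j i * s ^ i / (i.factorial : ℝ)) • iteratedDeriv i G x +
          s ^ (d + 2) • ∑ p ∈ P, (V j p * k p ^ (d + 2)) • R (k p * s) x := by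
      simp only [hT, smul_add, Finset.smul_sum, Finset.sum_add_distrib]
      rw [Finset.sum_comm]
      congr 1
      · refine Finset.sum_congr rfl fun i _ => ?_
        simp only [c, smul_smul]
        rw [← Finset.sum_smul, Finset.sum_mul, Finset.sum_div]
        congr 1
        exact Finset.sum_congr rfl fun p _ => by rw [mul_pow]; ring
      · refine Finset.sum_congr rfl fun p _ => ?_
        rw [smul_smul, smul_smul, mul_pow]; congr 1; ring
    have hlow : ∑ i ∈ Finset.range d, (c j i * s ^ i / (i.factorial : ℝ)) • iteratedDeriv i G x =
        (s ^ (j : ℕ) / ((j : ℕ).factorial : ℝ)) • iteratedDeriv j G x := by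
      rw [Finset.sum_eq_single (j : ℕ)]
      · rw [hc1 _ _ hjd, if_pos rfl, one_mul]
      · intro i hi hij
        rw [hc1 _ _ (Finset.mem_range.1 hi), if_neg hij.symm]; simp
      · intro h; exact absurd (Finset.mem_range.2 hjd) h
    have hfac : ((j : ℕ).factorial : ℝ) ≠ 0 := by positivity
    have hsj : s ^ (j : ℕ) ≠ 0 := pow_ne_zero _ hs
    have e1 : c j d * (s ^ 2 * s ^ (d - 2 - (j : ℕ))) * s ^ (j : ℕ) = c j d * s ^ d := by
      rcases Nat.lt_or_ge ((j : ℕ) + 1) d with h | h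
      · rw [mul_assoc, ← pow_add, ← pow_add]; congr 2; omega
      · rw [hcd1 j (by omega)]; simp
    have e2 : s ^ 2 * s ^ (d - 1 - (j : ℕ)) * s ^ (j : ℕ) = s ^ (d + 1) := by
      rw [← pow_add, ← pow_add]; congr 1; omega
    have e3 : s ^ 2 * s ^ (d - (j : ℕ)) * s ^ (j : ℕ) = s ^ (d + 2) := by
      rw [← pow_add, ← pow_add]; congr 1; omega
    rw [key, Finset.sum_range_succ, Finset.sum_range_succ, hlow, ← e1, ← e2, ← e3]
    simp only [smul_add, smul_smul]
    rw [← add_assoc, ← add_assoc]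
    congr 1
    · congr 1
      · congr 1
        · rw [show ((j : ℕ).factorial : ℝ) * (s ^ (j : ℕ))⁻¹ *
            (s ^ (j : ℕ) / ((j : ℕ).factorial : ℝ)) = 1 by field_simp, one_smul]
        · congr 1; field_simp
      · congr 1; field_simp
    · congr 1; field_simp

theorem finrank_curveHyperplane_le (P : Finset ℤ) (G : ℝ → Vec d) (s x : ℝ) :
    Module.finrank ℝ (curveHyperplane P G s x) ≤ P.card := by
  classical
  unfold curveHyperplane
  rw [← Finset.coe_image]
  exact (finrank_span_finset_le_card _).trans Finset.card_image_le

end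

/-! ### Variation of the operator and the continuous limit of T_{P,Q} -/

section
variable {d : ℕ}

theorem opL_apply {u : Coeffs d} {f : ℝ → Vec d} (hf : ContDiff ℝ ∞ f) (x : ℝ) (i : Fin (d + 1)) :
    opL u f x i = opL u (fun x => f x i) x := by
  simp [opL, iteratedDeriv_apply hf]

theorem opQ_apply {u : Coeffs d} {f : ℝ → Vec d} (hf : ContDiff ℝ ∞ f) (x : ℝ) (i : Fin (d + 1)) :
    opQ u f x i = opQ u (fun x => f x i) x := by
  simp [opQ, iteratedDeriv_apply hf]

theorem opL_add_smul {u : Coeffs d} {G A : ℝ → Vec d} (hG : ContDiff ℝ ∞ G)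
    (hA : ContDiff ℝ ∞ A) (c x : ℝ) :
    opL u (fun x => G x + c • A x) x = opL u G x + c • opL u A x := by
  simp only [opL, iteratedDeriv_add_smul hG hA, smul_add, Finset.sum_add_distrib, Finset.smul_sum]
  simp only [smul_comm c]
  abel

theorem opL_smul {u : Coeffs d} {A : ℝ → Vec d} (hA : ContDiff ℝ ∞ A) (c x : ℝ) :
    opL u (c • A) x = c • opL u A x := by
  have := opL_add_smul (u := u) (contDiff_const (c := (0 : Vec d))) hA c x
  have h0 : opL u (fun _ => (0 : Vec d)) x = 0 := by
    simp [opL]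
  rw [h0, zero_add] at this
  simp only [zero_add] at this
  exact this

/-- The KdV vector field at the operator annihilating `G`. -/
theorem IsKdVField.eq_coord {W : Coeffs d → Coeffs d} (hW : IsKdVField W) {G : ℝ → Vec d}
    (hG : ContDiff ℝ ∞ G) (hG1 : ∀ x, wronskian G x = 1) (j : Fin d) (x : ℝ) :
    W (opCoeffs G) j x =
      -coord G x (opL (opCoeffs G) (opQ (opCoeffs G) G) x) j.castSucc := by
  have hu := contDiff_opCoeffs hG
  have h1 : ∑ j : Fin d, W (opCoeffs G) j x • iteratedDeriv (j : ℕ) G x =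
      -opL (opCoeffs G) (opQ (opCoeffs G) G) x := by
    ext i
    have h := hW (opCoeffs G) hu (fun x => G x i) (contDiff_pi.1 hG i) x
    have hL : opL (opCoeffs G) (fun x => G x i) = fun _ => 0 := by
      ext x
      rw [← opL_apply hG, opL_opCoeffs hG hG1]; rfl
    have hQ0 : opQ (opCoeffs G) (fun _ : ℝ => (0 : ℝ)) x = 0 := by
      simp [opQ]
    rw [hL, hQ0, zero_sub] at h
    rw [Pi.neg_apply, opL_apply (contDiff_opQ hu hG)]
    simp only [opQ_apply hG]
    rw [← h]
    simp [Finset.sum_apply, iteratedDeriv_apply hG]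
  have h2 := congrArg (fun v => coord G x v j.castSucc) h1
  simp only [map_neg, Pi.neg_apply, map_sum, map_smul, Finset.sum_apply, Pi.smul_apply] at h2
  rw [← h2, Finset.sum_eq_single j]
  · rw [coord_iteratedDeriv_apply (hG1 x) (by omega)]; simp
  · intro i _ hij
    rw [coord_iteratedDeriv_apply (hG1 x) (by omega), if_neg, smul_zero]
    simpa [Fin.ext_iff, eq_comm] using hij
  · simp

/-- With L the operator of G, L Z = c L F while the operator of Z kills Z. The two operators differ
by one of order below d, so its coefficients are the coordinates of -c L F in the frame of Z. The
formula is exact, not only first order in c. -/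
theorem opCoeffs_add_smul {G F : ℝ → Vec d} (hG : ContDiff ℝ ∞ G) (hG1 : ∀ x, wronskian G x = 1)
    (hF : ContDiff ℝ ∞ F) {c : ℝ} (h1 : ∀ x, wronskian (fun x => G x + c • F x) x = 1)
    (j : Fin d) (x : ℝ) : opCoeffs (fun x => G x + c • F x) j x = opCoeffs G j x +
      c * -coord (fun x => G x + c • F x) x (opL (opCoeffs G) F x) j.castSucc := by
  set Z := fun x => G x + c • F x with hZdef
  have hZ : ContDiff ℝ ∞ Z := hG.add (hF.const_smul c)
  have e1 : opL (opCoeffs G) Z x = c • opL (opCoeffs G) F x := by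
    rw [hZdef, opL_add_smul hG hF, opL_opCoeffs hG hG1, zero_add]
  have e2 := opL_opCoeffs hZ h1 x
  have e3 : ∑ i : Fin d, (opCoeffs Z i x - opCoeffs G i x) • iteratedDeriv (i : ℕ) Z x =
      -(c • opL (opCoeffs G) F x) := by
    rw [← e1, eq_neg_iff_add_eq_zero, ← e2]
    simp only [opL, sub_smul, Finset.sum_sub_distrib]
    abel
  have e4 := congrArg (fun v => coord Z x v j.castSucc) e3
  simp only [map_neg, Pi.neg_apply, map_sum, map_smul, Finset.sum_apply, Pi.smul_apply] at e4
  rw [Finset.sum_eq_single j] at e4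
  · rw [coord_iteratedDeriv_apply (h1 x) (by omega)] at e4
    simp at e4
    linarith
  · intro i _ hij
    rw [coord_iteratedDeriv_apply (h1 x) (by omega), if_neg, smul_zero]
    simpa [Fin.ext_iff, eq_comm] using hij
  · simp

theorem exists_bound_on_strip {E : Type} [NormedAddCommGroup E] {H : ℝ → ℝ → E}
    (hH : Continuous fun p : ℝ × ℝ => H p.1 p.2) (r a b : ℝ) :
    ∃ K : ℝ, ∀ s ∈ Set.Ioo 0 r, ∀ x ∈ Set.Icc a b, ‖H s x‖ ≤ K := by
  obtain ⟨K, hK⟩ := (isCompact_Icc (a := (0 : ℝ)) (b := r)).prod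
    (isCompact_Icc (a := a) (b := b)) |>.exists_bound_of_continuousOn hH.continuousOn
  exact ⟨K, fun s hs x hx => hK (s, x) ⟨⟨hs.1.le, hs.2.le⟩, hx⟩⟩

theorem contDiff_coord_family {Z E : ℝ → ℝ → Vec d}
    (hZ : ContDiff ℝ ∞ fun p : ℝ × ℝ => Z p.1 p.2) (hE : ContDiff ℝ ∞ fun p : ℝ × ℝ => E p.1 p.2)
    (j : Fin (d + 1)) : ContDiff ℝ ∞ fun p : ℝ × ℝ => coord (Z p.1) p.2 (E p.1 p.2) j := by
  simp only [coord, Matrix.mulVecLin_apply, Matrix.mulVec, dotProduct]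
  exact ContDiff.sum fun i _ =>
    (contDiff_matrix_adjugate (contDiff_frame_family hZ) j i).mul (contDiff_pi.1 hE i)

/-- The continuous limit of the maps `T_{P,Q}`. -/
theorem isEnvelopeLimit (hd : 2 ≤ d) {P Q : Finset ℤ} (hP : P.card = d)
    (hQ : ∃ (a : ℤ) (m : ℕ), 0 < m ∧ Q = progression a m d) {W : Coeffs d → Coeffs d}
    (hW : IsKdVField W) :
    IsEnvelopeLimit P Q (fun u G => limitConst d P • opQ u G) (fun u => limitConst d P • W u) := by
  refine ⟨hP, hQ, fun M G hG => ?_⟩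
  have hMdet : (M : Matrix (Fin (d + 1)) (Fin (d + 1)) ℝ).det = 1 := M.2
  have hu := contDiff_opCoeffs hG.smooth
  refine ⟨opCoeffs G, fun j => ⟨hu j, opCoeffs_periodic hMdet hG.smooth hG.quasiperiodic j⟩,
    opL_opCoeffs hG.smooth hG.wronskian_eq, ?_⟩
  obtain ⟨B, hB, hB0, hbasis⟩ := exists_hyperplane_basis hd hP hG.smooth hG.wronskian_eq
  let b : Fin d → ℝ → ℝ → Vec d := fun j s x => iteratedDeriv j G x + s ^ 2 • B j s x
  have hspan : ∀ s x, s ≠ 0 →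
      Submodule.span ℝ (Set.range fun j => b j s x) ≤ curveHyperplane P G s x := by
    intro s x hs
    rw [Submodule.span_le]
    rintro _ ⟨j, rfl⟩
    simp only [b]
    rw [hbasis j s x hs]
    exact Submodule.smul_mem _ _ (Submodule.sum_mem _ fun p hp =>
      Submodule.smul_mem _ _ (Submodule.subset_span ⟨p, hp, rfl⟩))
  obtain ⟨Z, hZ, hZ0, r, hr, hZr⟩ := exists_envelope_family hG (b := b)
    (fun j => ((contDiff_iteratedDeriv hG.smooth j).comp contDiff_snd).add
      ((contDiff_fst.pow 2).smul (hB j)))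
    (fun j x => by simp [b])
    (fun j s x hs => by
      simp only [b]
      rw [hbasis j s _ hs, hbasis j s x hs, Matrix.mulVec_smul, Matrix.mulVec_sum]
      congr 1
      refine Finset.sum_congr rfl fun p _ => ?_
      rw [Matrix.mulVec_smul, add_right_comm]
      congr 1
      exact hG.quasiperiodic _)
  -- The inclusion is known; the left side has dimension d and d points span at most that, so
  -- equality holds.
  have hosc : ∀ s ∈ Set.Ioo 0 r, ∀ x,
      Submodule.span ℝ (Set.range fun j : Fin d => iteratedDeriv (j : ℕ) (Z s) x) =
        curveHyperplane P G s x := by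
    intro s hs x
    refine Submodule.eq_of_le_of_finrank_le
      (((hZr s hs).2 x).trans (hspan s x hs.1.ne')) ?_
    rw [finrank_span_iteratedDeriv ((hZr s hs).1.wronskian_eq x)]
    exact (finrank_curveHyperplane_le P G s x).trans hP.le
  obtain ⟨F, hF, hZF, hF0⟩ := exists_envelope_expansion hd hG.smooth hG.wronskian_eq hZ hZ0 hB hr
    hB0 (fun s hs => (hZr s hs).1.wronskian_eq) fun s hs j x =>
      dualCurve_dotProduct_of_mem_span ((hZr s hs).1.wronskian_eq x) (by
        rw [hosc s hs x]
        exact hspan s x hs.1.ne' (Submodule.subset_span ⟨j, rfl⟩))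
  let w : Fin d → ℝ → ℝ → ℝ := fun j s x => -coord (Z s) x (opL (opCoeffs G) (F s) x) j.castSucc
  have hLF : ContDiff ℝ ∞ fun p : ℝ × ℝ => opL (opCoeffs G) (F p.1) p.2 :=
    (contDiff_iteratedDeriv_snd hF _).add (ContDiff.sum fun j _ =>
      ((hu j).comp contDiff_snd).smul (contDiff_iteratedDeriv_snd hF _))
  have hw : ∀ j, ContDiff ℝ ∞ fun p : ℝ × ℝ => w j p.1 p.2 := fun j =>
    (contDiff_coord_family hZ (E := fun s x => opL (opCoeffs G) (F s) x) hLF _).neg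
  have hw0 : ∀ j x, w j 0 x = limitConst d P * W (opCoeffs G) j x := by
    intro j x
    simp only [w]
    rw [hW.eq_coord hG.smooth hG.wronskian_eq, hF0, hZ0,
      opL_smul (contDiff_opQ hu hG.smooth), map_smul, Pi.smul_apply, smul_eq_mul, mul_neg]
  have huw : ∀ s ∈ Set.Ioo 0 r, ∀ j x, opCoeffs (Z s) j x = opCoeffs G j x + s ^ 2 * w j s x := by
    intro s hs j x
    have h1 := (hZr s hs).1.wronskian_eq
    simp only [w]
    rw [funext (hZF s)] at h1 ⊢
    exact opCoeffs_add_smul hG.smooth hG.wronskian_eq (contDiff_slice hF s) h1 j x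
  clear_value w
  have hperG := fun j => opCoeffs_periodic hMdet hG.smooth hG.quasiperiodic j
  have hperZ := fun s (hs : s ∈ Set.Ioo 0 r) j =>
    opCoeffs_periodic hMdet (hZr s hs).1.smooth (hZr s hs).1.quasiperiodic j
  have hperw : ∀ s ∈ Set.Ioo 0 r, ∀ j, Function.Periodic (w j s) (2 * Real.pi) := by
    intro s hs j x
    have e1 := huw s hs j x
    have e2 := huw s hs j (x + 2 * Real.pi)
    rw [hperG j x, hperZ s hs j x, e1] at e2
    exact (mul_left_cancel₀ (pow_ne_zero 2 hs.1.ne') (add_left_cancel e2)).symm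
  -- For s > 0 periodicity comes from division by s²; at s = 0 it is obtained as a limit.
  have hperw0 : ∀ j, Function.Periodic (w j 0) (2 * Real.pi) := fun j x =>
    apply_zero_eq_of_eventuallyEq (f := fun s => w j s (x + 2 * Real.pi)) (g := fun s => w j s x)
      ((hw j).continuous.comp (by fun_prop : Continuous fun s : ℝ => (s, x + 2 * Real.pi)))
      ((hw j).continuous.comp (by fun_prop : Continuous fun s : ℝ => (s, x))) hr
      fun s hs => hperw s hs j x
  -- One more Hadamard quotient turns F_s - F_0 and w_s - w_0 into s times locally bounded
  -- functions, whence the O(s³) remainders.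
  obtain ⟨F₁, hF₁, hFF₁⟩ := exists_smooth_quotient hF
  choose w₁ hw₁ hww₁ using fun j => exists_smooth_quotient (hw j)
  refine ⟨r, hr, Z, fun s => opCoeffs (Z s), fun s hs => ⟨⟨(hZr s hs).1.smooth, hosc s hs,
    (hZr s hs).1.wronskian_eq⟩, fun Z' hZ' => ?_, ?_⟩, fun R => ?_, ?_⟩
  · exact eq_or_eq_neg_of_osculating_eq (hZr s hs).1.smooth hZ'.smooth (hZr s hs).1.wronskian_eq
      hZ'.wronskian_eq fun x => by rw [hZ'.osculating, hosc s hs]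
  · exact opL_opCoeffs (hZr s hs).1.smooth (hZr s hs).1.wronskian_eq
  · obtain ⟨K, hK⟩ := exists_bound_on_strip hF₁.continuous r (-R) R
    refine ⟨K, fun s hs x hx => ?_⟩
    have : Z s x - G x - s ^ 2 • (limitConst d P • opQ (opCoeffs G) G) x = s ^ 3 • F₁ s x := by
      rw [hZF, hFF₁, hF0, smul_add, smul_smul]
      rw [show s ^ 2 * s = s ^ 3 by ring]
      abel
    rw [this, norm_smul, Real.norm_eq_abs, abs_of_pos (pow_pos hs.1 3), mul_comm]
    exact mul_le_mul_of_nonneg_right (hK s hs x hx) (pow_pos hs.1 3).le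
  · choose K hK using fun j => exists_bound_on_strip (hw₁ j).continuous r 0 (2 * Real.pi)
    refine ⟨∑ j, |K j|, fun s hs j x => ?_⟩
    have hloc : ∀ y ∈ Set.Icc 0 (2 * Real.pi), |w j s y - w j 0 y| ≤ (∑ j, |K j|) * s := by
      intro y hy
      rw [hww₁, add_sub_cancel_left, smul_eq_mul, abs_mul, abs_of_pos hs.1, mul_comm]
      refine mul_le_mul_of_nonneg_right ((hK j s hs y hy).trans ((le_abs_self _).trans ?_)) hs.1.le
      exact Finset.single_le_sum (f := fun j => |K j|) (fun _ _ => abs_nonneg _)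
        (Finset.mem_univ j)
    obtain ⟨y, hy, hxy⟩ := ((hperw s hs j).sub (hperw0 j)).exists_mem_Ico₀ (by positivity) x
    simp only [Pi.sub_apply] at hxy
    have hbd := hloc y ⟨hy.1, hy.2.le⟩
    rw [← hxy] at hbd
    beta_reduce
    rw [huw s hs, Pi.smul_apply, Pi.smul_apply, smul_eq_mul, ← hw0,
      show opCoeffs G j x + s ^ 2 * w j s x - opCoeffs G j x - s ^ 2 * w j 0 x =
        s ^ 2 * (w j s x - w j 0 x) by ring, abs_mul, abs_of_pos (pow_pos hs.1 2)]
    calc s ^ 2 * |w j s x - w j 0 x| ≤ s ^ 2 * ((∑ j, |K j|) * s) :=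
          mul_le_mul_of_nonneg_left hbd (pow_pos hs.1 2).le
      _ = (∑ j, |K j|) * s ^ 3 := by ring

end

/-! ### The commutator field, change of time and mixed derivatives -/

section
variable {d : ℕ}

/-- The potential `2 / (d + 1) u_{d-1}` of `Q₂`. -/
noncomputable def potential (u : Coeffs d) (x : ℝ) : ℝ := 2 / ((d : ℝ) + 1) * topCoeff u x

/-- The coefficients of the commutator `[Q₂, L]`. -/
noncomputable def kdvField (u : Coeffs d) : Coeffs d := fun i x =>
  iteratedDeriv 2 (u i) x +
    (if h : (i : ℕ) = 0 then 0 else 2 * deriv (u ⟨(i : ℕ) - 1, by omega⟩) x) -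
    ((d + 1).choose i : ℝ) * iteratedDeriv (d + 1 - i) (potential u) x -
    ∑ j : Fin d, if (i : ℕ) < j then
      u j x * (((j : ℕ).choose i : ℝ) * iteratedDeriv (j - i : ℕ) (potential u) x) else 0

theorem contDiff_potential {u : Coeffs d} (hu : ∀ j, ContDiff ℝ ∞ (u j)) :
    ContDiff ℝ ∞ (potential u) := contDiff_const.mul (contDiff_topCoeff hu)

theorem sum_fin_ite_lt_eq_sum_range {m n : ℕ} (h : m ≤ n) (g : ℕ → ℝ) :
    ∑ i : Fin n, (if (i : ℕ) < m then g i else 0) = ∑ i ∈ Finset.range m, g i := by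
  rw [Fin.sum_univ_eq_sum_range (fun i => if i < m then g i else 0) n,
    ← Finset.sum_subset (Finset.range_mono h)]
  · exact Finset.sum_congr rfl fun i hi => if_pos (Finset.mem_range.1 hi)
  · exact fun i _ hi => if_neg fun h => hi (Finset.mem_range.2 h)

theorem iteratedDeriv_mul_reflect {q f : ℝ → ℝ} (hq : ContDiff ℝ ∞ q) (hf : ContDiff ℝ ∞ f)
    (n : ℕ) (x : ℝ) : iteratedDeriv n (fun x => q x * f x) x = ∑ i ∈ Finset.range n,
      ((n.choose i : ℝ) * iteratedDeriv (n - i) q x) * iteratedDeriv i f x +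
        q x * iteratedDeriv n f x := by
  have h := iteratedDeriv_smul_eq_sum hq hf n x
  simp only [smul_eq_mul] at h
  rw [h, ← Finset.sum_range_reflect, Finset.sum_range_succ]
  congr 1
  · refine Finset.sum_congr rfl fun i hi => ?_
    rw [Finset.mem_range] at hi
    rw [show n + 1 - 1 - i = n - i by omega, show n - (n - i) = i by omega,
      Nat.choose_symm hi.le]
  · simp

theorem iteratedDeriv_two_mul {v g : ℝ → ℝ} (hv : ContDiff ℝ ∞ v) (hg : ContDiff ℝ ∞ g) (x : ℝ) :
    iteratedDeriv 2 (fun x => v x * g x) x = iteratedDeriv 2 v x * g x +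
      2 * deriv v x * deriv g x + v x * iteratedDeriv 2 g x := by
  rw [iteratedDeriv_mul_reflect hv hg]
  simp [Finset.sum_range_succ]

/-- Both compositions are expanded by Leibniz. The terms of order above d cancel at once, and the
order-d term cancels by the choice of the potential, so the commutator has order below d. -/
theorem isKdVField_kdvField (hd : 0 < d) : IsKdVField (kdvField (d := d)) := by
  obtain ⟨e, rfl⟩ : ∃ e, d = e + 1 := ⟨d - 1, by omega⟩
  intro u hu f hf x
  have hq := contDiff_potential hu
  set q := potential u with hqdef
  have hLf : iteratedDeriv 2 (opL u f) x = iteratedDeriv (e + 4) f x + ∑ j : Fin (e + 1),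
      (iteratedDeriv 2 (u j) x * iteratedDeriv j f x +
        2 * deriv (u j) x * iteratedDeriv (j + 1) f x + u j x * iteratedDeriv (j + 2) f x) := by
    have h1 : ∀ (j : Fin (e + 1)),
        ContDiff ℝ ∞ (fun x => u j x * iteratedDeriv (j : ℕ) f x) := fun j =>
      (hu j).mul (contDiff_iteratedDeriv hf j)
    have h2 : iteratedDeriv 2 (fun x => ∑ j : Fin (e + 1), u j x * iteratedDeriv (j : ℕ) f x) x =
        ∑ j : Fin (e + 1), iteratedDeriv 2 (fun x => u j x * iteratedDeriv (j : ℕ) f x) x :=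
      iteratedDeriv_fun_sum fun j _ => (contDiff_infty.1 (h1 j) 2).contDiffAt
    unfold opL
    simp only [smul_eq_mul]
    have h3 := iteratedDeriv_add (n := 2) (x := x)
      (f := iteratedDeriv (e + 1 + 1) f)
      (g := fun x => ∑ j : Fin (e + 1), u j x * iteratedDeriv (j : ℕ) f x)
      (contDiff_infty.1 (contDiff_iteratedDeriv hf _) 2).contDiffAt
      (contDiff_infty.1 (ContDiff.sum fun j _ => h1 j) 2).contDiffAt
    rw [show (fun x => iteratedDeriv (e + 1 + 1) f x + ∑ j : Fin (e + 1),
      u j x * iteratedDeriv (j : ℕ) f x) = iteratedDeriv (e + 1 + 1) f +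
        fun x => ∑ j : Fin (e + 1), u j x * iteratedDeriv (j : ℕ) f x from rfl, h3, h2,
      iteratedDeriv_iteratedDeriv, show 2 + (e + 1 + 1) = e + 4 by ring]
    congr 1
    refine Finset.sum_congr rfl fun j _ => ?_
    rw [iteratedDeriv_two_mul (hu j) (contDiff_iteratedDeriv hf j), ← iteratedDeriv_succ,
      iteratedDeriv_iteratedDeriv, add_comm 2]
  have hQf : ∀ n, iteratedDeriv n (opQ u f) x = iteratedDeriv (n + 2) f x +
      (∑ i ∈ Finset.range n, ((n.choose i : ℝ) * iteratedDeriv (n - i) q x) * iteratedDeriv i f x +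
        q x * iteratedDeriv n f x) := by
    intro n
    rw [← iteratedDeriv_mul_reflect hq hf, ← iteratedDeriv_iteratedDeriv]
    exact iteratedDeriv_add ((contDiff_iteratedDeriv hf 2).of_le (by exact_mod_cast le_top)).contDiffAt
      ((hq.mul hf).of_le (by exact_mod_cast le_top)).contDiffAt
  have hRHS : opQ u (opL u f) x - opL u (opQ u f) x =
      iteratedDeriv 2 (opL u f) x + q x * opL u f x - opL u (opQ u f) x := rfl
  -- This is the vanishing of the coefficient 2u'_{d-1} - (d + 1)q' of ∂^d, with d = e + 1.
  have hqtop : ((e : ℝ) + 2) * deriv q x = 2 * deriv (u (Fin.last e)) x := by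
    have htop : topCoeff u = u (Fin.last e) := by
      unfold topCoeff; rw [dif_pos (by omega)]; rfl
    rw [hqdef]
    unfold potential
    rw [htop, deriv_const_mul _ ((hu _).differentiable (by simp) x)]
    push_cast
    field_simp
    ring
  rw [hRHS, hLf]
  unfold opL
  simp only [hQf, smul_eq_mul]
  have hsum1 : ∑ i : Fin (e + 1), (if h : (i : ℕ) = 0 then (0 : ℝ) else
      2 * deriv (u ⟨(i : ℕ) - 1, by omega⟩) x) * iteratedDeriv (i : ℕ) f x =
      (∑ j : Fin (e + 1), 2 * deriv (u j) x * iteratedDeriv (j + 1) f x) -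
        2 * deriv (u (Fin.last e)) x * iteratedDeriv (e + 1) f x := by
    rw [Fin.sum_univ_succ, Fin.sum_univ_castSucc (n := e)
      (f := fun j : Fin (e + 1) => 2 * deriv (u j) x * iteratedDeriv (j + 1) f x)]
    rw [dif_pos (Fin.val_zero _), zero_mul, zero_add]
    simp only [Fin.val_last, add_sub_cancel_right]
    refine Finset.sum_congr rfl fun j _ => ?_
    rw [dif_neg (by simp)]
    simp only [Fin.val_succ, Fin.val_castSucc, Nat.add_sub_cancel]
    rfl
  have hsum2 : ∑ i : Fin (e + 1), (∑ j : Fin (e + 1), if (i : ℕ) < j then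
      u j x * (((j : ℕ).choose i : ℝ) * iteratedDeriv (j - i : ℕ) q x) else 0) *
        iteratedDeriv (i : ℕ) f x = ∑ j : Fin (e + 1), u j x * ∑ i ∈ Finset.range j,
          (((j : ℕ).choose i : ℝ) * iteratedDeriv (j - i : ℕ) q x) * iteratedDeriv i f x := by
    simp only [Finset.sum_mul]
    rw [Finset.sum_comm]
    refine Finset.sum_congr rfl fun j _ => ?_
    rw [← sum_fin_ite_lt_eq_sum_range (n := e + 1) j.2.le, Finset.mul_sum]
    refine Finset.sum_congr rfl fun i _ => ?_
    split_ifs <;> ring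
  have hsum3 : ∑ i : Fin (e + 1), (((e + 1 + 1).choose i : ℝ) *
      iteratedDeriv (e + 1 + 1 - i : ℕ) q x) * iteratedDeriv (i : ℕ) f x =
      ∑ i ∈ Finset.range (e + 1), (((e + 1 + 1).choose i : ℝ) *
        iteratedDeriv (e + 1 + 1 - i : ℕ) q x) * iteratedDeriv i f x :=
    Fin.sum_univ_eq_sum_range (fun i => (((e + 1 + 1).choose i : ℝ) *
        iteratedDeriv (e + 1 + 1 - i : ℕ) q x) * iteratedDeriv i f x) (e + 1)
  unfold kdvField
  simp only [← hqdef, sub_mul, add_mul, Finset.sum_sub_distrib, Finset.sum_add_distrib, hsum1, hsum2,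
    hsum3, mul_add]
  rw [Finset.sum_range_succ (n := e + 1)]
  have hch : ((e + 1 + 1).choose (e + 1) : ℝ) = e + 2 := by
    rw [Nat.choose_succ_self_right]; push_cast; ring
  rw [hch, show e + 1 + 1 - (e + 1) = 1 by omega, iteratedDeriv_one, hqtop, Finset.mul_sum,
    show e + 1 + 1 + 2 = e + 4 by ring]
  have hcomm : ∑ i : Fin (e + 1), q x * (u i x * iteratedDeriv (i : ℕ) f x) =
    ∑ i : Fin (e + 1), u i x * (q x * iteratedDeriv (i : ℕ) f x) :=
      Finset.sum_congr rfl fun i _ => by ring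
  rw [hcomm]
  ring

theorem IsSolution.time_change {W : Coeffs d → Coeffs d} {U : ℝ → Coeffs d} (hU : IsSolution W U)
    (a : ℝ) : IsSolution (fun u => a • W u) fun t => U (a * t) := by
  obtain ⟨h1, h2, h3⟩ := hU
  refine ⟨fun j => (h1 j).comp (by fun_prop : ContDiff ℝ ∞ fun p : ℝ × ℝ => (a * p.1, p.2)),
    fun t => h2 _, fun t j x => ?_⟩
  rw [deriv_comp_mul_left a (fun s => U s j x) t, h3]
  rfl

theorem isSolution_time_change_iff {C : ℝ} (hC : C ≠ 0) (W : Coeffs d → Coeffs d)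
    (U : ℝ → Coeffs d) : IsSolution (fun u => (-C) • W u) U ↔
      IsSolution W fun t => U (-t / C) := by
  constructor
  · intro h
    have := h.time_change (-C⁻¹)
    simp only [smul_smul, neg_mul_neg, inv_mul_cancel₀ hC, one_smul] at this
    convert this using 3
    field_simp
  · intro h
    have := h.time_change (-C)
    convert this using 3
    field_simp

theorem deriv_deriv_comm {f : ℝ → ℝ → ℝ} (hf : ContDiff ℝ ∞ fun p : ℝ × ℝ => f p.1 p.2)
    (t x : ℝ) : deriv (fun s => deriv (f s) x) t = deriv (fun z => deriv (fun s => f s z) t) x := by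
  set F := fun p : ℝ × ℝ => f p.1 p.2
  have hF : Differentiable ℝ F := hf.differentiable (by simp)
  have hF' : ContDiff ℝ ∞ (fderiv ℝ F) := hf.fderiv_right (by simp)
  have hF'' : Differentiable ℝ (fderiv ℝ F) := hF'.differentiable (by simp)
  have e1 : ∀ s z, deriv (f s) z = fderiv ℝ F (s, z) (0, 1) := fun s z => by
    have h : HasDerivAt (fun z : ℝ => (s, z)) ((0 : ℝ), (1 : ℝ)) z :=
      (hasDerivAt_const z s).prodMk (hasDerivAt_id z)
    exact ((hF (s, z)).hasFDerivAt.comp_hasDerivAt z h).deriv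
  have e2 : ∀ s z, deriv (fun s => f s z) s = fderiv ℝ F (s, z) (1, 0) := fun s z => by
    have h : HasDerivAt (fun s : ℝ => (s, z)) ((1 : ℝ), (0 : ℝ)) s :=
      (hasDerivAt_id s).prodMk (hasDerivAt_const s z)
    exact ((hF (s, z)).hasFDerivAt.comp_hasDerivAt s h).deriv
  simp only [e1, e2]
  have g1 : HasDerivAt (fun s => fderiv ℝ F (s, x) (0, 1))
      (fderiv ℝ (fderiv ℝ F) (t, x) (1, 0) (0, 1)) t := by
    have h : HasDerivAt (fun s : ℝ => (s, x)) ((1 : ℝ), (0 : ℝ)) t :=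
      (hasDerivAt_id t).prodMk (hasDerivAt_const t x)
    exact (ContinuousLinearMap.apply ℝ ℝ ((0 : ℝ), (1 : ℝ))).hasFDerivAt.comp_hasDerivAt t
      ((hF'' (t, x)).hasFDerivAt.comp_hasDerivAt t h)
  have g2 : HasDerivAt (fun z => fderiv ℝ F (t, z) (1, 0))
      (fderiv ℝ (fderiv ℝ F) (t, x) (0, 1) (1, 0)) x := by
    have h : HasDerivAt (fun z : ℝ => (t, z)) ((0 : ℝ), (1 : ℝ)) x :=
      (hasDerivAt_const x t).prodMk (hasDerivAt_id x)
    exact (ContinuousLinearMap.apply ℝ ℝ ((1 : ℝ), (0 : ℝ))).hasFDerivAt.comp_hasDerivAt x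
      ((hF'' (t, x)).hasFDerivAt.comp_hasDerivAt x h)
  rw [g1.deriv, g2.deriv]
  exact (hf.contDiffAt.isSymmSndFDerivAt (by
    rw [minSmoothness_of_isRCLikeNormedField]
    exact WithTop.coe_le_coe.2 (le_top : (2 : ℕ∞) ≤ ⊤))).eq _ _

theorem deriv_iteratedDeriv_comm {f : ℝ → ℝ → ℝ} (hf : ContDiff ℝ ∞ fun p : ℝ × ℝ => f p.1 p.2)
    (n : ℕ) (t x : ℝ) : deriv (fun s => iteratedDeriv n (f s) x) t =
      iteratedDeriv n (fun z => deriv (fun s => f s z) t) x := by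
  induction n generalizing x with
  | zero => simp
  | succ n ih =>
    simp only [iteratedDeriv_succ]
    rw [deriv_deriv_comm (f := fun s => iteratedDeriv n (f s)) (contDiff_iteratedDeriv_snd hf n)]
    simp only [ih]

end

/-! ### The case d = 2: Boussinesq equation -/

theorem hasDerivAt_iteratedDeriv {f : ℝ → ℝ} (hf : ContDiff ℝ ∞ f) (n : ℕ) (x : ℝ) :
    HasDerivAt (iteratedDeriv n f) (iteratedDeriv (n + 1) f x) x := by
  rw [iteratedDeriv_succ]
  exact ((contDiff_iteratedDeriv hf n).differentiable (by simp) x).hasDerivAt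

theorem topCoeff_two (u : Coeffs 2) : topCoeff u = u 1 := topCoeff_eq (e := 0) u

theorem kdvField_two_one (u : Coeffs 2) (x : ℝ) :
    kdvField u 1 x = 2 * iteratedDeriv 1 (u 0) x - iteratedDeriv 2 (u 1) x := by
  have hq : ∀ n, iteratedDeriv n (potential u) x = 2 / 3 * iteratedDeriv n (u 1) x := by
    intro n
    unfold potential
    rw [iteratedDeriv_const_mul_field, topCoeff_two]
    norm_num
  simp [kdvField, hq, Nat.choose, iteratedDeriv_one]
  ring

theorem kdvField_two_zero (u : Coeffs 2) (x : ℝ) :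
    kdvField u 0 x = iteratedDeriv 2 (u 0) x - 2 / 3 * iteratedDeriv 3 (u 1) x -
      2 / 3 * (u 1 x * iteratedDeriv 1 (u 1) x) := by
  have hq : ∀ n, iteratedDeriv n (potential u) x = 2 / 3 * iteratedDeriv n (u 1) x := by
    intro n
    unfold potential
    rw [iteratedDeriv_const_mul_field, topCoeff_two]
    norm_num
  simp [kdvField, hq, Nat.choose, iteratedDeriv_one]
  ring

/-- Here u_t = -C(2v' - u'') and v_t = -C(v'' - (2/3)u''' - (2/3)uu'). Differentiating the first in
t and inserting both cancels v''' and leaves u_tt = -C²(u'''' + 2(u²)'')/3; the time scale r removes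
C²/3. -/
theorem solvesBoussinesq_of_isSolution {C r : ℝ} (hrC : r ^ 2 * C ^ 2 = 3) {U : ℝ → Coeffs 2}
    (hU : IsSolution (fun u => (-C) • kdvField u) U) :
    SolvesBoussinesq fun t x => topCoeff (U (r * t)) x := by
  obtain ⟨h1, h2, h3⟩ := hU
  have hu : ∀ t j, ContDiff ℝ ∞ (U t j) := fun t j => (h2 t j).1
  have hut : ∀ t, (fun z => deriv (fun s => U s 1 z) t) = fun z =>
      (-C) * (2 * iteratedDeriv 1 (U t 0) z - iteratedDeriv 2 (U t 1) z) := fun t => by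
    ext z; rw [h3, ← kdvField_two_one (U t)]; rfl
  have hvt : ∀ t, (fun z => deriv (fun s => U s 0 z) t) = fun z =>
      (-C) * (iteratedDeriv 2 (U t 0) z - 2 / 3 * iteratedDeriv 3 (U t 1) z -
      2 / 3 * (U t 1 z * iteratedDeriv 1 (U t 1) z)) := fun t => by
    ext z; rw [h3, ← kdvField_two_zero (U t)]; rfl
  have hutt : ∀ t x, iteratedDeriv 2 (fun s => U s 1 x) t = C ^ 2 *
      (-(1 / 3) * iteratedDeriv 4 (U t 1) x - 4 / 3 * (iteratedDeriv 1 (U t 1) x ^ 2 +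
        U t 1 x * iteratedDeriv 2 (U t 1) x)) := by
    intro t x
    have D := fun n j => hasDerivAt_iteratedDeriv (hu t j) n
    have e1 : deriv (fun s => U s 1 x) = fun t =>
        (-C) * (2 * iteratedDeriv 1 (U t 0) x - iteratedDeriv 2 (U t 1) x) := by
      ext t; exact congrFun (hut t) x
    have e2 : ∀ n j, DifferentiableAt ℝ (fun s => iteratedDeriv n (U s j) x) t := fun n j =>
      ((contDiff_iteratedDeriv_snd (H := fun s => U s j) (h1 j) n).comp
        (by fun_prop : ContDiff ℝ ∞ fun s : ℝ => (s, x))).differentiable (by simp) t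
    rw [iteratedDeriv_succ, iteratedDeriv_one, e1, deriv_const_mul_field,
      deriv_fun_sub ((e2 1 0).const_mul 2) (e2 2 1),
      deriv_const_mul _ (e2 1 0), deriv_iteratedDeriv_comm (f := fun s => U s 0) (h1 0),
      deriv_iteratedDeriv_comm (f := fun s => U s 1) (h1 1), hut, hvt]
    have f1 : ∀ z, HasDerivAt (fun z => (-C) * (iteratedDeriv 2 (U t 0) z -
        2 / 3 * iteratedDeriv 3 (U t 1) z - 2 / 3 * (U t 1 z * iteratedDeriv 1 (U t 1) z)))
        ((-C) * (iteratedDeriv 3 (U t 0) z - 2 / 3 * iteratedDeriv 4 (U t 1) z -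
          2 / 3 * (iteratedDeriv 1 (U t 1) z * iteratedDeriv 1 (U t 1) z +
            U t 1 z * iteratedDeriv 2 (U t 1) z))) z := fun z => by
      have := D 0 1 z
      rw [iteratedDeriv_zero] at this
      exact (((D 2 0 z).sub ((D 3 1 z).const_mul _)).sub
        ((this.mul (D 1 1 z)).const_mul _)).const_mul _
    have f2 : ∀ z, HasDerivAt (fun z => (-C) * (2 * iteratedDeriv 1 (U t 0) z -
        iteratedDeriv 2 (U t 1) z)) ((-C) * (2 * iteratedDeriv 2 (U t 0) z -
        iteratedDeriv 3 (U t 1) z)) z := fun z =>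
      (((D 1 0 z).const_mul _).sub (D 2 1 z)).const_mul _
    have f3 : ∀ z, HasDerivAt (fun z => (-C) * (2 * iteratedDeriv 2 (U t 0) z -
        iteratedDeriv 3 (U t 1) z)) ((-C) * (2 * iteratedDeriv 3 (U t 0) z -
        iteratedDeriv 4 (U t 1) z)) z := fun z =>
      (((D 2 0 z).const_mul _).sub (D 3 1 z)).const_mul _
    have k1 := (f1 x).deriv
    have k2 : iteratedDeriv 2 (fun z => (-C) * (2 * iteratedDeriv 1 (U t 0) z -
        iteratedDeriv 2 (U t 1) z)) x = (-C) * (2 * iteratedDeriv 3 (U t 0) x -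
        iteratedDeriv 4 (U t 1) x) := by
      rw [← (f3 x).deriv, ← funext fun z => (f2 z).deriv, iteratedDeriv_succ, iteratedDeriv_one]
    rw [← iteratedDeriv_one] at k1
    rw [k1, k2]
    ring
  intro t x
  simp only [topCoeff_two]
  have hscale : iteratedDeriv 2 (fun s => U (r * s) 1 x) t =
      r ^ 2 * iteratedDeriv 2 (fun s => U s 1 x) (r * t) := by
    have : ContDiff ℝ 2 fun s => U s 1 x :=
      contDiff_infty.1 ((h1 1).comp (by fun_prop : ContDiff ℝ ∞ fun s : ℝ => (s, x))) 2
    exact congrFun (iteratedDeriv_comp_const_mul this r) t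
  rw [hscale, hutt]
  have D := fun n => hasDerivAt_iteratedDeriv (hu (r * t) 1) n
  have g1 : ∀ z, HasDerivAt (fun z => U (r * t) 1 z ^ 2)
      (2 * (U (r * t) 1 z * iteratedDeriv 1 (U (r * t) 1) z)) z := fun z => by
    have := D 0 z
    rw [iteratedDeriv_zero] at this
    refine (this.pow 2).congr_deriv ?_
    simp; ring
  have g2 : HasDerivAt (fun z => 2 * (U (r * t) 1 z * iteratedDeriv 1 (U (r * t) 1) z))
      (2 * (iteratedDeriv 1 (U (r * t) 1) x * iteratedDeriv 1 (U (r * t) 1) x +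
        U (r * t) 1 x * iteratedDeriv 2 (U (r * t) 1) x)) x := by
    have := D 0 x
    rw [iteratedDeriv_zero] at this
    exact (this.mul (D 1 x)).const_mul _
  have hsq : iteratedDeriv 2 (fun z => U (r * t) 1 z ^ 2) x =
      2 * (iteratedDeriv 1 (U (r * t) 1) x * iteratedDeriv 1 (U (r * t) 1) x +
        U (r * t) 1 x * iteratedDeriv 2 (U (r * t) 1) x) := by
    rw [← g2.deriv, ← funext fun z => (g1 z).deriv, iteratedDeriv_succ, iteratedDeriv_one]
  rw [hsq]
  change r ^ 2 * _ + _ + iteratedDeriv 4 (U (r * t) 1) x = 0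
  linear_combination (-(1 / 3) * iteratedDeriv 4 (U (r * t) 1) x - 4 / 3 *
    (iteratedDeriv 1 (U (r * t) 1) x ^ 2 + U (r * t) 1 x * iteratedDeriv 2 (U (r * t) 1) x)) * hrC

/-! ### Descartes' rule for sums of few monomials -/

section Fewnomial
open Polynomial

/-- Erasing the leading term removes one monomial and at most one sign variation; a single monomial
has none. -/
theorem signVariations_lt_card_support (f : ℝ[X]) (hf : f ≠ 0) :
    f.signVariations < f.support.card := by
  induction hn : f.support.card using Nat.strong_induction_on generalizing f with
  | _ n ih =>
    subst hn
    by_cases h : f.eraseLead = 0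
    · have := f.eraseLead_add_monomial_natDegree_leadingCoeff
      rw [h, zero_add] at this
      rw [← this, signVariations_monomial, this]
      exact Finset.card_pos.2 (support_nonempty.2 hf)
    · have h1 := ih _ (eraseLead_support_card_lt hf) f.eraseLead h rfl
      have h2 := signVariations_le_eraseLead_succ (P := f)
      have h3 := eraseLead_support_card_lt hf
      omega

/-- A combination of `N` monomials with `N` positive zeros vanishes. -/
theorem eq_zero_of_sum_zpow_eq_zero {ι : Type*} {S : Finset ι} {e : ι → ℤ} (he : Set.InjOn e S)
    {c : ι → ℝ} {X : Finset ℝ} (hpos : ∀ x ∈ X, 0 < x) (hcard : S.card ≤ X.card)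
    (h : ∀ x ∈ X, ∑ s ∈ S, c s * x ^ e s = 0) : ∀ s ∈ S, c s = 0 := by
  classical
  -- Multiplication by x^N clears negative exponents without changing the positive zeros.
  obtain ⟨N, hN⟩ : ∃ N : ℕ, ∀ s ∈ S, 0 ≤ e s + N := by
    refine ⟨∑ s ∈ S, (e s).natAbs, fun s hs => ?_⟩
    have := Finset.single_le_sum (f := fun s => (e s).natAbs) (fun _ _ => Nat.zero_le _) hs
    omega
  set f : ℝ[X] := ∑ s ∈ S, monomial (e s + N).toNat (c s) with hf
  have hcoeff : ∀ s ∈ S, f.coeff (e s + N).toNat = c s := by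
    intro s hs
    rw [hf, finsetSum_coeff, Finset.sum_eq_single s]
    · simp
    · intro t ht hts
      rw [coeff_monomial, if_neg]
      have h1 := hN s hs
      have h2 := hN t ht
      have h3 : e t ≠ e s := fun h => hts (he ht hs h)
      omega
    · exact fun h => absurd hs h
  by_cases hf0 : f = 0
  · intro s hs
    rw [← hcoeff s hs, hf0, coeff_zero]
  exfalso
  have hsupp : f.support.card ≤ S.card := by
    refine (Finset.card_le_card (t := S.image fun s => (e s + N).toNat) fun n hn => ?_).trans
      Finset.card_image_le
    by_contra hn'
    rw [mem_support_iff, hf, finsetSum_coeff] at hn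
    refine hn (Finset.sum_eq_zero fun s hs => ?_)
    rw [coeff_monomial, if_neg]
    exact fun h => hn' (Finset.mem_image.2 ⟨s, hs, h⟩)
  -- A nonzero f would have at least N positive roots, but fewer than N sign variations for its at
  -- most N monomials.
  have hroots : X.val ≤ f.roots.filter (0 < ·) := by
    rw [Multiset.le_iff_subset X.nodup]
    intro x hx
    have hx' := hpos x hx
    rw [Multiset.mem_filter, mem_roots hf0]
    refine ⟨?_, hx'⟩
    rw [IsRoot.def, hf, eval_finsetSum]
    have h1 : ∀ s ∈ S, (monomial (e s + N).toNat (c s)).eval x =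
        x ^ (N : ℤ) * (c s * x ^ e s) := by
      intro s hs
      rw [eval_monomial, ← zpow_natCast, Int.toNat_of_nonneg (hN s hs), zpow_add₀ hx'.ne']
      ring
    rw [Finset.sum_congr rfl h1, ← Finset.mul_sum, h x hx, mul_zero]
  have h1 := Multiset.card_le_card hroots
  rw [← Multiset.countP_eq_card_filter] at h1
  have h2 := roots_countP_pos_le_signVariations (P := f)
  have h3 := signVariations_lt_card_support f hf0
  have h4 : Multiset.card X.val = X.card := rfl
  omega

end Fewnomial

/-! ### Arithmetic progressions -/

section Progression

theorem mem_progression {a : ℤ} {m n : ℕ} {x : ℤ} :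
    x ∈ progression a m n ↔ ∃ i < n, x = a + m * i := by
  simp [progression, eq_comm]

theorem progression_index_injective {m : ℕ} (hm : 0 < m) (a : ℤ) :
    Function.Injective fun i : ℕ => a + (m : ℤ) * (i : ℤ) := fun i j h => by
  simpa [hm.ne'] using h

theorem card_progression {m : ℕ} (hm : 0 < m) (a : ℤ) (n : ℕ) :
    (progression a m n).card = n := by
  rw [progression, Finset.card_image_of_injective _ (progression_index_injective hm a),
    Finset.card_range]

theorem sum_progression {m : ℕ} (hm : 0 < m) (a : ℤ) (n : ℕ) {E : Type*} [AddCommMonoid E]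
    (f : ℤ → E) : ∑ x ∈ progression a m n, f x = ∑ i ∈ Finset.range n, f (a + m * i) :=
  Finset.sum_image fun _ _ _ _ h => progression_index_injective hm a h

theorem image_add_progression (k a : ℤ) (m n : ℕ) :
    (progression a m n).image (fun j => k + j) = progression (k + a) m n := by
  ext x
  simp only [Finset.mem_image, mem_progression]
  constructor
  · rintro ⟨_, ⟨i, hi, rfl⟩, rfl⟩
    exact ⟨i, hi, by ring⟩
  · rintro ⟨i, hi, rfl⟩
    exact ⟨_, ⟨i, hi, rfl⟩, by ring⟩

end Progression

/-! ### A model polygon with all vertices in general position -/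

section Orbit
variable {d : ℕ}

/-- The orbit of `(1, …, 1)` under `diag (1, 2, …, d + 1)`. -/
noncomputable def orbitPoint (d : ℕ) (k : ℤ) : Vec d := fun i => ((i : ℕ) + 1 : ℝ) ^ k

theorem orbitPoint_ne_zero (d : ℕ) (k : ℤ) : orbitPoint d k ≠ 0 := fun h => by
  have := congrFun h 0
  simp [orbitPoint] at this

noncomputable def orbitNodes (d : ℕ) : Finset ℝ :=
  Finset.univ.image fun i : Fin (d + 1) => ((i : ℕ) + 1 : ℝ)

theorem card_orbitNodes (d : ℕ) : (orbitNodes d).card = d + 1 := by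
  rw [orbitNodes, Finset.card_image_of_injective, Finset.card_univ, Fintype.card_fin]
  intro i j h
  simpa [Fin.ext_iff] using h

theorem orbitNodes_pos : ∀ x ∈ orbitNodes d, 0 < x := by
  intro x hx
  obtain ⟨i, -, rfl⟩ := Finset.mem_image.1 hx
  positivity

theorem sum_smul_orbitPoint_eq_zero_iff {ι : Type*} (S : Finset ι) (c : ι → ℝ) (e : ι → ℤ) :
    ∑ s ∈ S, c s • orbitPoint d (e s) = 0 ↔
      ∀ x ∈ orbitNodes d, ∑ s ∈ S, c s * x ^ e s = 0 := by
  constructor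
  · intro h x hx
    obtain ⟨i, -, rfl⟩ := Finset.mem_image.1 hx
    have := congrFun h i
    simpa [Finset.sum_apply, orbitPoint] using this
  · intro h
    ext i
    have := h _ (Finset.mem_image_of_mem _ (Finset.mem_univ i))
    simpa [Finset.sum_apply, orbitPoint] using this

/-- A relation is a sum of at most d + 1 monomials vanishing at the d + 1 positive numbers 1, …, d +
1. -/
theorem orbitPoint_relation {ι : Type*} {S : Finset ι} {e : ι → ℤ} (he : Set.InjOn e S)
    (hS : S.card ≤ d + 1) {c : ι → ℝ} (h : ∑ s ∈ S, c s • orbitPoint d (e s) = 0) :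
    ∀ s ∈ S, c s = 0 :=
  eq_zero_of_sum_zpow_eq_zero he orbitNodes_pos (hS.trans (card_orbitNodes d).ge)
    ((sum_smul_orbitPoint_eq_zero_iff S c e).1 h)

/-- The span of the points of the orbit with indices in `S`. -/
noncomputable def orbitSpan (d : ℕ) (S : Finset ℤ) : Submodule ℝ (Vec d) :=
  Submodule.span ℝ (orbitPoint d '' S)

theorem mem_orbitSpan {S : Finset ℤ} {x : Vec d} :
    x ∈ orbitSpan d S ↔ ∃ c : ℤ → ℝ, ∑ s ∈ S, c s • orbitPoint d s = x :=
  Submodule.mem_span_image_finset_iff_exists_fun' ℝ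

theorem orbitPoint_mem_orbitSpan {S : Finset ℤ} {s : ℤ} (hs : s ∈ S) :
    orbitPoint d s ∈ orbitSpan d S := Submodule.subset_span ⟨s, hs, rfl⟩

theorem orbitSpan_mono {S S' : Finset ℤ} (h : S ⊆ S') : orbitSpan d S ≤ orbitSpan d S' :=
  Submodule.span_mono (Set.image_mono (by exact_mod_cast h))

theorem finrank_orbitSpan {S : Finset ℤ} (hS : S.card ≤ d + 1) :
    Module.finrank ℝ (orbitSpan d S) = S.card := by
  have hli : LinearIndependent ℝ fun s : S => orbitPoint d s := by
    rw [Fintype.linearIndependent_iff]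
    intro g hg s
    have := orbitPoint_relation (e := id) (Set.injOn_id _) hS
      (c := fun s => if h : s ∈ S then g ⟨s, h⟩ else 0) (by
      rw [← Finset.sum_coe_sort, ← hg]
      exact Finset.sum_congr rfl fun s _ => by simp [id]) s s.2
    simpa using this
  have := finrank_span_eq_card hli
  rw [Fintype.card_coe] at this
  rw [← this, orbitSpan, Set.image_eq_range]
  rfl

/-- The vertices of the union are independent, so the two expansions of a common vector must
coincide. -/
theorem orbitSpan_inf_le {S S' : Finset ℤ} (h : (S ∪ S').card ≤ d + 1) :
    orbitSpan d S ⊓ orbitSpan d S' ≤ orbitSpan d (S ∩ S') := by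
  classical
  rintro x ⟨h1, h2⟩
  obtain ⟨α, hα⟩ := mem_orbitSpan.1 h1
  obtain ⟨β, hβ⟩ := mem_orbitSpan.1 h2
  have key := orbitPoint_relation (e := id) (Set.injOn_id _) h
    (c := fun s => (if s ∈ S then α s else 0) - (if s ∈ S' then β s else 0)) (by
      simp only [id, sub_smul, Finset.sum_sub_distrib, ite_smul, zero_smul, Finset.sum_ite_mem,
        Finset.union_inter_cancel_left, Finset.union_inter_cancel_right, hα, hβ, sub_self])
  refine mem_orbitSpan.2 ⟨α, ?_⟩
  rw [← hα]
  refine Finset.sum_subset Finset.inter_subset_left fun s hs hs' => ?_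
  have hns : s ∉ S' := fun h => hs' (Finset.mem_inter.2 ⟨hs, h⟩)
  have := key s (Finset.mem_union_left _ hs)
  simp only [if_pos hs, if_neg hns, sub_zero] at this
  rw [this, zero_smul]

/-- Intersections of consecutive hyperplanes of the orbit. -/
theorem iInf_orbitSpan_le {m : ℕ} (hm : 0 < m) (a : ℤ) {r : ℕ} (hr : r < d) :
    ⨅ i ∈ Finset.range (r + 1), orbitSpan d (progression (a + m * (i : ℕ)) m d) ≤
      orbitSpan d (progression (a + m * (r : ℕ)) m (d - r)) := by
  induction r with
  | zero => simp
  | succ r ih =>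
    have h1 : ⨅ i ∈ Finset.range (r + 1 + 1), orbitSpan d (progression (a + m * (i : ℕ)) m d) ≤
        orbitSpan d (progression (a + m * (r : ℕ)) m (d - r)) ⊓
          orbitSpan d (progression (a + m * ((r + 1 : ℕ) : ℤ)) m d) := by
      refine le_inf ((le_iInf₂ fun i hi => ?_).trans (ih (by omega))) ?_
      · refine iInf₂_le i ?_
        rw [Finset.mem_range] at hi ⊢; omega
      · exact iInf₂_le (r + 1) (by simp)
    -- In units of m the index sets are r, …, d - 1 and r + 1, …, r + d; their union has at most d +
    -- 1 elements, so the independence of the vertices applies.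
    refine h1.trans ((orbitSpan_inf_le ?_).trans (orbitSpan_mono ?_))
    · refine (Finset.card_le_card (t := progression (a + m * (r : ℕ)) m (d + 1)) ?_).trans
        (card_progression hm _ _).le
      intro x hx
      rw [Finset.mem_union, mem_progression, mem_progression] at hx
      rw [mem_progression]
      rcases hx with ⟨i, hi, rfl⟩ | ⟨i, hi, rfl⟩
      · exact ⟨i, by omega, rfl⟩
      · exact ⟨i + 1, by omega, by push_cast; ring⟩
    · intro x hx
      rw [Finset.mem_inter, mem_progression, mem_progression] at hx
      obtain ⟨⟨i, hi, rfl⟩, ⟨j, hj, hij⟩⟩ := hx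
      rw [mem_progression]
      refine ⟨j, ?_, hij⟩
      have hm' : (m : ℤ) ≠ 0 := by exact_mod_cast hm.ne'
      have : (m : ℤ) * (i : ℤ) = m * (j + 1) := by push_cast at hij; linarith
      have := mul_left_cancel₀ hm' this
      omega

end Orbit

/-! ### Coprimality of the two halves of a relation -/

section Coprime
open Polynomial

/-- A common factor k of degree κ ≥ 1 can be cancelled at the nodes where k(x^m) ≠ 0, at least p + q
+ 1 - κ of them. The quotients have at most p + q + 2 - 2κ monomials, with distinct exponents
because the progressions are disjoint, so by Descartes they vanish: a contradiction. -/
theorem isCoprime_of_relation {p q m : ℕ} (hm : 0 < m) {a b : ℤ} {f g : ℝ[X]}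
    (hab : Disjoint (progression a m (p + 1)) (progression b m (q + 1)))
    (hf : f.natDegree ≤ p) (hg : g.natDegree ≤ q) (hf0 : f ≠ 0) (hg0 : g ≠ 0)
    (h : ∀ x ∈ orbitNodes (p + q), x ^ a * f.eval (x ^ m) + x ^ b * g.eval (x ^ m) = 0) :
    IsCoprime f g := by
  classical
  rw [← EuclideanDomain.gcd_isUnit_iff]
  by_contra hu
  set k := EuclideanDomain.gcd f g
  obtain ⟨f', hf'⟩ : k ∣ f := EuclideanDomain.gcd_dvd_left f g
  obtain ⟨g', hg'⟩ : k ∣ g := EuclideanDomain.gcd_dvd_right f g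
  have hk0 : k ≠ 0 := fun h0 => hf0 (by rw [hf', h0, zero_mul])
  have hf'0 : f' ≠ 0 := fun h0 => hf0 (by rw [hf', h0, mul_zero])
  have hg'0 : g' ≠ 0 := fun h0 => hg0 (by rw [hg', h0, mul_zero])
  have hk1 : 1 ≤ k.natDegree := by
    by_contra h1
    rw [eq_C_of_natDegree_eq_zero (by omega : k.natDegree = 0)] at hu hk0
    exact hu (isUnit_C.2 (isUnit_iff_ne_zero.2 fun h0 => hk0 (by rw [h0, C_0])))
  have hfdeg : k.natDegree + f'.natDegree ≤ p := by rwa [← natDegree_mul hk0 hf'0, ← hf']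
  have hgdeg : k.natDegree + g'.natDegree ≤ q := by rwa [← natDegree_mul hk0 hg'0, ← hg']
  let S : Finset (ℕ ⊕ ℕ) := (Finset.range (f'.natDegree + 1)).disjSum
    (Finset.range (g'.natDegree + 1))
  let e : ℕ ⊕ ℕ → ℤ := Sum.elim (fun i => a + m * i) (fun i => b + m * i)
  let c : ℕ ⊕ ℕ → ℝ := Sum.elim f'.coeff g'.coeff
  let X := (orbitNodes (p + q)).filter fun x => k.eval (x ^ m) ≠ 0
  have hXcard : p + q + 1 ≤ X.card + k.natDegree := by
    have h1 : ((orbitNodes (p + q)).filter fun x => ¬ k.eval (x ^ m) ≠ 0).card ≤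
        k.roots.toFinset.card := by
      refine Finset.card_le_card_of_injOn (fun x => x ^ m) (fun x hx => ?_) fun x hx y hy hxy => ?_
      · simp only [Finset.coe_filter, Set.mem_ofPred_eq, not_not] at hx
        simp [hk0, hx.2]
      · simp only [Finset.coe_filter, Set.mem_ofPred_eq] at hx hy
        exact (pow_left_inj₀ (orbitNodes_pos x hx.1).le (orbitNodes_pos y hy.1).le hm.ne').1 hxy
    have h2 := (Multiset.toFinset_card_le k.roots).trans (card_roots' k)
    have h3 := Finset.card_filter_add_card_filter_not (s := orbitNodes (p + q))
      (fun x => k.eval (x ^ m) ≠ 0)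
    rw [card_orbitNodes] at h3
    change X.card + _ = _ at h3
    omega
  have he : Set.InjOn e S := by
    have hinl : ∀ i, Sum.inl i ∈ S → e (Sum.inl i) ∈ progression a m (p + 1) := fun i hi => by
      rw [Finset.inl_mem_disjSum, Finset.mem_range] at hi
      exact mem_progression.2 ⟨i, by omega, rfl⟩
    have hinr : ∀ i, Sum.inr i ∈ S → e (Sum.inr i) ∈ progression b m (q + 1) := fun i hi => by
      rw [Finset.inr_mem_disjSum, Finset.mem_range] at hi
      exact mem_progression.2 ⟨i, by omega, rfl⟩
    rintro (i | i) hi (j | j) hj hij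
    · exact congrArg _ (progression_index_injective hm a hij)
    · exact absurd hij (Finset.disjoint_iff_ne.1 hab _ (hinl i hi) _ (hinr j hj))
    · exact absurd hij.symm (Finset.disjoint_iff_ne.1 hab _ (hinl j hj) _ (hinr i hi))
    · exact congrArg _ (progression_index_injective hm b hij)
  have hz := eq_zero_of_sum_zpow_eq_zero (S := S) (e := e) (c := c) (X := X) he
    (fun x hx => orbitNodes_pos x
      (Finset.mem_filter.1 (show x ∈ (orbitNodes (p + q)).filter _ from hx)).1)
    (by rw [Finset.card_disjSum, Finset.card_range, Finset.card_range]; omega)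
    (fun x hx => by
      obtain ⟨hx1, hx2⟩ := Finset.mem_filter.1 (show x ∈ (orbitNodes (p + q)).filter _ from hx)
      have hx0 := orbitNodes_pos x hx1
      have hrel := h x hx1
      rw [hf', hg', eval_mul, eval_mul] at hrel
      have hrel' : x ^ a * f'.eval (x ^ m) + x ^ b * g'.eval (x ^ m) = 0 :=
        mul_left_cancel₀ hx2 (by rw [mul_zero, ← hrel]; ring)
      rw [← hrel', eval_eq_sum_range, eval_eq_sum_range, Finset.sum_disjSum, Finset.mul_sum,
        Finset.mul_sum]
      have hz : ∀ (z : ℤ) (i : ℕ), x ^ (z + m * i) = x ^ z * (x ^ m) ^ i := fun z i => by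
        rw [zpow_add₀ hx0.ne', zpow_mul, zpow_natCast, zpow_natCast]
      congr 1 <;> refine Finset.sum_congr rfl fun i _ => ?_
      · simp only [c, e, Sum.elim_inl, hz]; ring
      · simp only [c, e, Sum.elim_inr, hz]; ring)
  refine hf'0 (Polynomial.ext fun i => ?_)
  rcases Nat.lt_or_ge i (f'.natDegree + 1) with hi | hi
  · exact hz (Sum.inl i) (Finset.inl_mem_disjSum.2 (Finset.mem_range.2 hi))
  · rw [coeff_eq_zero_of_natDegree_lt (by omega), coeff_zero]

end Coprime

/-! ### The relation among d + 2 vertices and general position of the images -/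

section Relation
variable {d : ℕ}

theorem orbitPoint_add_apply (k j : ℤ) (i : Fin (d + 1)) :
    orbitPoint d (k + j) i = ((i : ℕ) + 1 : ℝ) ^ k * orbitPoint d j i := by
  have : ((i : ℕ) + 1 : ℝ) ≠ 0 := by positivity
  simp only [orbitPoint, zpow_add₀ this]

theorem sum_smul_orbitPoint_add {S : Finset ℤ} {c : ℤ → ℝ} (k : ℤ) (i : Fin (d + 1)) :
    (∑ j ∈ S, c j • orbitPoint d (k + j)) i =
      ((i : ℕ) + 1 : ℝ) ^ k * (∑ j ∈ S, c j • orbitPoint d j) i := by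
  simp only [Finset.sum_apply, Pi.smul_apply, orbitPoint_add_apply, smul_eq_mul, Finset.mul_sum]
  exact Finset.sum_congr rfl fun _ _ => by ring

theorem sum_smul_orbitPoint_add_eq_zero {S : Finset ℤ} {c : ℤ → ℝ}
    (h : ∑ j ∈ S, c j • orbitPoint d j = 0) (k : ℤ) :
    ∑ j ∈ S, c j • orbitPoint d (k + j) = 0 := by
  ext i
  rw [sum_smul_orbitPoint_add, h]; simp

theorem exists_orbitPoint_relation {S : Finset ℤ} (hS : S.card = d + 2) :
    ∃ c : ℤ → ℝ, ∑ s ∈ S, c s • orbitPoint d s = 0 ∧ ∀ s ∈ S, c s ≠ 0 := by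
  classical
  have hdep : ¬ LinearIndependent ℝ fun s : S => orbitPoint d s := fun h => by
    have := h.fintype_card_le_finrank
    simp [hS] at this
  rw [Fintype.not_linearIndependent_iff] at hdep
  obtain ⟨g, hg, s₀, hs₀⟩ := hdep
  let c : ℤ → ℝ := fun s => if h : s ∈ S then g ⟨s, h⟩ else 0
  have hc : ∑ s ∈ S, c s • orbitPoint d s = 0 := by
    rw [← Finset.sum_coe_sort, ← hg]
    exact Finset.sum_congr rfl fun s _ => by simp [c]
  refine ⟨c, hc, fun s hs h0 => hs₀ ?_⟩
  -- One zero coefficient would leave a relation among d + 1 vertices, which is trivial.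
  have hz := orbitPoint_relation (S := S.erase s) (e := id) (d := d) (Set.injOn_id _)
    (by rw [Finset.card_erase_of_mem hs]; omega) (c := c) (by
      rw [← hc, ← Finset.add_sum_erase S _ hs, h0, zero_smul, zero_add]; rfl)
  by_cases h : (s₀ : ℤ) = s
  · have : c s₀ = 0 := by rw [h, h0]
    simpa [c] using this
  · have := hz s₀ (Finset.mem_erase.2 ⟨h, s₀.2⟩)
    simpa [c] using this

/-- A vector in both planes yields a relation among the d + 2 vertices; subtracting the multiple of
c that kills one coefficient makes it trivial, so the vector is a multiple of the A-half of c. -/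
theorem inf_orbitSpan_le_span {A A' : Finset ℤ} (hA : A.Nonempty) (hdisj : Disjoint A A')
    (hcard : A.card + A'.card = d + 2) {c : ℤ → ℝ} (hc0 : ∀ s ∈ A, c s ≠ 0)
    (hc : ∑ s ∈ A, c s • orbitPoint d s + ∑ s ∈ A', c s • orbitPoint d s = 0) (k : ℤ) :
    orbitSpan d (A.image fun j => k + j) ⊓ orbitSpan d (A'.image fun j => k + j) ≤
      Submodule.span ℝ {∑ j ∈ A, c j • orbitPoint d (k + j)} := by
  classical
  have hinj : Function.Injective fun j : ℤ => k + j := add_right_injective k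
  rintro x ⟨h1, h2⟩
  obtain ⟨α, hα⟩ := mem_orbitSpan.1 h1
  obtain ⟨β, hβ⟩ := mem_orbitSpan.1 h2
  rw [Finset.sum_image hinj.injOn] at hα hβ
  obtain ⟨a, ha⟩ := hA
  set t := α (k + a) / c a
  rw [← Finset.sum_union hdisj] at hc
  have hck := sum_smul_orbitPoint_add_eq_zero hc k
  rw [Finset.sum_union hdisj] at hck
  let γ : ℤ → ℝ := fun j => (if j ∈ A then α (k + j) else -β (k + j)) - t * c j
  have hγA : ∑ j ∈ A, γ j • orbitPoint d (k + j) = x - t • ∑ j ∈ A, c j • orbitPoint d (k + j) := by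
    rw [← hα, Finset.smul_sum, ← Finset.sum_sub_distrib]
    exact Finset.sum_congr rfl fun j hj => by simp only [γ, if_pos hj, sub_smul, mul_smul]
  have hγA' : ∑ j ∈ A', γ j • orbitPoint d (k + j) =
      -x - t • ∑ j ∈ A', c j • orbitPoint d (k + j) := by
    rw [← hβ, Finset.smul_sum, ← Finset.sum_neg_distrib, ← Finset.sum_sub_distrib]
    refine Finset.sum_congr rfl fun j hj => ?_
    simp only [γ, if_neg (Finset.disjoint_right.1 hdisj hj), sub_smul, mul_smul, neg_smul]
  have hγ : ∑ j ∈ A ∪ A', γ j • orbitPoint d (k + j) = 0 := by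
    rw [Finset.sum_union hdisj, hγA, hγA', eq_neg_of_add_eq_zero_right hck, smul_neg]
    abel
  have hγa : γ a = 0 := by
    simp only [γ, if_pos ha, t]
    rw [div_mul_cancel₀ _ (hc0 a ha), sub_self]
  have hamem : a ∈ A ∪ A' := Finset.mem_union_left _ ha
  have hz := orbitPoint_relation (S := (A ∪ A').erase a) (e := fun j => k + j) (d := d) hinj.injOn
    (by rw [Finset.card_erase_of_mem hamem, Finset.card_union_of_disjoint hdisj]; omega) (c := γ)
    (by rw [← hγ, ← Finset.add_sum_erase _ _ hamem, hγa, zero_smul, zero_add])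
  have hz' : ∑ j ∈ A, γ j • orbitPoint d (k + j) = 0 := Finset.sum_eq_zero fun j hj => by
    by_cases hja : j = a
    · rw [hja, hγa, zero_smul]
    · rw [hz j (Finset.mem_erase.2 ⟨hja, Finset.mem_union_left _ hj⟩), zero_smul]
  rw [hz'] at hγA
  exact Submodule.mem_span_singleton.2 ⟨t, (sub_eq_zero.1 hγA.symm).symm⟩

open Polynomial in
/-- The images of consecutive vertices are in general position. -/
theorem linearIndependent_images {p q m : ℕ} (hm : 0 < m) (hpq : p + q = d) {a b : ℤ}
    (hab : Disjoint (progression a m (p + 1)) (progression b m (q + 1))) {c : ℤ → ℝ}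
    (hca : ∀ s ∈ progression a m (p + 1), c s ≠ 0) (hcb : ∀ s ∈ progression b m (q + 1), c s ≠ 0)
    (hc : ∑ s ∈ progression a m (p + 1), c s • orbitPoint d s +
      ∑ s ∈ progression b m (q + 1), c s • orbitPoint d s = 0) (k : ℤ) :
    LinearIndependent ℝ (Sum.elim
      (fun i : Fin q => ∑ j ∈ progression a m (p + 1),
        c j • orbitPoint d (k + (-a + m * (i : ℕ)) + j))
      (fun i : Fin p => ∑ j ∈ progression a m (p + 1),
        c j • orbitPoint d (k + (-b + m * (i : ℕ)) + j))) := by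
  classical
  subst hpq
  have hcoeff : ∀ {n : ℕ} (φ : Fin n → ℝ) (i : Fin n),
      (∑ i : Fin n, C (φ i) * X ^ (i : ℕ) : ℝ[X]).coeff i = φ i := by
    intro n φ i
    rw [finsetSum_coeff, Finset.sum_eq_single i]
    · simp
    · intro j _ hj
      rw [coeff_C_mul, coeff_X_pow, if_neg, mul_zero]
      simpa [Fin.ext_iff, eq_comm] using hj
    · simp
  have heval : ∀ {n : ℕ} (φ : Fin n → ℝ) (y : ℝ),
      (∑ i : Fin n, C (φ i) * X ^ (i : ℕ) : ℝ[X]).eval y = ∑ i : Fin n, φ i * y ^ (i : ℕ) := by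
    intro n φ y
    simp [eval_finsetSum]
  have hdeg : ∀ {n : ℕ} (φ : Fin (n + 1) → ℝ),
      (∑ i : Fin (n + 1), C (φ i) * X ^ (i : ℕ) : ℝ[X]).natDegree ≤ n := fun φ =>
    natDegree_sum_le_of_forall_le _ _ fun i _ =>
      (natDegree_C_mul_X_pow_le _ _).trans (Nat.lt_succ_iff.1 i.2)
  set f : ℝ[X] := ∑ i : Fin (p + 1), C (c (a + m * (i : ℕ))) * X ^ (i : ℕ) with hf
  set g : ℝ[X] := ∑ i : Fin (q + 1), C (c (b + m * (i : ℕ))) * X ^ (i : ℕ) with hg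
  have hfdeg : f.natDegree ≤ p := hdeg fun i => c (a + m * (i : ℕ))
  have hgdeg : g.natDegree ≤ q := hdeg fun i => c (b + m * (i : ℕ))
  have hf0 : f ≠ 0 := fun h => by
    have := hcoeff (fun i : Fin (p + 1) => c (a + m * (i : ℕ))) 0
    rw [← hf, h, coeff_zero] at this
    exact hca _ (mem_progression.2 ⟨0, by omega, rfl⟩) (by simpa using this.symm)
  have hgq : g.coeff q ≠ 0 := fun h => by
    have := hcoeff (fun i : Fin (q + 1) => c (b + m * (i : ℕ))) (Fin.last q)
    rw [← hg, Fin.val_last, h] at this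
    exact hcb _ (mem_progression.2 ⟨q, by omega, rfl⟩) this.symm
  have hg0 : g ≠ 0 := fun h => hgq (by rw [h, coeff_zero])
  have hzm : ∀ {x : ℝ}, 0 < x → ∀ (z : ℤ) (i : ℕ), x ^ (z + m * i) = x ^ z * (x ^ m) ^ i :=
    fun hx z i => by rw [zpow_add₀ hx.ne', zpow_mul, zpow_natCast, zpow_natCast]
  have hprog : ∀ {x : ℝ}, 0 < x → ∀ (z : ℤ) (n : ℕ), ∑ s ∈ progression z m n, c s * x ^ s =
      x ^ z * (∑ i : Fin n, C (c (z + m * (i : ℕ))) * X ^ (i : ℕ) : ℝ[X]).eval (x ^ m) := by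
    intro x hx z n
    rw [heval, sum_progression hm, Finset.sum_range, Finset.mul_sum]
    exact Finset.sum_congr rfl fun i _ => by rw [hzm hx]; ring
  have hfg : ∀ x ∈ orbitNodes (p + q),
      x ^ a * f.eval (x ^ m) + x ^ b * g.eval (x ^ m) = 0 := by
    intro x hx
    rw [← Finset.sum_union hab] at hc
    have := (sum_smul_orbitPoint_eq_zero_iff _ _ _).1 hc x hx
    rwa [Finset.sum_union hab, hprog (orbitNodes_pos x hx), hprog (orbitNodes_pos x hx)] at this
  have hcop := isCoprime_of_relation hm hab hfdeg hgdeg hf0 hg0 hfg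
  rw [Fintype.linearIndependent_iff]
  intro γ hγ
  rw [Fintype.sum_sum_type] at hγ
  simp only [Sum.elim_inl, Sum.elim_inr] at hγ
  set A : ℝ[X] := ∑ i : Fin q, C (γ (Sum.inl i)) * X ^ (i : ℕ) with hA
  set B : ℝ[X] := ∑ i : Fin p, C (γ (Sum.inr i)) * X ^ (i : ℕ) with hB
  have hAdeg : A.degree < q := degree_sum_fin_lt fun i => γ (Sum.inl i)
  have hBdeg : B.degree < p := degree_sum_fin_lt fun i => γ (Sum.inr i)
  have hw : ∀ (s : ℤ) (i : Fin (p + q + 1)), (∑ j ∈ progression a m (p + 1),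
      c j • orbitPoint (p + q) (s + j)) i =
      ((i : ℕ) + 1 : ℝ) ^ s * (((i : ℕ) + 1 : ℝ) ^ a * f.eval (((i : ℕ) + 1 : ℝ) ^ m)) := by
    intro s i
    rw [sum_smul_orbitPoint_add, ← hprog (by positivity)]
    simp [orbitPoint]
  -- A relation among the images says that Af - Bg vanishes at the d + 1 points x^m. Its degree is
  -- below d + 1, so it is zero as a polynomial.
  have hAB : A * f - B * g = 0 := by
    refine eq_zero_of_degree_lt_of_eval_finset_eq_zero ((orbitNodes (p + q)).image (· ^ m)) ?_ ?_
    · rw [Finset.card_image_of_injOn fun x hx y hy hxy => (pow_left_inj₀ (orbitNodes_pos x hx).le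
        (orbitNodes_pos y hy).le hm.ne').1 hxy, card_orbitNodes]
      have hfd : f.degree ≤ p := natDegree_le_iff_degree_le.1 hfdeg
      have hgd : g.degree ≤ q := natDegree_le_iff_degree_le.1 hgdeg
      refine (degree_sub_le _ _).trans_lt (max_lt ?_ ?_)
      · refine (degree_mul_le _ _).trans_lt ?_
        refine (add_le_add hAdeg.le hfd).trans_lt ?_
        rw [← Nat.cast_add]
        exact_mod_cast (by omega : q + p < p + q + 1)
      · refine (degree_mul_le _ _).trans_lt ?_
        refine (add_le_add hBdeg.le hgd).trans_lt ?_
        rw [← Nat.cast_add]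
        exact_mod_cast (by omega : p + q < p + q + 1)
    · intro y hy
      obtain ⟨x, hx, rfl⟩ := Finset.mem_image.1 hy
      have hfgx := hfg x hx
      have hx0 := orbitNodes_pos x hx
      obtain ⟨i, -, rfl⟩ := Finset.mem_image.1 hx
      have h := congrFun hγ i
      rw [Pi.add_apply, Finset.sum_apply, Finset.sum_apply] at h
      simp only [Pi.smul_apply, Pi.zero_apply, hw, smul_eq_mul] at h
      set x : ℝ := ((i : ℕ) + 1 : ℝ)
      have h1 : ∀ (z : ℤ) (j : ℕ), x ^ (k + (-z + m * j)) * x ^ z = x ^ k * (x ^ m) ^ j := by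
        intro z j
        rw [← zpow_add₀ hx0.ne', show k + (-z + m * (j : ℤ)) + z = k + m * j by ring, hzm hx0]
      have h2 : x ^ a * f.eval (x ^ m) = -(x ^ b * g.eval (x ^ m)) :=
        eq_neg_of_add_eq_zero_left hfgx
      refine (mul_eq_zero.1 (?_ : x ^ k * _ = 0)).resolve_left (zpow_ne_zero _ hx0.ne')
      have hAe : A.eval (x ^ m) = _ := heval _ _
      have hBe : B.eval (x ^ m) = _ := heval _ _
      rw [eval_sub, eval_mul, eval_mul, hAe, hBe, mul_sub, Finset.sum_mul, Finset.sum_mul,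
        Finset.mul_sum, Finset.mul_sum, ← h, sub_eq_add_neg, ← Finset.sum_neg_distrib]
      congr 1 <;> refine Finset.sum_congr rfl fun j _ => ?_
      · linear_combination (-γ (Sum.inl j) * f.eval (x ^ m)) * h1 a j
      · rw [h2]
        linear_combination (γ (Sum.inr j) * g.eval (x ^ m)) * h1 b j
  -- By coprimality g divides A, whose degree is below q = deg g; the degree is exact since the last
  -- coefficient of g is nonzero.
  have hA0 : A = 0 := by
    refine eq_zero_of_dvd_of_degree_lt (p := g) ?_ (hAdeg.trans_le (le_degree_of_ne_zero hgq))
    exact hcop.symm.dvd_of_dvd_mul_right ⟨B, by rw [sub_eq_zero.1 hAB, mul_comm]⟩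
  have hB0 : B = 0 := by
    rw [hA0, zero_mul, zero_sub, neg_eq_zero] at hAB
    exact (mul_eq_zero.1 hAB).resolve_right hg0
  rintro (i | i)
  · rw [← hcoeff (fun i => γ (Sum.inl i)) i, ← hA, hA0, coeff_zero]
  · rw [← hcoeff (fun i => γ (Sum.inr i)) i, ← hB, hB0, coeff_zero]

end Relation

/-! ### Dimensions of diagonals -/

section Diagonal
variable {d : ℕ}

theorem submodule_le_diagonal (v : Polygon d) {S : Finset ℤ} {k l : ℤ} (h : l - k ∈ S) :
    (v l).submodule ≤ diagonal v S k := by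
  have := le_iSup₂_of_le (f := fun j (_ : j ∈ S) => (v (k + j)).submodule) (l - k) h le_rfl
  simpa [diagonal] using this

theorem diagonal_le_iff {v : Polygon d} {S : Finset ℤ} {k : ℤ} {U : Submodule ℝ (Vec d)} :
    diagonal v S k ≤ U ↔ ∀ j ∈ S, (v (k + j)).submodule ≤ U := iSup₂_le_iff

theorem diagonal_eq_span {v : Polygon d} {f : ℤ → Vec d}
    (h : ∀ k, (v k).submodule = Submodule.span ℝ {f k}) (S : Finset ℤ) (k : ℤ) :
    diagonal v S k = Submodule.span ℝ ((fun j => f (k + j)) '' S) := by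
  simp only [diagonal, h, Submodule.iSup_span, Set.image_eq_iUnion, Finset.mem_coe]

theorem finrank_diagonal_le (v : Polygon d) (S : Finset ℤ) (k : ℤ) :
    Module.finrank ℝ (diagonal v S k) ≤ S.card := by
  classical
  rw [diagonal_eq_span (fun k => (v k).submodule_eq), ← Finset.coe_image]
  exact (finrank_span_finset_le_card _).trans Finset.card_image_le

theorem eq_of_submodule_le {x y : Projectivization ℝ (Vec d)} (h : x.submodule ≤ y.submodule) :
    x = y :=
  Projectivization.submodule_injective (Submodule.eq_of_le_of_finrank_eq h
    (x.finrank_submodule.trans y.finrank_submodule.symm))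

/-- Each intersection with a hyperplane lowers the dimension by at most one. -/
theorem finrank_le_finrank_inf_iInf_add_card {ι : Type*} (A : Submodule ℝ (Vec d))
    {H : ι → Submodule ℝ (Vec d)} {S : Finset ι} (hH : ∀ i ∈ S, d ≤ Module.finrank ℝ (H i)) :
    Module.finrank ℝ A ≤ Module.finrank ℝ (A ⊓ ⨅ i ∈ S, H i : Submodule ℝ (Vec d)) + S.card := by
  classical
  induction S using Finset.induction_on with
  | empty =>
    rw [show (⨅ i ∈ (∅ : Finset ι), H i) = ⊤ by simp, inf_top_eq]
    exact Nat.le_add_right _ _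
  | insert i S hi ih =>
    have h1 := ih fun j hj => hH j (Finset.mem_insert_of_mem hj)
    have h2 := hH i (Finset.mem_insert_self i S)
    have h3 := Submodule.finrank_sup_add_finrank_inf_eq (A ⊓ ⨅ i ∈ S, H i) (H i)
    have h4 := Submodule.finrank_le ((A ⊓ ⨅ i ∈ S, H i) ⊔ H i)
    rw [Module.finrank_fin_fun] at h4
    rw [Finset.iInf_insert, Finset.card_insert_of_notMem hi, inf_comm (H i), ← inf_assoc]
    omega

end Diagonal

/-! ### Recovering vertices from hyperplanes, and conversely -/

section Inverse
variable {d : ℕ}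

/-- The indices `-(d - 1) m, …, -m, 0`. -/
noncomputable def backwardProgression (d m : ℕ) : Finset ℤ :=
  progression (-(((d : ℤ) - 1) * m)) m d

theorem mem_backwardProgression {m : ℕ} {x : ℤ} :
    x ∈ backwardProgression d m ↔ ∃ i < d, x = -((m : ℤ) * (i : ℕ)) := by
  rw [backwardProgression, mem_progression]
  constructor
  · rintro ⟨i, hi, rfl⟩
    refine ⟨d - 1 - i, by omega, ?_⟩
    rw [show ((d - 1 - i : ℕ) : ℤ) = d - 1 - i by omega]
    ring
  · rintro ⟨i, hi, rfl⟩
    refine ⟨d - 1 - i, by omega, ?_⟩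
    rw [show ((d - 1 - i : ℕ) : ℤ) = d - 1 - i by omega]
    ring

theorem neg_mem_backwardProgression {m : ℕ} {x : ℤ} :
    -x ∈ backwardProgression d m ↔ x ∈ progression 0 m d := by
  simp [mem_backwardProgression, mem_progression]

/-- Dimension turns each inclusion into an equality. All the hyperplanes intersected to form v'_k
then contain v_k, so the two points agree. -/
theorem eq_of_diagonal_le {m : ℕ} (hm : 0 < m) {P : Finset ℤ} {v w v' : Polygon d}
    (h : ∀ s, diagonal w P s ≤ diagonal v (progression 0 m d) s)
    (hS : pentagramMap d P (backwardProgression d m) w v') : v' = v := by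
  ext1 k
  refine (eq_of_submodule_le ?_).symm
  rw [← (hS k).2]
  refine le_iInf₂ fun x hx => ?_
  have heq : diagonal w P (k + x) = diagonal v (progression 0 m d) (k + x) :=
    Submodule.eq_of_le_of_finrank_le (h _) (by
      rw [(hS (k + x)).1]
      exact (finrank_diagonal_le _ _ _).trans (card_progression hm _ _).le)
  rw [heq]
  refine submodule_le_diagonal v ?_
  rw [← neg_mem_backwardProgression]
  simpa using hx

theorem submodule_le_diagonal_of_pentagramMap {m : ℕ} {P : Finset ℤ} {v w : Polygon d}
    (hS : pentagramMap d P (backwardProgression d m) w v) {s k : ℤ}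
    (h : k - s ∈ progression 0 m d) : (v k).submodule ≤ diagonal w P s := by
  rw [← (hS k).2]
  have := iInf₂_le (f := fun x (_ : x ∈ backwardProgression d m) => diagonal w P (k + x))
    (s - k) (by rw [← neg_mem_backwardProgression] at h; simpa using h)
  simpa using this

/-- The (p+1)-dimensional diagonal of v lies in q hyperplanes of w, all of which also contain w_k.
It suffices that it is their whole intersection. -/
theorem submodule_le_diagonal_progression {p q m : ℕ} (hpq : p + q = d) {a : ℤ}
    {P : Finset ℤ} (hP : ∀ i < q, -a + (m : ℤ) * (i : ℕ) ∈ P) {v w : Polygon d}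
    (hS : pentagramMap d P (backwardProgression d m) w v) (k : ℤ)
    (hv : Module.finrank ℝ (diagonal v (progression a m (p + 1)) k) = p + 1) :
    (w k).submodule ≤ diagonal v (progression a m (p + 1)) k := by
  classical
  let H : ℕ → Submodule ℝ (Vec d) := fun i => diagonal w P (k + a - m * i)
  have hH : ∀ i, Module.finrank ℝ (H i) = d := fun i => (hS _).1
  have hv_le : diagonal v (progression a m (p + 1)) k ≤ ⨅ i ∈ Finset.range q, H i := by
    refine diagonal_le_iff.2 fun j hj => le_iInf₂ fun i hi => ?_
    obtain ⟨j, hj, rfl⟩ := mem_progression.1 hj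
    refine submodule_le_diagonal_of_pentagramMap hS (mem_progression.2 ⟨i + j, ?_, ?_⟩)
    · have := Finset.mem_range.1 hi; omega
    · push_cast; ring
  -- The remaining d - q = p hyperplanes through v_{k+a} cut the intersection down to a point, so
  -- its dimension is at most p + 1.
  have hle : Module.finrank ℝ (⨅ i ∈ Finset.range q, H i : Submodule ℝ (Vec d)) ≤ p + 1 := by
    have h1 := finrank_le_finrank_inf_iInf_add_card (⨅ i ∈ Finset.range q, H i)
      (H := H) (S := Finset.Ico q d) fun i _ => (hH i).ge
    have h2 : (⨅ i ∈ Finset.range q, H i) ⊓ ⨅ i ∈ Finset.Ico q d, H i ≤ (v (k + a)).submodule := by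
      rw [← (hS (k + a)).2]
      refine le_iInf₂ fun x hx => ?_
      obtain ⟨i, hi, rfl⟩ := mem_backwardProgression.1 hx
      rw [← sub_eq_add_neg]
      rcases lt_or_ge i q with h | h
      · exact inf_le_left.trans (iInf₂_le (f := fun i _ => H i) i (Finset.mem_range.2 h))
      · exact inf_le_right.trans (iInf₂_le (f := fun i _ => H i) i (Finset.mem_Ico.2 ⟨h, hi⟩))
    have h3 := Submodule.finrank_mono h2
    rw [(v (k + a)).finrank_submodule] at h3
    rw [Nat.card_Ico] at h1
    omega
  rw [Submodule.eq_of_le_of_finrank_le hv_le (hle.trans hv.ge)]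
  refine le_iInf₂ fun i hi => submodule_le_diagonal w ?_
  convert hP i (Finset.mem_range.1 hi) using 1
  ring

/-- The hyperplane indices of the inverse map. -/
noncomputable def inverseIndices (a b : ℤ) (m p q : ℕ) : Finset ℤ :=
  progression (-a) m q ∪ progression (-b) m p

theorem mem_inverseIndices_left {a b : ℤ} {m p q i : ℕ} (hi : i < q) :
    -a + (m : ℤ) * (i : ℕ) ∈ inverseIndices a b m p q :=
  Finset.mem_union_left _ (mem_progression.2 ⟨i, hi, rfl⟩)

theorem mem_inverseIndices_right {a b : ℤ} {m p q i : ℕ} (hi : i < p) :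
    -b + (m : ℤ) * (i : ℕ) ∈ inverseIndices a b m p q :=
  Finset.mem_union_right _ (mem_progression.2 ⟨i, hi, rfl⟩)

theorem card_inverseIndices {a b : ℤ} {m p q : ℕ} (hm : 0 < m)
    (hab : Disjoint (progression a m (p + 1)) (progression b m (q + 1))) :
    (inverseIndices a b m p q).card = p + q := by
  rw [inverseIndices, Finset.card_union_of_disjoint, card_progression hm, card_progression hm,
    add_comm]
  rw [Finset.disjoint_iff_ne] at hab ⊢
  intro x hx y hy hxy
  obtain ⟨i, hi, rfl⟩ := mem_progression.1 hx
  obtain ⟨j, hj, rfl⟩ := mem_progression.1 hy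
  exact hab (a + m * (j : ℕ)) (mem_progression.2 ⟨j, by omega, rfl⟩) (b + m * (i : ℕ))
    (mem_progression.2 ⟨i, by omega, rfl⟩) (by linarith)

end Inverse

/-! ### The model polygon as a witness, and the two inverse theorems -/

section OrbitPolygon
variable {d : ℕ}

noncomputable def orbitPolygon (d : ℕ) : Polygon d := fun k =>
  Projectivization.mk ℝ (orbitPoint d k) (orbitPoint_ne_zero d k)

theorem submodule_orbitPolygon (d : ℕ) (k : ℤ) :
    (orbitPolygon d k).submodule = Submodule.span ℝ {orbitPoint d k} :=
  Projectivization.submodule_mk _ _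

theorem isTwisted_orbitPolygon (d n : ℕ) : IsTwisted n (orbitPolygon d) := by
  have h0 : ∀ i : Fin (d + 1), ((i : ℕ) + 1 : ℝ) ^ n ≠ 0 := fun i => by positivity
  refine ⟨LinearEquiv.piCongrRight fun i => LinearEquiv.smulOfNeZero ℝ ℝ _ (h0 i), fun k => ?_⟩
  rw [orbitPolygon, orbitPolygon, Projectivization.map_mk]
  congr 1
  ext i
  rw [add_comm, orbitPoint_add_apply, zpow_natCast]
  rfl

theorem diagonal_orbitPolygon (S : Finset ℤ) (k : ℤ) :
    diagonal (orbitPolygon d) S k = orbitSpan d (S.image fun j => k + j) := by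
  rw [diagonal_eq_span (f := orbitPoint d) (submodule_orbitPolygon d), orbitSpan,
    Finset.coe_image, Set.image_image]

/-- The bi-diagonal and the long-diagonal map with these data send the model polygon to the same w,
and the candidate inverse brings it back; one example serves both inverse theorems. -/
theorem exists_orbit_images {p q m : ℕ} (hm : 0 < m) (hp : 1 ≤ p) (hq : 1 ≤ q) (hpq : p + q = d)
    {a b : ℤ} (hab : Disjoint (progression a m (p + 1)) (progression b m (q + 1))) :
    ∃ w : Polygon d,
      biDiagonalMap d (progression a m (p + 1)) (progression b m (q + 1)) (orbitPolygon d) w ∧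
      pentagramMap d (progression 0 m d) ((inverseIndices a b m p q).image Neg.neg)
        (orbitPolygon d) w ∧
      pentagramMap d (inverseIndices a b m p q) (backwardProgression d m) w (orbitPolygon d) := by
  classical
  set Ap := progression a m (p + 1) with hAp
  set Am := progression b m (q + 1) with hAm
  have hApc : Ap.card = p + 1 := card_progression hm _ _
  have hAmc : Am.card = q + 1 := card_progression hm _ _
  have hinj : ∀ k : ℤ, Function.Injective fun j : ℤ => k + j := fun k => add_right_injective k
  obtain ⟨c, hc, hc0⟩ := exists_orbitPoint_relation (d := d) (S := Ap ∪ Am) (by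
    rw [Finset.card_union_of_disjoint hab]; omega)
  rw [Finset.sum_union hab] at hc
  have hca : ∀ s ∈ Ap, c s ≠ 0 := fun s hs => hc0 s (Finset.mem_union_left _ hs)
  have hcb : ∀ s ∈ Am, c s ≠ 0 := fun s hs => hc0 s (Finset.mem_union_right _ hs)
  have hapos : a ∈ Ap := mem_progression.2 ⟨0, by omega, by simp⟩
  let W : ℤ → Vec d := fun k => ∑ j ∈ Ap, c j • orbitPoint d (k + j)
  have hW' : ∀ k, W k = -∑ j ∈ Am, c j • orbitPoint d (k + j) := fun k => by
    rw [← Finset.sum_union hab] at hc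
    have := sum_smul_orbitPoint_add_eq_zero hc k
    rw [Finset.sum_union hab] at this
    exact eq_neg_of_add_eq_zero_left this
  have hW0 : ∀ k, W k ≠ 0 := fun k h =>
    hca a hapos (orbitPoint_relation (hinj k).injOn (by omega) h a hapos)
  have hsum : ∀ (S : Finset ℤ) (k : ℤ),
      ∑ j ∈ S, c j • orbitPoint d (k + j) ∈ orbitSpan d (S.image fun j => k + j) := fun S k =>
    Submodule.sum_mem _ fun j hj =>
      Submodule.smul_mem _ _ (orbitPoint_mem_orbitSpan (Finset.mem_image_of_mem _ hj))
  have hWa : ∀ k, W k ∈ orbitSpan d (progression (k + a) m (p + 1)) := fun k => by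
    rw [← image_add_progression]; exact hsum Ap k
  have hWb : ∀ k, W k ∈ orbitSpan d (progression (k + b) m (q + 1)) := fun k => by
    rw [← image_add_progression, hW']; exact Submodule.neg_mem _ (hsum Am k)
  have hinf : ∀ k, orbitSpan d (progression (k + a) m (p + 1)) ⊓
      orbitSpan d (progression (k + b) m (q + 1)) = Submodule.span ℝ {W k} := fun k => by
    refine le_antisymm ?_ ?_
    · rw [← image_add_progression, ← image_add_progression]
      exact inf_orbitSpan_le_span ⟨a, hapos⟩ hab (by omega) hca hc k
    · rw [Submodule.span_singleton_le_iff_mem]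
      exact ⟨hWa k, hWb k⟩
  let w : Polygon d := fun k => Projectivization.mk ℝ (W k) (hW0 k)
  have hw : ∀ k, (w k).submodule = Submodule.span ℝ {W k} := fun k =>
    Projectivization.submodule_mk _ _
  have hWmem : ∀ s, ∀ j ∈ inverseIndices a b m p q, W (s + j) ∈ orbitSpan d (progression s m d) := by
    intro s j hj
    rcases Finset.mem_union.1 hj with hj | hj
    · obtain ⟨i, hi, rfl⟩ := mem_progression.1 hj
      refine orbitSpan_mono (fun x hx => ?_) (hWa _)
      obtain ⟨l, hl, rfl⟩ := mem_progression.1 hx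
      exact mem_progression.2 ⟨i + l, by omega, by push_cast; ring⟩
    · obtain ⟨i, hi, rfl⟩ := mem_progression.1 hj
      refine orbitSpan_mono (fun x hx => ?_) (hWb _)
      obtain ⟨l, hl, rfl⟩ := mem_progression.1 hx
      exact mem_progression.2 ⟨i + l, by omega, by push_cast; ring⟩
  have hfinprog : ∀ s, Module.finrank ℝ (orbitSpan d (progression s m d)) = d := fun s => by
    rw [finrank_orbitSpan, card_progression hm]
    rw [card_progression hm]; omega
  -- The vertices of w lie in the hyperplane by shifting indices; they span it because the images
  -- are independent.
  have hdiag : ∀ s, diagonal w (inverseIndices a b m p q) s = orbitSpan d (progression s m d) := by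
    intro s
    refine Submodule.eq_of_le_of_finrank_le (diagonal_le_iff.2 fun j hj => ?_) ?_
    · rw [hw, Submodule.span_singleton_le_iff_mem]
      exact hWmem s j hj
    · have hli := linearIndependent_images hm hpq hab hca hcb hc s
      have hcard := finrank_span_eq_card hli
      rw [Fintype.card_sum, Fintype.card_fin, Fintype.card_fin] at hcard
      rw [hfinprog]
      refine (hpq.symm.trans ((add_comm p q).trans hcard.symm)).le.trans ?_
      refine Submodule.finrank_mono (Submodule.span_le.2 ?_)
      have hmem : ∀ j ∈ inverseIndices a b m p q,
          W (s + j) ∈ diagonal w (inverseIndices a b m p q) s := fun j hj => by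
        rw [← Submodule.span_singleton_le_iff_mem, ← hw]
        exact submodule_le_diagonal w (by simpa using hj)
      rintro _ ⟨i | i, rfl⟩
      · exact hmem _ (mem_inverseIndices_left i.2)
      · exact hmem _ (mem_inverseIndices_right i.2)
  refine ⟨w, fun k => ?_, fun k => ⟨?_, ?_⟩, fun k => ⟨?_, ?_⟩⟩
  · rw [diagonal_orbitPolygon, diagonal_orbitPolygon, image_add_progression, image_add_progression,
      hinf, hw]
    refine ⟨?_, ?_, rfl⟩
    · rw [finrank_orbitSpan, card_progression hm, hApc]
      rw [card_progression hm]; omega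
    · rw [finrank_orbitSpan, card_progression hm, hAmc]
      rw [card_progression hm]; omega
  · rw [diagonal_orbitPolygon, image_add_progression, hfinprog]
  · simp only [diagonal_orbitPolygon, image_add_progression, add_zero]
    rw [hw]
    -- Intersecting q consecutive m-diagonal hyperplanes recovers one plane of the bi-diagonal map;
    -- the statement is used for both planes.
    have hhalf : ∀ {a : ℤ} {p q : ℕ}, 1 ≤ q → p + q = d → ∀ S : Finset ℤ,
        (∀ i < q, a - (m : ℤ) * (i : ℕ) ∈ S) →
        ⨅ x ∈ S, orbitSpan d (progression (k + x) m d) ≤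
          orbitSpan d (progression (k + a) m (p + 1)) := by
      intro a p q hq hpq S hS
      have h1 := iInf_orbitSpan_le (d := d) hm (k + a - m * ((q - 1 : ℕ) : ℤ)) (r := q - 1)
        (by omega)
      rw [show d - (q - 1) = p + 1 by omega, sub_add_cancel] at h1
      refine (le_iInf₂ fun i hi => ?_).trans h1
      rw [Finset.mem_range] at hi
      refine (iInf₂_le _ (hS (q - 1 - i) (by omega))).trans (orbitSpan_mono (subset_of_eq ?_))
      congr 1
      rw [show ((q - 1 - i : ℕ) : ℤ) = ((q - 1 : ℕ) : ℤ) - i by omega]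
      ring
    refine le_antisymm ?_ (le_iInf₂ fun x hx => ?_)
    · rw [← hinf]
      refine le_inf (hhalf hq hpq _ fun i hi => ?_)
        (hhalf hp (by omega) _ fun i hi => ?_)
      · exact Finset.mem_image.2 ⟨_, mem_inverseIndices_left hi, by ring⟩
      · exact Finset.mem_image.2 ⟨_, mem_inverseIndices_right hi, by ring⟩
    · obtain ⟨j, hj, rfl⟩ := Finset.mem_image.1 hx
      rw [Submodule.span_singleton_le_iff_mem]
      simpa using hWmem (k + -j) j hj
  · rw [hdiag, hfinprog]
  · simp only [hdiag]
    rw [submodule_orbitPolygon]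
    refine le_antisymm ?_ (le_iInf₂ fun x hx => ?_)
    · have h1 := iInf_orbitSpan_le (d := d) hm (k - m * ((d - 1 : ℕ) : ℤ)) (r := d - 1)
        (by omega)
      rw [show d - (d - 1) = 1 by omega, sub_add_cancel] at h1
      refine ((le_iInf₂ fun i hi => ?_).trans h1).trans (Submodule.span_mono ?_)
      · rw [Finset.mem_range] at hi
        refine (iInf₂_le (-((m : ℤ) * ((d - 1 - i : ℕ) : ℤ)))
          (mem_backwardProgression.2 ⟨_, by omega, rfl⟩)).trans (orbitSpan_mono (subset_of_eq ?_))
        congr 1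
        rw [show ((d - 1 - i : ℕ) : ℤ) = ((d - 1 : ℕ) : ℤ) - i by omega]
        ring
      · simp [progression]
    · rw [Submodule.span_singleton_le_iff_mem]
      refine orbitPoint_mem_orbitSpan ?_
      obtain ⟨i, hi, rfl⟩ := mem_backwardProgression.1 hx
      exact mem_progression.2 ⟨i, hi, by ring⟩

theorem isGenericInverse_biDiagonalMap {p q m : ℕ} (hm : 0 < m) (hp : 1 ≤ p) (hq : 1 ≤ q)
    (hpq : p + q = d) {a b : ℤ}
    (hab : Disjoint (progression a m (p + 1)) (progression b m (q + 1))) :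
    IsGenericInverse (biDiagonalMap d (progression a m (p + 1)) (progression b m (q + 1)))
      (pentagramMap d (inverseIndices a b m p q) (backwardProgression d m)) where
  left v w v' hT hS := by
    refine eq_of_diagonal_le hm (fun s => diagonal_le_iff.2 fun j hj => ?_) hS
    rw [← (hT (s + j)).2.2]
    rcases Finset.mem_union.1 hj with hj | hj <;> obtain ⟨i, hi, rfl⟩ := mem_progression.1 hj
    · refine inf_le_left.trans (diagonal_le_iff.2 fun l hl => submodule_le_diagonal v ?_)
      obtain ⟨l, hl, rfl⟩ := mem_progression.1 hl
      exact mem_progression.2 ⟨i + l, by omega, by push_cast; ring⟩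
    · refine inf_le_right.trans (diagonal_le_iff.2 fun l hl => submodule_le_diagonal v ?_)
      obtain ⟨l, hl, rfl⟩ := mem_progression.1 hl
      exact mem_progression.2 ⟨i + l, by omega, by push_cast; ring⟩
  right w v w' hS hT := by
    ext1 k
    refine (eq_of_submodule_le ?_).symm
    obtain ⟨h1, h2, h3⟩ := hT k
    rw [card_progression hm] at h1 h2
    rw [← h3]
    exact le_inf
      (submodule_le_diagonal_progression hpq (fun i hi => mem_inverseIndices_left hi) hS k h1)
      (submodule_le_diagonal_progression (by omega) (fun i hi => mem_inverseIndices_right hi)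
        hS k h2)
  nonempty n _ := by
    obtain ⟨w, hT, -, hS⟩ := exists_orbit_images hm hp hq hpq hab
    exact ⟨_, w, isTwisted_orbitPolygon d n, hT, hS⟩

/-- Incidence is symmetric: w_{s+j} lies in H_s for j ∈ P exactly when w_k lies in H_{k-j}. This is
why the long-diagonal offsets are the negatives of P. -/
theorem isGenericInverse_pentagramMap {p q m : ℕ} (hm : 0 < m) (hp : 1 ≤ p) (hq : 1 ≤ q)
    (hpq : p + q = d) {a b : ℤ}
    (hab : Disjoint (progression a m (p + 1)) (progression b m (q + 1))) :
    IsGenericInverse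
      (pentagramMap d (progression 0 m d) ((inverseIndices a b m p q).image Neg.neg))
      (pentagramMap d (inverseIndices a b m p q) (backwardProgression d m)) where
  left v w v' hT hS := by
    refine eq_of_diagonal_le hm (fun s => diagonal_le_iff.2 fun j hj => ?_) hS
    rw [← (hT (s + j)).2]
    have := iInf₂_le (f := fun x (_ : x ∈ (inverseIndices a b m p q).image Neg.neg) =>
      diagonal v (progression 0 m d) (s + j + x)) (-j) (Finset.mem_image_of_mem _ hj)
    simpa using this
  right w v w' hS hT := by
    ext1 k
    refine (eq_of_submodule_le ?_).symm
    rw [← (hT k).2]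
    refine le_iInf₂ fun x hx => ?_
    obtain ⟨j, hj, rfl⟩ := Finset.mem_image.1 hx
    have heq : diagonal v (progression 0 m d) (k + -j) =
        diagonal w (inverseIndices a b m p q) (k + -j) := by
      refine Submodule.eq_of_le_of_finrank_eq (diagonal_le_iff.2 fun l hl => ?_)
        ((hT (k + -j)).1.trans (hS (k + -j)).1.symm)
      refine submodule_le_diagonal_of_pentagramMap hS ?_
      rwa [add_sub_cancel_left]
    rw [heq]
    exact submodule_le_diagonal w (by simpa using hj)
  nonempty n _ := by
    obtain ⟨w, -, hT, hS⟩ := exists_orbit_images hm hp hq hpq hab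
    exact ⟨_, w, isTwisted_orbitPolygon d n, hT, hS⟩

end OrbitPolygon

/-! ### Every map in the theorem has such an inverse -/

section Classification
variable {d : ℕ}

theorem image_neg_progression (a : ℤ) (m n : ℕ) :
    (progression a m n).image Neg.neg = progression (-(a + m * ((n : ℤ) - 1))) m n := by
  ext x
  simp only [Finset.mem_image, mem_progression]
  constructor
  · rintro ⟨_, ⟨i, hi, rfl⟩, rfl⟩
    refine ⟨n - 1 - i, by omega, ?_⟩
    rw [show ((n - 1 - i : ℕ) : ℤ) = n - 1 - i by omega]
    ring
  · rintro ⟨i, hi, rfl⟩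
    refine ⟨_, ⟨n - 1 - i, by omega, rfl⟩, ?_⟩
    rw [show ((n - 1 - i : ℕ) : ℤ) = n - 1 - i by omega]
    ring

theorem progression_union (a : ℤ) (m : ℕ) {n t : ℕ} (ht : t ≤ n) (n' : ℕ) :
    progression a m n ∪ progression (a + m * (t : ℕ)) m n' = progression a m (max n (t + n')) := by
  ext x
  simp only [Finset.mem_union, mem_progression]
  constructor
  · rintro (⟨i, hi, rfl⟩ | ⟨i, hi, rfl⟩)
    · exact ⟨i, by omega, rfl⟩
    · exact ⟨t + i, by omega, by push_cast; ring⟩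
  · rintro ⟨i, hi, rfl⟩
    rcases lt_or_ge i n with h | h
    · exact Or.inl ⟨i, h, rfl⟩
    · refine Or.inr ⟨i - t, by omega, ?_⟩
      rw [show ((i - t : ℕ) : ℤ) = i - t by omega]
      ring

/-- Bi-diagonal and long-diagonal maps are inverse to maps with equally spaced hyperplanes. -/
theorem exists_isGenericInverse {T : PolygonMap d} (hT : IsBiDiagonal d T ∨ IsLongDiagonal d T) :
    2 ≤ d ∧ ∃ P Q : Finset ℤ, P.card = d ∧ (∃ (a : ℤ) (m : ℕ), 0 < m ∧ Q = progression a m d) ∧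
      IsGenericInverse T (pentagramMap d P Q) := by
  classical
  rcases hT with ⟨m, _, _, hm, ⟨a, n, rfl⟩, ⟨b, n', rfl⟩, hdisj, h1, h2, h3, rfl⟩ |
    ⟨m, _, _, hm, ⟨a, n, rfl⟩, ⟨b, n', rfl⟩, hnot, hcard, rfl⟩
  · rw [card_progression hm] at h1 h2 h3
    rw [card_progression hm] at h3
    obtain ⟨p, rfl⟩ : ∃ p, n = p + 1 := ⟨n - 1, by omega⟩
    obtain ⟨q, rfl⟩ : ∃ q, n' = q + 1 := ⟨n' - 1, by omega⟩
    exact ⟨by omega, _, _, (card_inverseIndices hm hdisj).trans (by omega), ⟨_, m, hm, rfl⟩,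
      isGenericInverse_biDiagonalMap hm (by omega) (by omega) (by omega) hdisj⟩
  · have hn : 1 ≤ n := by
      by_contra h
      obtain rfl : n = 0 := by omega
      exact hnot ⟨b, n', by simp [progression]⟩
    have hn' : 1 ≤ n' := by
      by_contra h
      obtain rfl : n' = 0 := by omega
      exact hnot ⟨a, n, by simp [progression]⟩
    -- For these t the two progressions overlap or abut, and their union would be a progression.
    have hgap : ∀ t : ℤ, -n' ≤ t → t ≤ n → b ≠ a + m * t := by
      intro t h1 h2 h
      rcases le_total 0 t with h0 | h0
      · lift t to ℕ using h0
        rw [h, progression_union a m (by omega)] at hnot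
        exact hnot ⟨_, _, rfl⟩
      · obtain ⟨s, rfl⟩ : ∃ s : ℕ, t = -s := ⟨(-t).toNat, by omega⟩
        rw [show a = b + m * (s : ℕ) by rw [h]; ring, Finset.union_comm,
          progression_union b m (by omega)] at hnot
        exact hnot ⟨_, _, rfl⟩
    -- The last terms of the two progressions, since negation reverses them. The lengths are
    -- interchanged and increased by one in the associated bi-diagonal data; the gap condition is
    -- exactly what keeps these disjoint.
    set a' := a + m * ((n : ℤ) - 1) with ha'
    set b' := b + m * ((n' : ℤ) - 1) with hb'
    have hdisj : Disjoint (progression a' m (n' + 1)) (progression b' m (n + 1)) := by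
      rw [Finset.disjoint_iff_ne]
      intro x hx y hy hxy
      obtain ⟨i, hi, rfl⟩ := mem_progression.1 hx
      obtain ⟨j, hj, rfl⟩ := mem_progression.1 hy
      refine hgap (n - n' + i - j) (by omega) (by omega) ?_
      rw [ha', hb'] at hxy
      linear_combination -hxy
    have himage : (inverseIndices a' b' m n' n).image Neg.neg =
        progression a m n ∪ progression b m n' := by
      rw [inverseIndices, Finset.image_union, image_neg_progression, image_neg_progression]
      congr 2 <;> simp [ha', hb']
    have hc := card_inverseIndices hm hdisj
    have hd : n' + n = d := by
      rw [← hcard, ← himage, Finset.card_image_of_injective _ neg_injective, hc]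
    refine ⟨by omega, inverseIndices a' b' m n' n, backwardProgression d m, hc.trans hd,
      ⟨_, m, hm, rfl⟩, ?_⟩
    rw [← himage]
    exact isGenericInverse_pentagramMap hm hn' hn hd hdisj

end Classification

end Pentagram

theorem theorem4p1 (d : ℕ) (T : Pentagram.PolygonMap d)
    (hT : Pentagram.IsBiDiagonal d T ∨ Pentagram.IsLongDiagonal d T) :
    ∃ (C : ℝ) (W : Pentagram.Coeffs d → Pentagram.Coeffs d), 0 < C ∧
      Pentagram.IsKdVField W ∧
      Pentagram.IsContinuousLimit T (fun u G => (-C) • Pentagram.opQ u G)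
        (fun u => (-C) • W u) ∧
      (∀ U : ℝ → Pentagram.Coeffs d,
        Pentagram.IsSolution (fun u => (-C) • W u) U ↔
          Pentagram.IsSolution W (fun t => U (-t / C))) ∧
      (d = 2 → ∃ r : ℝ, 0 < r ∧ ∀ U : ℝ → Pentagram.Coeffs d,
        Pentagram.IsSolution (fun u => (-C) • W u) U →
          Pentagram.SolvesBoussinesq (fun t x => Pentagram.topCoeff (U (r * t)) x)) := by
  obtain ⟨hd, P, Q, hP, hQ, hinv⟩ := Pentagram.exists_isGenericInverse hT
  have hC : 0 < Pentagram.limitConst d P := Pentagram.limitConst_pos (by omega)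
  have hW := Pentagram.isKdVField_kdvField (d := d) (by omega)
  refine ⟨Pentagram.limitConst d P, Pentagram.kdvField, hC, hW, ⟨P, Q, hinv, ?_⟩,
    fun U => Pentagram.isSolution_time_change_iff hC.ne' _ U, ?_⟩
  -- The time reversal in the definition cancels the minus sign, leaving the envelope flow with
  -- constant +C.
  · simpa only [neg_smul, neg_neg] using Pentagram.isEnvelopeLimit hd hP hQ hW
  · rintro rfl
    -- Chosen so that r²C² = 3.
    refine ⟨√3 / Pentagram.limitConst 2 P, by positivity, fun U hU =>
      Pentagram.solvesBoussinesq_of_isSolution ?_ hU⟩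
    rw [div_pow, Real.sq_sqrt (by norm_num)]
    field_simp
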